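/- Let $d\ge 0$ and let $(J_{x,y})_{x,y\in\mathbb Z^d}$ be real couplings with $J_{x,y}=J_{y,x}$ such that - (C1) $J_{x,y}=J_{0,y-x}$ for all $x,y$; - (C2) $J_{x,y}\ge 0$ for all $x,y$; - (C3) $\sum_{x\in\mathbb Z^d}J_{0,x}<\infty$; - (C4) for every $x\in\mathbb Z^d$ there are $m\ge 0$ and $0=x_0,x_1,\dots,x_m=x$ in $\mathbb Z^d$ with $\prod_{i=0}^{m-1}J_{x_i,x_{i+1}}>0$. Let $\beta\ge 0$. A current on a set $G$ is a function $\mathbf n$ from the unordered pairs of distinct elements of $G$ (the edges of $G$) to $\{0,1,2,\dots\}$, and its sources are the vertices $x$ for which $\sum_{y}\mathbf n_{x,y}$ is odd. For a finite set $G\subset\mathbb Z^d$, let $\mathrm P^0_{G,\beta}$ be the law of the random current on $G$ that gives to each current $\mathbf n$ without sources a probability proportional to $w_\beta(\mathbf n)=\prod_{\{x,y\}\subset G}(\beta J_{x,y})^{\mathbf n_{x,y}}/\mathbf n_{x,y}!$, and probability $0$ to every other current. Let $\mathrm P^+_{G,\beta}$ be the law obtained in the same way from currents on $G\cup\{\delta\}$,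 where $\delta\notin\mathbb Z^d$ is an additional vertex, which is never counted as a source, with $J_{x,\delta}=\sum_{y\in\mathbb Z^d\setminus G}J_{x,y}$ for $x\in G$, by restricting the current to the edges of $G$. Both are regarded as laws on currents on $\mathbb Z^d$, by setting the current to $0$ on all edges not contained in $G$. Let $\Lambda_L=[-L,L]^d\cap\mathbb Z^d$. Then for $\#\in\{0,+\}$ there is a probability measure $\mathrm P^\#_\beta$ on currents on $\mathbb Z^d$ such that $\lim_{L\to\infty}\mathrm P^\#_{\Lambda_L,\beta}[\mathcal A]=\mathrm P^\#_\beta[\mathcal A]$ for every event $\mathcal A$ depending on finitely many edges (such a measure is necessarily unique). Let $\mathbf n_1,\mathbf n_2$ be independent with laws $\mathrm P^0_\beta$ and $\mathrm P^+_\beta$, call an edge $\{x,y\}$ open if $(\mathbf n_1+\mathbf n_2)_{x,y}>0$, and let $\mathbb P_\beta$ be the law of the configuration of open and closed edges. Then, $\mathbb P_\beta$-almost surely, the graph on $\mathbb Z^d$ formed by the open edges has at most one infinite connected component. -/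

import Mathlib

open MeasureTheory Filter Topology
open scoped ENNReal Nat

noncomputable section

/-- Unordered pairs of distinct vertices of `V`. -/
abbrev Bond (V : Type*) := {e : Sym2 V // ¬ e.IsDiag}

/-- Currents on `V`: functions from bonds to `{0, 1, 2, …}` (with the product σ-algebra). -/
abbrev Current (V : Type*) := Bond V → ℕ

/-- The bonds with both endpoints in the finite set `G`. -/
def bondsIn {V : Type*} [DecidableEq V] (G : Finset V) : Finset (Bond V) :=
  G.sym2.subtype (fun e => ¬ e.IsDiag)

/-- Currents on the finite set `G`. -/
abbrev FinCurrent {V : Type*} [DecidableEq V] (G : Finset V) := bondsIn G → ℕ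

/-- A current on `G`, viewed as a current on `V` that vanishes on the bonds not contained in `G`. -/
def FinCurrent.extend {V : Type*} [DecidableEq V] {G : Finset V} (n : FinCurrent G) : Current V :=
  fun e => if h : e ∈ bondsIn G then n ⟨e, h⟩ else 0

/-- The total current `∑_y n_{x,y}` at the vertex `x`. -/
def FinCurrent.flux {V : Type*} [DecidableEq V] {G : Finset V} (n : FinCurrent G) (x : V) : ℕ :=
  ∑ e : bondsIn G with x ∈ e.1.1, n e

/-- The sources of `n` among the vertices of `S`. -/
def FinCurrent.sources {V : Type*} [DecidableEq V] {G : Finset V} (S : Finset V)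
    (n : FinCurrent G) : Finset V :=
  S.filter (fun x => Odd (n.flux x))

/-- The weight `w_β(n) = ∏_{x,y} (β K_{x,y})^{n_{x,y}} / n_{x,y}!`. -/
def FinCurrent.weight {V : Type*} [DecidableEq V] {G : Finset V} (β : ℝ) (K : Sym2 V → ℝ)
    (n : FinCurrent G) : ℝ :=
  ∏ e : bondsIn G, (β * K e.1.1) ^ n e / ((n e)! : ℝ)

/-- `w_β(n)` if `n` has no sources in `S`, and `0` otherwise. -/
def FinCurrent.sourcelessWeight {V : Type*} [DecidableEq V] {G : Finset V} (β : ℝ)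
    (K : Sym2 V → ℝ) (S : Finset V) (n : FinCurrent G) : ℝ≥0∞ :=
  if n.sources S = ∅ then ENNReal.ofReal (n.weight β K) else 0

/-- The law of the random current on `G` with couplings `K` and no sources in `S`: the current `n`
has probability `w_β(n) 1{∂n = ∅} / ∑_m w_β(m) 1{∂m = ∅}`. -/
def finiteCurrentLaw {V : Type*} [DecidableEq V] (β : ℝ) (K : Sym2 V → ℝ) (S G : Finset V) :
    Measure (Current V) :=
  Measure.sum fun n : FinCurrent G =>
    (n.sourcelessWeight β K S / ∑' m : FinCurrent G, m.sourcelessWeight β K S) •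
      Measure.dirac n.extend

/-- The couplings on `V ∪ {δ}`, the ghost vertex `δ` being `none`:
`J_{x,δ} = ∑_{y ∉ G} J_{x,y}`. -/
def ghostCoupling {V : Type*} [DecidableEq V] (J : Sym2 V → ℝ) (G : Finset V) :
    Sym2 (Option V) → ℝ :=
  Sym2.lift ⟨fun a b =>
    match a, b with
    | some x, some y => J s(x, y)
    | some x, none => ∑' y, if y ∈ G then 0 else J s(x, y)
    | none, some y => ∑' x, if x ∈ G then 0 else J s(y, x)
    | none, none => 0, by
      rintro (_ | x) (_ | y)
      · rfl
      · rfl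
      · rfl
      · exact congrArg J Sym2.eq_swap⟩

/-- A bond of `V` as a bond of `V ∪ {δ}`. -/
def Bond.toGhost {V : Type*} (e : Bond V) : Bond (Option V) :=
  ⟨e.1.map some, fun h => e.2 ((Sym2.isDiag_map (Option.some_injective V)).1 h)⟩

/-- The random current law on `G` with free boundary conditions. -/
def freeCurrentLaw {V : Type*} [DecidableEq V] (J : Sym2 V → ℝ) (β : ℝ) (G : Finset V) :
    Measure (Current V) :=
  finiteCurrentLaw β J G G

/-- The random current law on `G` with `+` boundary conditions: the law of a current on
`G ∪ {δ}` without sources in `G` (the ghost vertex is never listed as a source), restricted to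
the bonds that do not contain `δ`. -/
def plusCurrentLaw {V : Type*} [DecidableEq V] (J : Sym2 V → ℝ) (β : ℝ) (G : Finset V) :
    Measure (Current V) :=
  (finiteCurrentLaw β (ghostCoupling J G) (G.map Function.Embedding.some)
    (Finset.insertNone G)).map (fun n e => n e.toGhost)

/-- The box `Λ_L = [-L, L]^d`. -/
def latticeBox (d L : ℕ) : Finset (Fin d → ℤ) :=
  Finset.Icc (fun _ => -(L : ℤ)) (fun _ => (L : ℤ))

/-- `P` is a probability measure and `μ L A → P A` for every event `A` depending on finitely
many bonds. (Every subset of `E → ℕ`, with `E` finite, is measurable.) -/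
structure IsInfiniteVolumeLimit {V : Type*} (μ : ℕ → Measure (Current V))
    (P : Measure (Current V)) : Prop where
  isProbabilityMeasure : IsProbabilityMeasure P
  tendsto : ∀ (E : Finset (Bond V)) (A : Set (E → ℕ)),
    Tendsto (fun L => μ L (cylinder E A)) atTop (𝓝 (P (cylinder E A)))

/-- The percolation configuration `n̂` of a current: the bond `e` is open iff `n e > 0`. -/
def Current.trace {V : Type*} (n : Current V) : Bond V → Bool :=
  fun e => decide (0 < n e)

/-- The law of the trace of `n₁ + n₂`, for independent currents with laws `P₁` and `P₂`. -/
def sumTraceLaw {V : Type*} (P₁ P₂ : Measure (Current V)) : Measure (Bond V → Bool) :=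
  (P₁.prod P₂).map (fun p => Current.trace (p.1 + p.2))

/-- The graph of open bonds; its connected components are the clusters. -/
def openGraph {V : Type*} (ω : Bond V → Bool) : SimpleGraph V :=
  SimpleGraph.fromEdgeSet {e | ∃ h : ¬ e.IsDiag, ω ⟨e, h⟩ = true}

/-- Any two infinite clusters coincide. -/
def AtMostOneInfiniteCluster {V : Type*} (ω : Bond V → Bool) : Prop :=
  ∀ C C' : (openGraph ω).ConnectedComponent, C.supp.Infinite → C'.supp.Infinite → C = C'

end

/-! Expanding each bond factor `exp(βJσ_xσ_y)` into a power series and averaging over the spins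
keeps exactly the currents without sources. Hence the probability that a finite-volume current
equals `k` on a finite bond set `E` is the weight of `k` on `E` times a quotient of two Ising
averages, both taken with the bonds of `E` switched off (`finiteCurrentLaw_pointCylinder_eq`). The
two observables are nonnegative combinations of `±1`-valued characters, so Griffiths' second
inequality makes their averages increase with the volume for the free boundary condition and
decrease for the `+` one, where the ghost spin is frozen at `1`. The denominator is at least `1`, so
the probabilities converge, along all finite sets and not only along boxes. They are dominated by
the bare weights, so the laws are tight and the limit measures exist. Convergence along all finite
sets makes the limits translation invariant.

Uniqueness is a Burton–Keane argument for a law that is translation invariant, has summable bond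
probabilities and allows bonds with `J > 0` to be opened. The last property comes from the free
current alone: adding two units to a bond changes no parity and multiplies cylinder probabilities by
an explicit positive factor (`map_addTwo_absolutelyContinuous`).

A furcation set is a finite connected set whose removal leaves at least three infinite pieces of its
cluster. Disjoint furcation sets in a finite `Λ` inject into the vertices outside `Λ` joined to `Λ`
by an open bond (`SimpleGraph.exists_injOn_outerBoundary`). The expected number of bonds leaving a
large box is `o(n^d)` by summability, whereas a furcation set of positive probability would give
order `n^d` disjoint translates. So there are almost surely none. Three infinite clusters could be
joined inside a finite set to form one, so there are at most two infinite clusters.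

Two clusters are excluded without ergodicity. Having at least two infinite clusters is a
translation-invariant event, and opening finitely many bonds does not change such an event up to a
null set (`ae_openBonds_mem_iff`). If two infinite clusters are joined, another one must therefore
remain, and it comes from a third infinite cluster of the original configuration. -/

/-! ### Griffiths' second inequality on finite groups of spins -/

/-- The real value of a sign. -/
def signVal (u : ℤˣ) : ℝ := ((u : ℤ) : ℝ)

@[simp] lemma signVal_one : signVal 1 = 1 := by simp [signVal]

@[simp] lemma signVal_neg_one : signVal (-1) = -1 := by simp [signVal]

lemma signVal_mul (u v : ℤˣ) : signVal (u * v) = signVal u * signVal v := by simp [signVal]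

lemma signVal_pow (u : ℤˣ) (k : ℕ) : signVal (u ^ k) = signVal u ^ k := by simp [signVal]

lemma signVal_prod {ι : Type*} (s : Finset ι) (f : ι → ℤˣ) :
    signVal (∏ i ∈ s, f i) = ∏ i ∈ s, signVal (f i) := by
  simp [signVal, Units.coe_prod]

lemma abs_signVal (u : ℤˣ) : |signVal u| = 1 := by
  rcases Int.units_eq_one_or u with rfl | rfl <;> simp

lemma signVal_le_one (u : ℤˣ) : signVal u ≤ 1 := (le_abs_self _).trans (abs_signVal u).le

/-- Nonnegative combinations of `±1`-valued characters. -/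
inductive PositiveType {Ω : Type*} [Group Ω] : (Ω → ℝ) → Prop
  | char (c : ℝ) (hc : 0 ≤ c) (χ : Ω →* ℤˣ) : PositiveType fun σ => c * signVal (χ σ)
  | add {f g : Ω → ℝ} : PositiveType f → PositiveType g → PositiveType fun σ => f σ + g σ

namespace PositiveType

variable {Ω Ω' : Type*} [Group Ω] [Group Ω'] {f g : Ω → ℝ}

lemma const {c : ℝ} (hc : 0 ≤ c) : PositiveType fun _ : Ω => c := by
  simpa using PositiveType.char c hc (1 : Ω →* ℤˣ)

lemma char_mul {c : ℝ} (hc : 0 ≤ c) (χ : Ω →* ℤˣ) (hf : PositiveType f) :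
    PositiveType fun σ => c * signVal (χ σ) * f σ := by
  induction hf with
  | char c' hc' χ' =>
    convert PositiveType.char (c * c') (mul_nonneg hc hc') (χ * χ') using 2 with σ
    rw [MonoidHom.mul_apply, signVal_mul]; ring
  | add _ _ h₁ h₂ =>
    convert h₁.add h₂ using 2
    ring

lemma mul (hf : PositiveType f) (hg : PositiveType g) : PositiveType fun σ => f σ * g σ := by
  induction hf with
  | char c hc χ => exact char_mul hc χ hg
  | add _ _ h₁ h₂ =>
    convert h₁.add h₂ using 2
    ring

lemma prod {ι : Type*} (s : Finset ι) {f : ι → Ω → ℝ} (hf : ∀ i ∈ s, PositiveType (f i)) :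
    PositiveType fun σ => ∏ i ∈ s, f i σ := by
  classical
  induction s using Finset.induction_on with
  | empty => simpa using const zero_le_one
  | insert a s ha ih =>
    simp only [Finset.prod_insert ha]
    exact (hf a (by simp)).mul (ih fun i hi => hf i (by simp [hi]))

lemma comp (hf : PositiveType f) (θ : Ω' →* Ω) : PositiveType fun σ => f (θ σ) := by
  induction hf with
  | char c hc χ => exact PositiveType.char c hc (χ.comp θ)
  | add _ _ h₁ h₂ => exact h₁.add h₂

/-- For a character, `χ(σ) - χ(στ) = (1 - χ(τ)) χ(σ)`, and `1 - χ(τ)` is `0` or `2`. Such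
differences appear in the duplicated-variable proof of Griffiths' inequality. -/
lemma sub_mul_right (hf : PositiveType f) (τ : Ω) :
    PositiveType fun σ => f σ - f (σ * τ) := by
  induction hf with
  | char c hc χ =>
    convert PositiveType.char (c * (1 - signVal (χ τ)))
      (mul_nonneg hc (sub_nonneg.2 (signVal_le_one _))) χ using 2 with σ
    simp only [map_mul, signVal_mul]; ring
  | add _ _ h₁ h₂ =>
    convert h₁.add h₂ using 2
    ring

/-- Since `χ(σ) = ±1`, the exponential is `cosh c + sinh c · χ(σ)`. -/
lemma exp_char {c : ℝ} (hc : 0 ≤ c) (χ : Ω →* ℤˣ) :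
    PositiveType fun σ => Real.exp (c * signVal (χ σ)) := by
  have h : (fun σ => Real.exp (c * signVal (χ σ))) =
      fun σ => Real.cosh c + Real.sinh c * signVal (χ σ) := by
    ext σ
    rcases Int.units_eq_one_or (χ σ) with h | h
    · simp [h, Real.cosh_add_sinh]
    · simp [h, ← sub_eq_add_neg, Real.cosh_sub_sinh]
  rw [h]
  exact (const (Real.cosh_pos c).le).add (PositiveType.char _ (Real.sinh_nonneg_iff.2 hc) χ)

lemma one_add_char (χ : Ω →* ℤˣ) : PositiveType fun σ => 1 + signVal (χ σ) := by
  simpa using (const (Ω := Ω) zero_le_one).add (PositiveType.char 1 zero_le_one χ)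

end PositiveType

lemma sum_signVal_eq_zero {Ω : Type*} [Group Ω] [Fintype Ω] (χ : Ω →* ℤˣ) {τ : Ω}
    (hτ : χ τ = -1) : ∑ σ, signVal (χ σ) = 0 := by
  have h : ∑ σ, signVal (χ σ) = ∑ σ, signVal (χ (σ * τ)) :=
    (Fintype.sum_equiv (Equiv.mulRight τ) _ _ fun σ => rfl).symm
  simp only [map_mul, signVal_mul] at h
  rw [hτ, ← Finset.sum_mul, signVal_neg_one] at h
  linarith

lemma PositiveType.sum_nonneg {Ω : Type*} [Group Ω] [Fintype Ω] {f : Ω → ℝ}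
    (hf : PositiveType f) : 0 ≤ ∑ σ, f σ := by
  induction hf with
  | char c hc χ =>
    rw [← Finset.mul_sum]
    refine mul_nonneg hc ?_
    by_cases h : ∃ τ, χ τ = -1
    · obtain ⟨τ, hτ⟩ := h
      exact (sum_signVal_eq_zero χ hτ).ge
    · push Not at h
      refine Finset.sum_nonneg fun σ _ => ?_
      rw [(Int.units_eq_one_or (χ σ)).resolve_right (h σ)]
      simp
  | add _ _ h₁ h₂ => rw [Finset.sum_add_distrib]; positivity

/-- Weights `w` for which every `σ ↦ w σ * w (σ τ)` is of positive type. -/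
def GinibreWeight {Ω : Type*} [Group Ω] (w : Ω → ℝ) : Prop :=
  ∀ τ, PositiveType fun σ => w σ * w (σ * τ)

namespace GinibreWeight

variable {Ω Ω' : Type*} [Group Ω] [Group Ω']

/-- The product of the two factors is `exp(c (1 + χ(τ)) χ(σ))`, which is `exp(2cχ(σ))` or `1`
according to the sign of `χ(τ)`. -/
lemma exp_char {c : ℝ} (hc : 0 ≤ c) (χ : Ω →* ℤˣ) :
    GinibreWeight fun σ => Real.exp (c * signVal (χ σ)) := by
  intro τ
  rcases Int.units_eq_one_or (χ τ) with h | h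
  · convert PositiveType.exp_char (by positivity : 0 ≤ 2 * c) χ using 2 with σ
    simp only [map_mul, h, mul_one, ← Real.exp_add]; ring_nf
  · convert PositiveType.const (Ω := Ω) zero_le_one using 2 with σ
    simp only [map_mul, signVal_mul, ← Real.exp_add, h]; simp

lemma prod {ι : Type*} (s : Finset ι) {w : ι → Ω → ℝ} (hw : ∀ i ∈ s, GinibreWeight (w i)) :
    GinibreWeight fun σ => ∏ i ∈ s, w i σ := by
  intro τ
  simp only [← Finset.prod_mul_distrib]
  exact PositiveType.prod s fun i hi => hw i hi τ

lemma comp {w : Ω → ℝ} (hw : GinibreWeight w) (θ : Ω' →* Ω) :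
    GinibreWeight fun σ => w (θ σ) := by
  intro τ
  simpa using (hw (θ τ)).comp θ

/-- **Griffiths' second inequality.** -/
theorem griffiths [Fintype Ω] {w f g : Ω → ℝ} (hw : GinibreWeight w) (hf : PositiveType f)
    (hg : PositiveType g) :
    (∑ σ, f σ * w σ) * ∑ σ, g σ * w σ ≤ (∑ σ, f σ * g σ * w σ) * ∑ σ, w σ := by
  -- Duplicated variables: the second configuration is written as `στ`, so that for fixed `τ` the
  -- summand is of positive type in `σ`.
  have h₀ : 0 ≤ ∑ τ, ∑ σ, (f σ - f (σ * τ)) * (g σ - g (σ * τ)) * (w σ * w (σ * τ)) :=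
    Finset.sum_nonneg fun τ _ =>
      (((hf.sub_mul_right τ).mul (hg.sub_mul_right τ)).mul (hw τ)).sum_nonneg
  rw [Finset.sum_comm] at h₀
  have h₁ : ∑ σ, ∑ τ, (f σ - f (σ * τ)) * (g σ - g (σ * τ)) * (w σ * w (σ * τ)) =
      ∑ σ, ∑ τ, (f σ - f τ) * (g σ - g τ) * (w σ * w τ) :=
    -- The substitution `τ ↦ σ⁻¹τ` turns the pair `(σ, στ)` into two independent copies; the sum is
    -- then twice the covariance, up to normalization.
    Finset.sum_congr rfl fun σ _ => Fintype.sum_equiv (Equiv.mulLeft σ) _ _ fun τ => rfl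
  have h₂ : ∑ σ, ∑ τ, (f σ - f τ) * (g σ - g τ) * (w σ * w τ) =
      2 * ((∑ σ, f σ * g σ * w σ) * ∑ σ, w σ) -
        2 * ((∑ σ, f σ * w σ) * ∑ σ, g σ * w σ) := by
    have e₁ := Finset.sum_mul_sum Finset.univ Finset.univ (fun σ => f σ * g σ * w σ) w
    have e₂ := Finset.sum_mul_sum Finset.univ Finset.univ (fun σ => f σ * w σ)
      (fun σ => g σ * w σ)
    have e₃ := Finset.sum_mul_sum Finset.univ Finset.univ w (fun σ => f σ * g σ * w σ)
    have e₄ := Finset.sum_mul_sum Finset.univ Finset.univ (fun σ => g σ * w σ)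
      (fun σ => f σ * w σ)
    have : ∑ σ, ∑ τ, (f σ - f τ) * (g σ - g τ) * (w σ * w τ) =
      (∑ σ, ∑ τ, f σ * g σ * w σ * w τ) + (∑ σ, ∑ τ, w σ * (f τ * g τ * w τ)) -
      (∑ σ, ∑ τ, f σ * w σ * (g τ * w τ)) - ∑ σ, ∑ τ, g σ * w σ * (f τ * w τ) := by
      simp only [← Finset.sum_add_distrib, ← Finset.sum_sub_distrib]
      refine Finset.sum_congr rfl fun σ _ => Finset.sum_congr rfl fun τ _ => ?_
      ring
    rw [this, ← e₁, ← e₂, ← e₃, ← e₄]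
    ring
  rw [h₁, h₂] at h₀
  linarith

end GinibreWeight

/-! ### Sums over all currents as products of one-bond series. -/

/-- Absolute summability is carried through the induction because multiplying the next series by the
sum over the remaining coordinates requires it. -/
lemma hasSum_fin_prod {m : ℕ} (f : Fin m → ℕ → ℝ) (hf : ∀ i, Summable fun k => |f i k|) :
    (Summable fun n : Fin m → ℕ => |∏ i, f i (n i)|) ∧
      HasSum (fun n : Fin m → ℕ => ∏ i, f i (n i)) (∏ i, ∑' k, f i k) := by
  induction m with
  | zero =>
    refine ⟨(hasSum_unique _).summable, ?_⟩
    simp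
  | succ m ih =>
    obtain ⟨h₁, h₂⟩ := ih (fun i => f i.succ) fun i => hf i.succ
    let e : ℕ × (Fin m → ℕ) ≃ (Fin (m + 1) → ℕ) := Fin.consEquiv fun _ => ℕ
    have key (p : ℕ × (Fin m → ℕ)) :
        ∏ i, f i (e p i) = f 0 p.1 * ∏ i : Fin m, f i.succ (p.2 i) := by
      rw [Fin.prod_univ_succ]; rfl
    have hs : Summable fun p : ℕ × (Fin m → ℕ) => |f 0 p.1 * ∏ i : Fin m, f i.succ (p.2 i)| := by
      simp only [abs_mul]
      exact Summable.mul_of_nonneg (f := fun k => |f 0 k|)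
        (g := fun n : Fin m → ℕ => |∏ i : Fin m, f i.succ (n i)|) (hf 0) h₁
        (Pi.le_def.2 fun _ => abs_nonneg _) (Pi.le_def.2 fun _ => abs_nonneg _)
    constructor
    · rw [← e.summable_iff]
      exact hs.congr fun p => by rw [Function.comp_apply, key]
    · rw [← e.hasSum_iff, Fin.prod_univ_succ]
      rw [show (fun n : Fin (m + 1) → ℕ => ∏ i, f i (n i)) ∘ e = _ from funext key]
      exact HasSum.mul (f := f 0) (g := fun n : Fin m → ℕ => ∏ i : Fin m, f i.succ (n i))
        (hf 0).of_abs.hasSum h₂ hs.of_abs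

/-- `∑_n ∏_i f_i(n_i) = ∏_i ∑_k f_i(k)`, for absolutely convergent series. -/
lemma hasSum_pi_prod {ι : Type*} [Fintype ι] (f : ι → ℕ → ℝ)
    (hf : ∀ i, Summable fun k => |f i k|) :
    HasSum (fun n : ι → ℕ => ∏ i, f i (n i)) (∏ i, ∑' k, f i k) := by
  let e : Fin (Fintype.card ι) ≃ ι := (Fintype.equivFin ι).symm
  have h := (hasSum_fin_prod (fun i => f (e i)) fun i => hf (e i)).2
  rw [← (e.arrowCongr (Equiv.refl ℕ)).symm.hasSum_iff] at h
  convert h using 1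
  · ext n
    exact (Fintype.prod_equiv e _ _ fun i => by simp [Equiv.arrowCongr]).symm
  · exact (Fintype.prod_equiv e _ _ fun i => rfl).symm

/-! ### Spin representation of random currents -/

/-- The product of the spins at the two endpoints of a pair. -/
def bondSpin {W : Type*} (e : Sym2 W) : (W → ℤˣ) →* ℤˣ where
  toFun σ := Sym2.lift ⟨fun x y => σ x * σ y, fun _ _ => mul_comm _ _⟩ e
  map_one' := by induction e; simp
  map_mul' σ τ := by induction e; simp [mul_mul_mul_comm]

@[simp] lemma bondSpin_mk {W : Type*} (x y : W) (σ : W → ℤˣ) :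
    bondSpin s(x, y) σ = σ x * σ y := rfl

/-- The spin configurations that are `1` outside the finite set `S`. -/
def spinsOn {W : Type*} (S : Finset W) : Subgroup (W → ℤˣ) where
  carrier := {σ | ∀ x ∉ S, σ x = 1}
  mul_mem' hσ hτ x hx := by simp [hσ x hx, hτ x hx]
  one_mem' _ _ := rfl
  inv_mem' hσ x hx := by simp [hσ x hx]

instance {W : Type*} (S : Finset W) : Finite (spinsOn S) := by
  refine Finite.of_injective (β := S → ℤˣ) (fun σ x => σ.1 x) fun σ τ h => ?_
  ext x : 2
  by_cases hx : x ∈ S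
  · exact congrFun h ⟨x, hx⟩
  · rw [σ.2 x hx, τ.2 x hx]

noncomputable instance {W : Type*} (S : Finset W) : Fintype (spinsOn S) := Fintype.ofFinite _

section

variable {W : Type*} [DecidableEq W]

/-- An endpoint outside `S` has spin `1` and drops out. With `S` the set of real vertices, this is
how the ghost is frozen at `1` and never counted as a source. -/
lemma bondSpin_eq_prod {S : Finset W} {e : Sym2 W} (he : ¬ e.IsDiag) {σ : W → ℤˣ}
    (hσ : σ ∈ spinsOn S) : bondSpin e σ = ∏ x ∈ S with x ∈ e, σ x := by
  induction e with
  | h a b =>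
  rw [Sym2.mk_isDiag_iff] at he
  have h (x : W) : (if x ∈ s(a, b) then σ x else 1) =
      (if x = a then σ x else 1) * (if x = b then σ x else 1) := by
    by_cases h₁ : x = a <;> by_cases h₂ : x = b <;> simp_all
  have h' (a : W) : (∏ x ∈ S, if x = a then σ x else 1) = σ a := by
    rw [Finset.prod_ite_eq' S a σ]
    split_ifs with ha
    · rfl
    · exact (hσ a ha).symm
  rw [Finset.prod_filter, Finset.prod_congr rfl fun x _ => h x, Finset.prod_mul_distrib, h', h',
    bondSpin_mk]

lemma prod_bondSpin_pow {S G : Finset W} (n : FinCurrent G) {σ : W → ℤˣ}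
    (hσ : σ ∈ spinsOn S) :
    ∏ e : bondsIn G, bondSpin e.1.1 σ ^ n e = ∏ x ∈ S, σ x ^ n.flux x := by
  simp_rw [fun e : bondsIn G => bondSpin_eq_prod e.1.2 hσ, FinCurrent.flux,
    ← Finset.prod_pow_eq_pow_sum,
    Finset.prod_filter, ← Finset.prod_pow]
  rw [Finset.prod_comm]
  refine Finset.prod_congr rfl fun x _ => Finset.prod_congr rfl fun e _ => ?_
  split_ifs <;> simp

/-- Orthogonality of characters: regrouped by vertices, the summand is the product of `σ_x` to the
power of the flux at `x`, a character that is trivial exactly when all these fluxes are even. -/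
lemma sum_signVal_prod_bondSpin_pow {S G : Finset W} (n : FinCurrent G) :
    ∑ σ : spinsOn S, signVal (∏ e : bondsIn G, bondSpin e.1.1 σ.1 ^ n e) =
      if n.sources S = ∅ then (Fintype.card (spinsOn S) : ℝ) else 0 := by
  split_ifs with h
  · have h₁ (σ : spinsOn S) : ∏ e : bondsIn G, bondSpin e.1.1 σ.1 ^ n e = 1 := by
      rw [prod_bondSpin_pow n σ.2]
      refine Finset.prod_eq_one fun x hx => ?_
      rw [FinCurrent.sources, Finset.filter_eq_empty_iff] at h
      obtain ⟨k, hk⟩ := Nat.not_odd_iff_even.1 (h hx)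
      rw [hk, ← two_mul, pow_mul, Int.units_sq, one_pow]
    rw [Finset.sum_congr rfl fun σ _ => by rw [h₁ σ, signVal_one]]
    simp
  · obtain ⟨x, hx⟩ := Finset.nonempty_iff_ne_empty.2 h
    rw [FinCurrent.sources, Finset.mem_filter] at hx
    -- Flipping the single spin at a source `x` changes the sign of the character.
    have hτ : Function.update (1 : W → ℤˣ) x (-1) ∈ spinsOn S := by
      intro y hy
      rw [Function.update_of_ne (by rintro rfl; exact hy hx.1)]
      rfl
    let χ : spinsOn S →* ℤˣ :=
      (∏ e : bondsIn G, bondSpin e.1.1 ^ n e).comp (spinsOn S).subtype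
    have hχ (σ : spinsOn S) : χ σ = ∏ e : bondsIn G, bondSpin e.1.1 σ.1 ^ n e := by
      simp [χ]
    simp only [← hχ]
    refine sum_signVal_eq_zero χ (τ := ⟨_, hτ⟩) ?_
    rw [hχ, prod_bondSpin_pow n hτ, Finset.prod_eq_single_of_mem x hx.1]
    · simpa using hx.2.neg_one_pow
    · intro y _ hy
      simp [Function.update_of_ne hy]

/-- Sums over currents without sources in `S` are averages over spins. -/
lemma hasSum_sourceless (S G : Finset W) (F : bondsIn G → ℕ → ℝ)
    (hF : ∀ e, Summable fun k => |F e k|) :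
    HasSum (fun n : FinCurrent G => if n.sources S = ∅ then ∏ e, F e (n e) else 0)
      ((∑ σ : spinsOn S, ∏ e : bondsIn G, ∑' k, F e k * signVal (bondSpin e.1.1 σ.1) ^ k) /
        Fintype.card (spinsOn S)) := by
  have h₁ (σ : spinsOn S) := hasSum_pi_prod
    (fun (e : bondsIn G) k => F e k * signVal (bondSpin e.1.1 σ.1) ^ k) fun e => by
      simpa [abs_mul, abs_pow, abs_signVal] using hF e
  have h₂ := (hasSum_sum fun σ (_ : σ ∈ Finset.univ) => h₁ σ).div_const
    (Fintype.card (spinsOn S) : ℝ)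
  suffices h : ∀ n : FinCurrent G, (if n.sources S = ∅ then ∏ e, F e (n e) else 0) =
      (∑ σ : spinsOn S, ∏ e : bondsIn G, F e (n e) * signVal (bondSpin e.1.1 σ.1) ^ n e) /
        Fintype.card (spinsOn S) by rw [funext h]; exact h₂
  intro n
  have h₃ (σ : spinsOn S) :
      ∏ e : bondsIn G, F e (n e) * signVal (bondSpin e.1.1 σ.1) ^ n e =
        (∏ e, F e (n e)) * signVal (∏ e : bondsIn G, bondSpin e.1.1 σ.1 ^ n e) := by
    rw [Finset.prod_mul_distrib, signVal_prod]
    simp [signVal_pow]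
  simp only [h₃]
  rw [← Finset.mul_sum, sum_signVal_prod_bondSpin_pow]
  have : (Fintype.card (spinsOn S) : ℝ) ≠ 0 := by
    exact_mod_cast Fintype.card_ne_zero
  split_ifs
  · field_simp
  · simp

/-- The currents that agree with `k` on `E`. -/
def pointCylinder {V : Type*} (E : Finset (Bond V)) (k : Current V) : Set (Current V) :=
  {n | ∀ e ∈ E, n e = k e}

lemma measurableSet_pointCylinder {V : Type*} (E : Finset (Bond V)) (k : Current V) :
    MeasurableSet (pointCylinder E k) := by
  have : pointCylinder E k = ⋂ e ∈ E, (fun n : Current V => n e) ⁻¹' {k e} := by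
    ext n; simp [pointCylinder]
  rw [this]
  exact E.measurableSet_biInter fun e _ => measurable_pi_apply e (measurableSet_singleton _)

/-- The Boltzmann weight of a spin configuration. -/
noncomputable def boltzmann (K : Sym2 W → ℝ) (G : Finset W) (σ : W → ℤˣ) : ℝ :=
  ∏ e ∈ bondsIn G, Real.exp (K e.1 * signVal (bondSpin e.1 σ))

lemma boltzmann_pos (K : Sym2 W → ℝ) (G : Finset W) (σ : W → ℤˣ) : 0 < boltzmann K G σ :=
  Finset.prod_pos fun _ _ => Real.exp_pos _

/-- The average of `f` over the spins in `S`, with weight `w`. -/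
noncomputable def spinAverage {W : Type*} (S : Finset W) (w f : (W → ℤˣ) → ℝ) : ℝ :=
  (∑ σ : spinsOn S, f σ.1 * w σ.1) / ∑ σ : spinsOn S, w σ.1

/-- The couplings `K`, set to `0` on the bonds of `E`. -/
noncomputable def couplingOff (E : Finset (Bond W)) (K : Sym2 W → ℝ) : Sym2 W → ℝ :=
  fun e => if e ∈ E.image Subtype.val then 0 else K e

lemma couplingOff_of_mem {E : Finset (Bond W)} (K : Sym2 W → ℝ) {e : Bond W} (he : e ∈ E) :
    couplingOff E K e.1 = 0 := by
  rw [couplingOff, if_pos (Finset.mem_image_of_mem _ he)]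

lemma couplingOff_of_notMem {E : Finset (Bond W)} (K : Sym2 W → ℝ) {e : Bond W} (he : e ∉ E) :
    couplingOff E K e.1 = K e.1 := by
  rw [couplingOff, if_neg]
  simpa [Subtype.val_inj] using he

/-- The weight of the restriction of the current `k` to `E`. -/
noncomputable def currentWeight {W : Type*} (K : Sym2 W → ℝ) (E : Finset (Bond W))
    (k : Current W) : ℝ :=
  ∏ e ∈ E, K e.1 ^ k e / ((k e)! : ℝ)

/-- The product of the bond spins of `E`, with multiplicities given by `k`. -/
def currentSpin {W : Type*} (E : Finset (Bond W)) (k : Current W) : (W → ℤˣ) →* ℤˣ :=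
  ∏ e ∈ E, bondSpin e.1 ^ k e

lemma currentSpin_apply {W : Type*} (E : Finset (Bond W)) (k : Current W) (σ : W → ℤˣ) :
    currentSpin E k σ = ∏ e ∈ E, bondSpin e.1 σ ^ k e := by
  simp [currentSpin]

/-- The Boltzmann factor of the bonds of `E`. -/
noncomputable def bondFactor {W : Type*} (K : Sym2 W → ℝ) (E : Finset (Bond W)) (σ : W → ℤˣ) : ℝ :=
  ∏ e ∈ E, Real.exp (K e.1 * signVal (bondSpin e.1 σ))

lemma boltzmann_eq_bondFactor_mul {K : Sym2 W → ℝ} {G : Finset W} {E : Finset (Bond W)}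
    (hE : E ⊆ bondsIn G) (σ : W → ℤˣ) :
    boltzmann K G σ = bondFactor K E σ * boltzmann (couplingOff E K) G σ := by
  have h (e : Bond W) : Real.exp (K e.1 * signVal (bondSpin e.1 σ)) =
      (if e ∈ E then Real.exp (K e.1 * signVal (bondSpin e.1 σ)) else 1) *
        Real.exp (couplingOff E K e.1 * signVal (bondSpin e.1 σ)) := by
    split_ifs with he
    · simp [couplingOff_of_mem K he]
    · simp [couplingOff_of_notMem K he]
  rw [boltzmann, Finset.prod_congr rfl fun e _ => h e, Finset.prod_mul_distrib, boltzmann,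
    bondFactor, Finset.prod_ite_mem, Finset.inter_eq_right.2 hE]

lemma tsum_exp_term (c s : ℝ) : ∑' k : ℕ, c ^ k / (k ! : ℝ) * s ^ k = Real.exp (c * s) := by
  rw [Real.exp_eq_exp_ℝ, NormedSpace.exp_eq_tsum_div]
  refine tsum_congr fun k => ?_
  rw [mul_pow]; ring

lemma summable_abs_exp_term (c : ℝ) : Summable fun k : ℕ => |c ^ k / (k ! : ℝ)| :=
  (Real.summable_pow_div_factorial c).abs

/-- The probability of a point cylinder, as a quotient of spin sums. -/
lemma finiteCurrentLaw_pointCylinder {β : ℝ} {K : Sym2 W → ℝ} (hK : ∀ e, 0 ≤ β * K e)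
    (S : Finset W) {G : Finset W} {E : Finset (Bond W)} (hE : E ⊆ bondsIn G) (k : Current W) :
    finiteCurrentLaw β K S G (pointCylinder E k) = ENNReal.ofReal
      (currentWeight (fun e => β * K e) E k *
        (∑ σ : spinsOn S, signVal (currentSpin E k σ.1) *
          boltzmann (couplingOff E fun e => β * K e) G σ.1) /
        ∑ σ : spinsOn S, boltzmann (fun e => β * K e) G σ.1) := by
  -- The number of spin configurations divides both the numerator and the partition function, and
  -- cancels at the end.
  obtain ⟨C, hC⟩ : ∃ C : ℝ, C = (Fintype.card (spinsOn S) : ℝ) := ⟨_, rfl⟩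
  have hC0 : 0 < C := by rw [hC]; exact_mod_cast Fintype.card_pos
  let F₀ : bondsIn G → ℕ → ℝ := fun e m => (β * K e.1.1) ^ m / (m ! : ℝ)
  -- The indicator of the cylinder is a product over bonds, so it is absorbed into the one-bond
  -- series: on `E` only the term `m = k e` survives.
  let F : bondsIn G → ℕ → ℝ := fun e m => if e.1 ∈ E ∧ m ≠ k e.1 then 0 else F₀ e m
  have hF₀ (e m) : 0 ≤ F₀ e m := div_nonneg (pow_nonneg (hK _) _) (by positivity)
  have hF (e m) : 0 ≤ F e m := by dsimp only [F]; split_ifs; exacts [le_rfl, hF₀ e m]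
  have s₀ (e) : Summable fun m => |F₀ e m| := summable_abs_exp_term _
  have s (e) : Summable fun m => |F e m| := by
    refine Summable.of_nonneg_of_le (fun _ => abs_nonneg _) (fun m => ?_) (s₀ e)
    dsimp only [F]; split_ifs
    · simp
    · rfl
  have H₀ := hasSum_sourceless S G F₀ s₀
  have H := hasSum_sourceless S G F s
  have v₀ : ∑ σ : spinsOn S, ∏ e : bondsIn G,
      ∑' m, F₀ e m * signVal (bondSpin e.1.1 σ.1) ^ m =
      ∑ σ : spinsOn S, boltzmann (fun e => β * K e) G σ.1 := by
    refine Finset.sum_congr rfl fun σ _ => ?_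
    rw [boltzmann, ← Finset.prod_coe_sort (bondsIn G)]
    exact Finset.prod_congr rfl fun e _ => tsum_exp_term _ _
  have v : ∑ σ : spinsOn S, ∏ e : bondsIn G,
      ∑' m, F e m * signVal (bondSpin e.1.1 σ.1) ^ m =
      currentWeight (fun e => β * K e) E k *
        (∑ σ : spinsOn S, signVal (currentSpin E k σ.1) *
          boltzmann (couplingOff E fun e => β * K e) G σ.1) := by
    rw [Finset.mul_sum]
    refine Finset.sum_congr rfl fun σ _ => ?_
    -- On a bond of `E` the series is its single surviving term, elsewhere it is the full
    -- exponential. This is why the couplings of `E` are off in the numerator.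
    have h (e : Bond W) : (if e ∈ E then (β * K e.1) ^ k e / ((k e)! : ℝ) *
        signVal (bondSpin e.1 σ.1) ^ k e else 1) *
        Real.exp (couplingOff E (fun e => β * K e) e.1 * signVal (bondSpin e.1 σ.1)) =
        ∑' m, (if e ∈ E ∧ m ≠ k e then 0 else (β * K e.1) ^ m / (m ! : ℝ)) *
          signVal (bondSpin e.1 σ.1) ^ m := by
      by_cases he : e ∈ E
      · rw [tsum_eq_single (k e) (by intro m hm; simp [he, hm])]
        simp [he, couplingOff_of_mem]
      · simp [he, couplingOff_of_notMem, tsum_exp_term]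
    calc ∏ e : bondsIn G, ∑' m, F e m * signVal (bondSpin e.1.1 σ.1) ^ m
        = ∏ e ∈ bondsIn G, ∑' m, (if e ∈ E ∧ m ≠ k e then 0 else (β * K e.1) ^ m / (m ! : ℝ)) *
          signVal (bondSpin e.1 σ.1) ^ m := by rw [← Finset.prod_coe_sort (bondsIn G)]
      _ = _ := by
        rw [← Finset.prod_congr rfl fun e _ => h e, Finset.prod_mul_distrib,
          Finset.prod_ite_mem, Finset.inter_eq_right.2 hE, Finset.prod_mul_distrib,
          currentSpin_apply, signVal_prod, currentWeight, boltzmann]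
        simp only [signVal_pow]
        ring
  rw [v₀] at H₀
  rw [v] at H
  have w₀ (n : FinCurrent G) : n.sourcelessWeight β K S =
      ENNReal.ofReal (if n.sources S = ∅ then ∏ e, F₀ e (n e) else 0) := by
    rw [FinCurrent.sourcelessWeight]
    split_ifs
    · rfl
    · simp
  have w (n : FinCurrent G) : n.sourcelessWeight β K S *
      (pointCylinder E k).indicator 1 n.extend =
      ENNReal.ofReal (if n.sources S = ∅ then ∏ e, F e (n e) else 0) := by
    rw [w₀]
    by_cases hn : n.extend ∈ pointCylinder E k
    · have : ∀ e, F e (n e) = F₀ e (n e) := by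
        intro e
        refine if_neg ?_
        rintro ⟨he, h⟩
        have := hn e.1 he
        rw [FinCurrent.extend, dif_pos e.2] at this
        exact h this
      simp [hn, this]
    · rw [Set.indicator_of_notMem hn, mul_zero]
      simp only [pointCylinder, Set.mem_ofPred_eq, not_forall] at hn
      obtain ⟨e, he, hne⟩ := hn
      rw [FinCurrent.extend, dif_pos (hE he)] at hne
      have : ∏ e, F e (n e) = 0 :=
        Finset.prod_eq_zero (Finset.mem_univ ⟨e, hE he⟩) (if_pos ⟨he, hne⟩)
      rw [this, ite_self, ENNReal.ofReal_zero]
  have nn₀ (n : FinCurrent G) : 0 ≤ if n.sources S = ∅ then ∏ e, F₀ e (n e) else 0 := by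
    split_ifs
    exacts [Finset.prod_nonneg fun e _ => hF₀ e _, le_rfl]
  have nn (n : FinCurrent G) : 0 ≤ if n.sources S = ∅ then ∏ e, F e (n e) else 0 := by
    split_ifs
    exacts [Finset.prod_nonneg fun e _ => hF e _, le_rfl]
  have t₀ : ∑' m : FinCurrent G, m.sourcelessWeight β K S = ENNReal.ofReal
      ((∑ σ : spinsOn S, boltzmann (fun e => β * K e) G σ.1) / C) := by
    rw [tsum_congr w₀, ← ENNReal.ofReal_tsum_of_nonneg nn₀ H₀.summable, H₀.tsum_eq, hC]
  have hZ : 0 < ∑ σ : spinsOn S, boltzmann (fun e => β * K e) G σ.1 :=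
    Finset.sum_pos (fun σ _ => boltzmann_pos _ _ _) ⟨1, Finset.mem_univ _⟩
  rw [finiteCurrentLaw, Measure.sum_apply _ (measurableSet_pointCylinder E k)]
  simp only [Measure.smul_apply, smul_eq_mul,
    Measure.dirac_apply' _ (measurableSet_pointCylinder E k)]
  have : ∀ n : FinCurrent G, n.sourcelessWeight β K S /
      (∑' m : FinCurrent G, m.sourcelessWeight β K S) *
        (pointCylinder E k).indicator 1 n.extend =
      ENNReal.ofReal (if n.sources S = ∅ then ∏ e, F e (n e) else 0) *
        (∑' m : FinCurrent G, m.sourcelessWeight β K S)⁻¹ := by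
    intro n
    rw [← w, div_eq_mul_inv]; ring
  rw [tsum_congr this, ENNReal.tsum_mul_right, t₀,
    ← ENNReal.ofReal_tsum_of_nonneg nn H.summable, H.tsum_eq, ← div_eq_mul_inv,
    ← ENNReal.ofReal_div_of_pos (by positivity)]
  congr 1
  rw [← hC]
  field_simp

end

/-! ### Monotonicity of spin averages in the volume -/

lemma sum_spinsOn_pos {W : Type*} {S : Finset W} {w : (W → ℤˣ) → ℝ} (hw : ∀ σ, 0 < w σ) :
    0 < ∑ σ : spinsOn S, w σ.1 :=
  Finset.sum_pos (fun σ _ => hw σ.1) ⟨1, Finset.mem_univ _⟩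

lemma spinAverage_nonneg {W : Type*} {S : Finset W} {w f : (W → ℤˣ) → ℝ} (hw : ∀ σ, 0 < w σ)
    (hw' : PositiveType w) (hf : PositiveType f) : 0 ≤ spinAverage S w f :=
  div_nonneg ((hf.mul hw').comp (spinsOn S).subtype).sum_nonneg (sum_spinsOn_pos hw).le

lemma spinAverage_le {W : Type*} {S : Finset W} {w f : (W → ℤˣ) → ℝ} (hw : ∀ σ, 0 < w σ) {C : ℝ}
    (hf : ∀ σ, f σ ≤ C) : spinAverage S w f ≤ C := by
  rw [spinAverage, div_le_iff₀ (sum_spinsOn_pos hw), Finset.mul_sum]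
  exact Finset.sum_le_sum fun σ _ => mul_le_mul_of_nonneg_right (hf _) (hw _).le

/-- Multiplying the weight by a function of positive type increases spin averages. -/
lemma sum_div_sum_le_of_positiveType {W : Type*} {S : Finset W} {w f g : (W → ℤˣ) → ℝ}
    (hw : ∀ σ, 0 < w σ)
    (hw' : GinibreWeight w) (hf : PositiveType f) (hg : PositiveType g)
    (hgw : 0 < ∑ σ : spinsOn S, g σ.1 * w σ.1) :
    spinAverage S w f ≤ spinAverage S (fun σ => g σ * w σ) f := by
  have h := (hw'.comp (spinsOn S).subtype).griffiths (hf.comp (spinsOn S).subtype)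
    (hg.comp (spinsOn S).subtype)
  rw [spinAverage, spinAverage, div_le_div_iff₀ (sum_spinsOn_pos hw) hgw]
  simpa [mul_assoc] using h

section

variable {W : Type*} [DecidableEq W]

lemma mem_bondsIn {G : Finset W} {e : Bond W} : e ∈ bondsIn G ↔ ∀ x ∈ e.1, x ∈ G := by
  simp [bondsIn, Finset.mem_sym2_iff]

lemma prod_bondsIn_insert {M : Type*} [CommMonoid M] {z : W} {G : Finset W} (hz : z ∉ G)
    (g : Sym2 W → M) :
    ∏ e ∈ bondsIn (insert z G), g e.1 = (∏ x ∈ G, g s(x, z)) * ∏ e ∈ bondsIn G, g e.1 := by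
  have h (G : Finset W) : ∏ e ∈ bondsIn G, g e.1 = ∏ e ∈ G.sym2 with ¬ e.IsDiag, g e :=
    Finset.prod_subtype_eq_prod_filter g
  have h' : (insert z G).sym2.filter (fun e => ¬ e.IsDiag) =
      G.image (fun x => s(x, z)) ∪ G.sym2.filter (fun e => ¬ e.IsDiag) := by
    ext e
    induction e with
    | h a b =>
    simp only [Finset.mem_filter, Finset.mk_mem_sym2_iff, Finset.mem_insert, Finset.mem_union,
      Finset.mem_image, Sym2.mk_isDiag_iff, Sym2.eq_iff]
    constructor
    · rintro ⟨⟨rfl | ha, rfl | hb⟩, hab⟩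
      · exact absurd rfl hab
      · exact Or.inl ⟨b, hb, by simp⟩
      · exact Or.inl ⟨a, ha, by simp⟩
      · exact Or.inr ⟨⟨ha, hb⟩, hab⟩
    · rintro (⟨x, hx, ⟨rfl, rfl⟩ | ⟨rfl, rfl⟩⟩ | ⟨⟨ha, hb⟩, hab⟩)
      · exact ⟨⟨Or.inr hx, Or.inl rfl⟩, by rintro rfl; exact hz hx⟩
      · exact ⟨⟨Or.inl rfl, Or.inr hx⟩, by rintro rfl; exact hz hx⟩
      · exact ⟨⟨Or.inr ha, Or.inr hb⟩, hab⟩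
  rw [h, h, h', Finset.prod_union, Finset.prod_image]
  · intro x _ y _ hxy
    rcases Sym2.eq_iff.1 hxy with h | h
    · exact h.1
    · exact h.1.trans h.2
  · rw [Finset.disjoint_left]
    intro e he he'
    obtain ⟨x, -, rfl⟩ := Finset.mem_image.1 he
    simp only [Finset.mem_filter, Finset.mk_mem_sym2_iff] at he'
    exact hz he'.1.2

lemma boltzmann_insert (K : Sym2 W → ℝ) {z : W} {G : Finset W} (hz : z ∉ G) (σ : W → ℤˣ) :
    boltzmann K (insert z G) σ =
      (∏ x ∈ G, Real.exp (K s(x, z) * signVal (bondSpin s(x, z) σ))) * boltzmann K G σ :=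
  prod_bondsIn_insert hz fun e => Real.exp (K e * signVal (bondSpin e σ))

lemma positiveType_boltzmann {K : Sym2 W → ℝ} (hK : ∀ e, 0 ≤ K e) (G : Finset W) :
    PositiveType (boltzmann K G) :=
  PositiveType.prod _ fun _ _ => PositiveType.exp_char (hK _) _

lemma ginibreWeight_boltzmann {K : Sym2 W → ℝ} (hK : ∀ e, 0 ≤ K e) (G : Finset W) :
    GinibreWeight (boltzmann K G) :=
  GinibreWeight.prod _ fun _ _ => GinibreWeight.exp_char (hK _) _

/-- The configuration with the spins outside `S` set to `1`. -/
def truncateSpins (S : Finset W) : (W → ℤˣ) →* (W → ℤˣ) where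
  toFun σ x := if x ∈ S then σ x else 1
  map_one' := by ext; simp
  map_mul' σ τ := by ext x; by_cases h : x ∈ S <;> simp [h]

lemma truncateSpins_mem (S : Finset W) (σ : W → ℤˣ) : truncateSpins S σ ∈ spinsOn S :=
  fun x hx => by simp [truncateSpins, hx]

lemma truncateSpins_of_mem {S : Finset W} {σ : W → ℤˣ} (hσ : σ ∈ spinsOn S) :
    truncateSpins S σ = σ := by
  ext x : 1
  by_cases hx : x ∈ S
  · simp [truncateSpins, hx]
  · simp [truncateSpins, hx, hσ x hx]

lemma truncateSpins_truncateSpins {S T : Finset W} (h : S ⊆ T) (σ : W → ℤˣ) :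
    truncateSpins S (truncateSpins T σ) = truncateSpins S σ := by
  ext x : 1
  by_cases hx : x ∈ S
  · simp [truncateSpins, hx, h hx]
  · simp [truncateSpins, hx]

lemma bondSpin_truncateSpins {S : Finset W} {e : Bond W} (he : e ∈ bondsIn S) (σ : W → ℤˣ) :
    bondSpin e.1 (truncateSpins S σ) = bondSpin e.1 σ := by
  obtain ⟨e, h⟩ := e
  rw [mem_bondsIn] at he
  induction e with
  | h a b =>
  have ha : a ∈ S := he a (by simp)
  have hb : b ∈ S := he b (by simp)
  simp [truncateSpins, ha, hb]

lemma boltzmann_truncateSpins (K : Sym2 W → ℝ) (G : Finset W) (σ : W → ℤˣ) :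
    boltzmann K G (truncateSpins G σ) = boltzmann K G σ :=
  Finset.prod_congr rfl fun e he => by rw [bondSpin_truncateSpins he]

/-- The fibres are cosets of the kernel, so `c` is the order of the kernel. It does not depend on
`g` and cancels in the quotients of `spinAverage`. -/
lemma sum_comp_surjective {Ω Ω' : Type*} [Group Ω] [Group Ω'] [Fintype Ω] [Fintype Ω']
    (θ : Ω' →* Ω) (hθ : Function.Surjective θ) :
    ∃ c : ℝ, 0 < c ∧ ∀ g : Ω → ℝ, ∑ σ, g (θ σ) = c * ∑ σ, g σ := by
  classical
  refine ⟨((Finset.univ.filter fun σ => θ σ = 1).card : ℝ), ?_, fun g => ?_⟩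
  · exact_mod_cast Finset.card_pos.2 ⟨1, by simp⟩
  · rw [← Finset.sum_fiberwise Finset.univ θ, Finset.mul_sum]
    refine Finset.sum_congr rfl fun σ _ => ?_
    rw [Finset.sum_congr rfl (g := fun _ => g σ) (by simp +contextual), Finset.sum_const,
      nsmul_eq_mul, MonoidHom.card_fiber_eq_of_mem_range θ (hθ σ) (hθ 1)]

/-- Spins on which neither the weight nor the observable depends can be added freely. -/
lemma spinAverage_of_subset {S T : Finset W} (h : S ⊆ T) {w f : (W → ℤˣ) → ℝ}
    (hw : ∀ σ, w (truncateSpins S σ) = w σ) (hf : ∀ σ, f (truncateSpins S σ) = f σ) :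
    spinAverage T w f = spinAverage S w f := by
  let θ : spinsOn T →* spinsOn S :=
    ((truncateSpins S).comp (spinsOn T).subtype).codRestrict (spinsOn S)
      fun σ => truncateSpins_mem S σ.1
  have hθ : Function.Surjective θ := by
    intro σ
    refine ⟨⟨σ.1, fun x hx => σ.2 x fun hx' => hx (h hx')⟩, ?_⟩
    exact Subtype.ext (truncateSpins_of_mem σ.2)
  obtain ⟨c, hc, H⟩ := sum_comp_surjective θ hθ
  have h₁ := H fun σ => f σ.1 * w σ.1
  have h₂ := H fun σ => w σ.1
  have e (σ : spinsOn T) : (θ σ).1 = truncateSpins S σ.1 := rfl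
  simp only [e, hw, hf] at h₁ h₂
  rw [spinAverage, spinAverage, h₁, h₂, mul_div_mul_left _ _ hc.ne']

/-- With free boundary conditions, spin averages increase with the volume. -/
lemma spinAverage_free_le {K : Sym2 W → ℝ} (hK : ∀ e, 0 ≤ K e) {G G' : Finset W} (h : G ⊆ G')
    {f : (W → ℤˣ) → ℝ} (hf : PositiveType f) (hf' : ∀ σ, f (truncateSpins G σ) = f σ) :
    spinAverage G (boltzmann K G) f ≤ spinAverage G' (boltzmann K G') f := by
  have hb : bondsIn G ⊆ bondsIn G' := fun e he =>
    mem_bondsIn.2 fun x hx => h (mem_bondsIn.1 he x hx)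
  -- Enlarging the volume amounts to adding free spins, which changes nothing, and then multiplying
  -- the weight by the factor `g` of the new bonds, which is of positive type.
  obtain ⟨g, hg⟩ : ∃ g : (W → ℤˣ) → ℝ, g = fun σ =>
      ∏ e ∈ bondsIn G' \ bondsIn G, Real.exp (K e.1 * signVal (bondSpin e.1 σ)) := ⟨_, rfl⟩
  have hg₀ (σ) : 0 < g σ := by rw [hg]; exact Finset.prod_pos fun _ _ => Real.exp_pos _
  have hg₁ : PositiveType g := by
    rw [hg]; exact PositiveType.prod _ fun _ _ => PositiveType.exp_char (hK _) _
  have hg₂ : boltzmann K G' = fun σ => g σ * boltzmann K G σ := by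
    rw [hg]; ext σ; exact (Finset.prod_sdiff hb).symm
  rw [← spinAverage_of_subset h (boltzmann_truncateSpins K G) hf', hg₂]
  exact sum_div_sum_le_of_positiveType (boltzmann_pos K G) (ginibreWeight_boltzmann hK G) hf hg₁
    (sum_spinsOn_pos (w := fun σ => g σ * boltzmann K G σ) fun σ =>
      mul_pos (hg₀ σ) (boltzmann_pos K G σ))

lemma exists_tendsto_spinAverage_free {K : Sym2 W → ℝ} (hK : ∀ e, 0 ≤ K e) {G₀ : Finset W}
    {f : (W → ℤˣ) → ℝ} (hf : PositiveType f) (hf' : ∀ σ, f (truncateSpins G₀ σ) = f σ)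
    {C : ℝ} (hC : ∀ σ, f σ ≤ C) :
    ∃ l, Tendsto (fun G => spinAverage G (boltzmann K G) f) atTop (𝓝 l) := by
  -- Monotonicity is available only for volumes containing `G₀`, on which `f` depends. Elsewhere the
  -- value `0` keeps `h` monotone, because the averages are nonnegative.
  let h : Finset W → ℝ := fun G => if G₀ ⊆ G then spinAverage G (boltzmann K G) f else 0
  have nn (G : Finset W) : 0 ≤ spinAverage G (boltzmann K G) f :=
    spinAverage_nonneg (boltzmann_pos K G) (positiveType_boltzmann hK G) hf
  have hm : Monotone h := by
    intro G G' hGG'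
    dsimp only [h]
    by_cases h₁ : G₀ ⊆ G
    · rw [if_pos h₁, if_pos (h₁.trans hGG')]
      refine spinAverage_free_le hK hGG' hf fun σ => ?_
      rw [← hf', truncateSpins_truncateSpins h₁, hf']
    · rw [if_neg h₁]
      split_ifs
      exacts [nn G', le_rfl]
  refine ⟨⨆ G, h G, (tendsto_atTop_ciSup hm ⟨max C 0, ?_⟩).congr' ?_⟩
  · rintro _ ⟨G, rfl⟩
    dsimp only [h]
    split_ifs
    · exact (spinAverage_le (boltzmann_pos K G) hC).trans (le_max_left _ _)
    · exact le_max_right _ _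
  · filter_upwards [eventually_ge_atTop G₀] with G hG
    exact if_pos hG

end

/-! ### The `+` boundary condition and the ghost vertex. -/

section

variable {V : Type*} [DecidableEq V]

@[simp] lemma ghostCoupling_some_some (J : Sym2 V → ℝ) (G : Finset V) (x y : V) :
    ghostCoupling J G s(some x, some y) = J s(x, y) := rfl

@[simp] lemma ghostCoupling_some_none (J : Sym2 V → ℝ) (G : Finset V) (x : V) :
    ghostCoupling J G s(some x, none) = ∑' y, if y ∈ G then 0 else J s(x, y) := rfl

lemma ghostCoupling_nonneg {J : Sym2 V → ℝ} (hJ : ∀ e, 0 ≤ J e) (G : Finset V)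
    (e : Sym2 (Option V)) : 0 ≤ ghostCoupling J G e := by
  have h (x : V) : 0 ≤ ∑' y, if y ∈ G then 0 else J s(x, y) :=
    tsum_nonneg fun y => by split_ifs; exacts [le_rfl, hJ _]
  induction e with
  | h a b =>
    rcases a with _ | a <;> rcases b with _ | b
    exacts [le_rfl, h b, h a, hJ _]

lemma tsum_outside_insert {f : V → ℝ} (hf : Summable f) {z : V} {G : Finset V} (hz : z ∉ G) :
    (∑' y, if y ∈ G then 0 else f y) = f z + ∑' y, if y ∈ insert z G then 0 else f y := by
  have h (G : Finset V) : Summable fun y => if y ∈ G then 0 else f y := by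
    have := hf.indicator (G : Set V)ᶜ
    refine this.congr fun y => ?_
    by_cases hy : y ∈ G <;> simp [hy]
  rw [(h G).tsum_eq_add_tsum_ite z, if_neg hz]
  congr 1
  refine tsum_congr fun y => ?_
  by_cases hy : y = z <;> simp [hy]

/-- Freezing the spin at `z` to `1` merges `z` with the ghost vertex. -/
lemma boltzmann_ghostCoupling_insert {J : Sym2 V → ℝ} (hJ : ∀ x, Summable fun y => J s(x, y))
    {z : V} {G : Finset V} (hz : z ∉ G) {σ : Option V → ℤˣ} (hσz : σ (some z) = 1)
    (hσ : σ none = 1) :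
    boltzmann (ghostCoupling J (insert z G)) (Finset.insertNone (insert z G)) σ =
      Real.exp (ghostCoupling J (insert z G) s(some z, none)) *
        boltzmann (ghostCoupling J G) (Finset.insertNone G) σ := by
  have h₁ (G : Finset V) : Finset.insertNone G = insert none (G.map Function.Embedding.some) := by
    ext (_ | x) <;> simp
  have h₂ (G : Finset V) : none ∉ G.map Function.Embedding.some := by simp
  have h₃ : some z ∉ G.map Function.Embedding.some := by simpa using hz
  have h₄ : boltzmann (ghostCoupling J (insert z G)) (G.map Function.Embedding.some) σ =
      boltzmann (ghostCoupling J G) (G.map Function.Embedding.some) σ := by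
    refine Finset.prod_congr rfl fun e he => ?_
    obtain ⟨e, he'⟩ := e
    rw [mem_bondsIn] at he
    induction e with
    | h a b =>
    have ha := he a (by simp)
    have hb := he b (by simp)
    obtain ⟨x, -, rfl⟩ := Finset.mem_map.1 ha
    obtain ⟨y, -, rfl⟩ := Finset.mem_map.1 hb
    rfl
  -- The bonds of `x ∈ G` to `z` and to the ghost now act in the same way, and their couplings add
  -- up to the ghost coupling of `x` relative to `G`. The bond from `z` to the ghost gives the
  -- constant factor.
  rw [h₁, h₁, boltzmann_insert _ (h₂ _), boltzmann_insert _ (h₂ _), Finset.map_insert,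
    Function.Embedding.some_apply, boltzmann_insert _ h₃, h₄, Finset.prod_insert h₃]
  simp only [Finset.prod_map, Function.Embedding.some_apply, bondSpin_mk, hσ, hσz, mul_one,
    signVal_one, ghostCoupling_some_some, ghostCoupling_some_none,
    tsum_outside_insert (hJ _) hz, add_mul, Real.exp_add, Finset.prod_mul_distrib]
  ring

/-- The factor `1 + σ_z` is twice the indicator of `σ_z = 1`, so it conditions the spin at `z` to be
`1`. -/
lemma sum_one_add_spin {W : Type*} [DecidableEq W] {S : Finset W} {z : W} (hz : z ∉ S)
    (g : (W → ℤˣ) → ℝ) :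
    ∑ σ : spinsOn (insert z S), (1 + signVal (σ.1 z)) * g σ.1 = 2 * ∑ σ : spinsOn S, g σ.1 := by
  have hS : spinsOn S ≤ spinsOn (insert z S) := fun σ hσ x hx =>
    hσ x fun h => hx (Finset.mem_insert_of_mem h)
  rw [Finset.mul_sum]
  refine (Fintype.sum_of_injective (Subgroup.inclusion hS) (Subgroup.inclusion_injective hS)
    _ _ ?_ ?_).symm
  · intro σ hσ
    rcases Int.units_eq_one_or (σ.1 z) with h | h
    · refine absurd ⟨⟨σ.1, fun x hx => ?_⟩, rfl⟩ hσ
      by_cases hxz : x = z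
      · rw [hxz, h]
      · exact σ.2 x (by simp [hxz, hx])
    · simp [h]
  · intro σ
    have : σ.1 z = 1 := σ.2 z hz
    simp only [Subgroup.coe_inclusion, this, signVal_one]
    norm_num

/-- With `+` boundary conditions, spin averages decrease with the volume. -/
lemma antitone_spinAverage_plus {J : Sym2 V → ℝ} (hJ : ∀ e, 0 ≤ J e)
    (hJs : ∀ x, Summable fun y => J s(x, y)) {f : (Option V → ℤˣ) → ℝ} (hf : PositiveType f) :
    Antitone fun G : Finset V => spinAverage (G.map Function.Embedding.some)
      (boltzmann (ghostCoupling J G) (Finset.insertNone G)) f := by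
  rw [Finset.antitone_iff_forall_insert_le]
  intro G z hz
  have hz' : some z ∉ G.map Function.Embedding.some := by simpa using hz
  have hs := sum_one_add_spin hz'
  have hw := fun σ => boltzmann_pos (ghostCoupling J (insert z G))
    (Finset.insertNone (insert z G)) σ
  have hc := Real.exp_pos (ghostCoupling J (insert z G) s(some z, none))
  have hr (σ : spinsOn (G.map Function.Embedding.some)) :=
    boltzmann_ghostCoupling_insert hJs hz (σ.2 (some z) hz') (σ.2 none (by simp))
  rw [Finset.map_insert, Function.Embedding.some_apply]
  -- Multiplying the weight of the larger volume by `1 + σ_z` raises the average. It also freezes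
  -- `z`, which leaves the `+` measure of the smaller volume.
  refine (sum_div_sum_le_of_positiveType (g := fun σ => 1 + signVal (σ (some z))) hw
    (ginibreWeight_boltzmann (ghostCoupling_nonneg hJ _) _) hf
    (PositiveType.one_add_char (Pi.evalMonoidHom (fun _ : Option V => ℤˣ) (some z))) ?_).trans_eq ?_
  · rw [hs]
    exact mul_pos two_pos (sum_spinsOn_pos hw)
  · have e (σ : Option V → ℤˣ) (w : ℝ) : f σ * ((1 + signVal (σ (some z))) * w) =
        (1 + signVal (σ (some z))) * (f σ * w) := by ring
    simp only [spinAverage, e]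
    rw [hs, hs fun σ => f σ * boltzmann (ghostCoupling J (insert z G))
      (Finset.insertNone (insert z G)) σ, mul_div_mul_left _ _ two_ne_zero]
    simp only [hr, mul_left_comm (f _), ← Finset.mul_sum]
    rw [mul_div_mul_left _ _ hc.ne']

lemma exists_tendsto_spinAverage_plus {J : Sym2 V → ℝ} (hJ : ∀ e, 0 ≤ J e)
    (hJs : ∀ x, Summable fun y => J s(x, y)) {f : (Option V → ℤˣ) → ℝ} (hf : PositiveType f) :
    ∃ l, Tendsto (fun G : Finset V => spinAverage (G.map Function.Embedding.some)
      (boltzmann (ghostCoupling J G) (Finset.insertNone G)) f) atTop (𝓝 l) := by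
  refine ⟨_, tendsto_atTop_ciInf (antitone_spinAverage_plus hJ hJs hf) ⟨0, ?_⟩⟩
  rintro _ ⟨G, rfl⟩
  exact spinAverage_nonneg (boltzmann_pos _ _)
    (positiveType_boltzmann (ghostCoupling_nonneg hJ _) _) hf

end

/-! ### Convergence of the finite-volume laws on point cylinders -/

lemma pointCylinder_empty {V : Type*} (k : Current V) : pointCylinder ∅ k = Set.univ := by
  ext n; simp [pointCylinder]

lemma positiveType_currentSpin {W : Type*} (E : Finset (Bond W)) (k : Current W) :
    PositiveType fun σ => signVal (currentSpin E k σ) := by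
  simpa using PositiveType.char 1 zero_le_one (currentSpin E k)

lemma positiveType_bondFactor {W : Type*} {K : Sym2 W → ℝ} (hK : ∀ e, 0 ≤ K e)
    (E : Finset (Bond W)) : PositiveType (bondFactor K E) :=
  PositiveType.prod _ fun _ _ => PositiveType.exp_char (hK _) _

lemma bondFactor_le {W : Type*} {K : Sym2 W → ℝ} (hK : ∀ e, 0 ≤ K e)
    (E : Finset (Bond W)) (σ : W → ℤˣ) : bondFactor K E σ ≤ ∏ e ∈ E, Real.exp (K e.1) :=
  Finset.prod_le_prod (fun _ _ => (Real.exp_pos _).le) fun _ _ =>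
    Real.exp_le_exp.2 (mul_le_of_le_one_right (hK _) (signVal_le_one _))

lemma currentWeight_nonneg {W : Type*} {K : Sym2 W → ℝ} (hK : ∀ e, 0 ≤ K e)
    (E : Finset (Bond W)) (k : Current W) : 0 ≤ currentWeight K E k :=
  Finset.prod_nonneg fun _ _ => div_nonneg (pow_nonneg (hK _) _) (by positivity)

section

variable {W : Type*} [DecidableEq W] {β : ℝ} {K : Sym2 W → ℝ}

lemma couplingOff_nonneg {K : Sym2 W → ℝ} (hK : ∀ e, 0 ≤ K e) (E : Finset (Bond W))
    (e : Sym2 W) : 0 ≤ couplingOff E K e := by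
  rw [couplingOff]; split_ifs
  exacts [le_rfl, hK e]

lemma isProbabilityMeasure_finiteCurrentLaw (hK : ∀ e, 0 ≤ β * K e) (S G : Finset W) :
    IsProbabilityMeasure (finiteCurrentLaw β K S G) := by
  constructor
  have h := finiteCurrentLaw_pointCylinder hK S (Finset.empty_subset (bondsIn G)) 0
  have hZ : 0 < ∑ σ : spinsOn S, boltzmann (fun e => β * K e) G σ.1 :=
    sum_spinsOn_pos (boltzmann_pos _ _)
  have h₁ : couplingOff ∅ (fun e => β * K e) = fun e => β * K e := by
    ext e; simp [couplingOff]
  rw [pointCylinder_empty, h₁] at h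
  rw [h]
  simp [currentWeight, currentSpin, div_self hZ.ne']

/-- Dividing both sums by the partition function with `E` switched off yields averages of two fixed
observables of positive type under the same weight, the form to which monotonicity in the volume
applies. -/
lemma finiteCurrentLaw_pointCylinder_eq (hK : ∀ e, 0 ≤ β * K e)
    (S : Finset W) {G : Finset W} {E : Finset (Bond W)} (hE : E ⊆ bondsIn G) (k : Current W) :
    finiteCurrentLaw β K S G (pointCylinder E k) = ENNReal.ofReal
      (currentWeight (fun e => β * K e) E k *
        spinAverage S (boltzmann (couplingOff E fun e => β * K e) G)
          (fun σ => signVal (currentSpin E k σ)) /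
        spinAverage S (boltzmann (couplingOff E fun e => β * K e) G)
          (bondFactor (fun e => β * K e) E)) := by
  have hZ : 0 < ∑ σ : spinsOn S, boltzmann (couplingOff E fun e => β * K e) G σ.1 :=
    sum_spinsOn_pos (boltzmann_pos _ _)
  rw [finiteCurrentLaw_pointCylinder hK S hE,
    Finset.sum_congr (f := fun σ : spinsOn S => boltzmann (fun e => β * K e) G σ.1) rfl
      fun σ _ => boltzmann_eq_bondFactor_mul hE σ.1, spinAverage, spinAverage,
    mul_div_assoc, mul_div_assoc, div_div_div_cancel_right₀ hZ.ne']

/-- For `k = 0` the formula for the cylinder probability is the inverse of this average, and a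
probability is at most `1`. The bound keeps the denominator away from `0` in the limit. -/
lemma one_le_spinAverage_bondFactor (hK : ∀ e, 0 ≤ β * K e)
    (S : Finset W) {G : Finset W} {E : Finset (Bond W)} (hE : E ⊆ bondsIn G) :
    1 ≤ spinAverage S (boltzmann (couplingOff E fun e => β * K e) G)
      (bondFactor (fun e => β * K e) E) := by
  have := isProbabilityMeasure_finiteCurrentLaw hK S G
  have h := finiteCurrentLaw_pointCylinder_eq hK S hE 0
  have h₁ : spinAverage S (boltzmann (couplingOff E fun e => β * K e) G)
      (fun σ => signVal (currentSpin E 0 σ)) = 1 := by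
    have hZ : 0 < ∑ σ : spinsOn S, boltzmann (couplingOff E fun e => β * K e) G σ.1 :=
      sum_spinsOn_pos (boltzmann_pos _ _)
    simp [spinAverage, currentSpin, div_self hZ.ne']
  have h₂ : 0 < spinAverage S (boltzmann (couplingOff E fun e => β * K e) G)
      (bondFactor (fun e => β * K e) E) := by
    refine div_pos (sum_spinsOn_pos (w := fun σ => bondFactor (fun e => β * K e) E σ *
      boltzmann (couplingOff E fun e => β * K e) G σ) fun σ => ?_)
      (sum_spinsOn_pos (boltzmann_pos _ _))
    exact mul_pos (Finset.prod_pos fun _ _ => Real.exp_pos _) (boltzmann_pos _ _ _)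
  have h₃ := h.symm.trans_le prob_le_one
  rw [h₁, ENNReal.ofReal_le_one] at h₃
  simpa [currentWeight, inv_le_one_iff₀, h₂.not_ge] using h₃

/-- The spin average in the numerator lies in `[0, 1]` and the denominator is at least `1`. The
bound is uniform in the volume, which gives tightness and summable bond probabilities. -/
lemma finiteCurrentLaw_pointCylinder_le (hK : ∀ e, 0 ≤ β * K e)
    (S : Finset W) {G : Finset W} {E : Finset (Bond W)} (hE : E ⊆ bondsIn G) (k : Current W) :
    finiteCurrentLaw β K S G (pointCylinder E k) ≤
      ENNReal.ofReal (currentWeight (fun e => β * K e) E k) := by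
  rw [finiteCurrentLaw_pointCylinder_eq hK S hE]
  refine ENNReal.ofReal_le_ofReal ?_
  have hw := currentWeight_nonneg hK E k
  refine (div_le_self ?_ (one_le_spinAverage_bondFactor hK S hE)).trans ?_
  · exact mul_nonneg hw (spinAverage_nonneg (boltzmann_pos _ _)
      (positiveType_boltzmann (couplingOff_nonneg hK E) G) (positiveType_currentSpin E k))
  · exact mul_le_of_le_one_right hw
      (spinAverage_le (boltzmann_pos _ _) fun σ => signVal_le_one _)

lemma exists_bondsIn_superset (E : Finset (Bond W)) : ∃ G : Finset W, E ⊆ bondsIn G := by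
  refine ⟨E.biUnion fun e => e.1.toFinset, fun e he => mem_bondsIn.2 fun x hx => ?_⟩
  exact Finset.mem_biUnion.2 ⟨e, he, Sym2.mem_toFinset.2 hx⟩

lemma bondsIn_mono {G G' : Finset W} (h : G ⊆ G') : bondsIn G ⊆ bondsIn G' := fun _ he =>
  mem_bondsIn.2 fun x hx => h (mem_bondsIn.1 he x hx)

lemma eventually_subset_bondsIn (E : Finset (Bond W)) :
    ∀ᶠ G : Finset W in atTop, E ⊆ bondsIn G := by
  obtain ⟨G₀, h₀⟩ := exists_bondsIn_superset E
  filter_upwards [eventually_ge_atTop G₀] with G hG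
  exact h₀.trans (bondsIn_mono hG)

lemma tendsto_ofReal_quotient {ι : Type*} {l : Filter ι} [l.NeBot] {a b : ι → ℝ} {c a' b' : ℝ}
    (ha : Tendsto a l (𝓝 a')) (hb : Tendsto b l (𝓝 b')) (hb₁ : ∀ᶠ i in l, 1 ≤ b i) :
    Tendsto (fun i => ENNReal.ofReal (c * a i / b i)) l (𝓝 (ENNReal.ofReal (c * a' / b'))) := by
  have : 1 ≤ b' := ge_of_tendsto hb hb₁
  exact ENNReal.tendsto_ofReal ((ha.const_mul c).div hb (by positivity))

/-- Convergence along all finite sets, directed by inclusion, is needed because a translate of a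
centred box is in general not a centred box; it is the source of translation invariance. -/
lemma exists_tendsto_freeCurrentLaw (hK : ∀ e, 0 ≤ β * K e) (E : Finset (Bond W))
    (k : Current W) :
    ∃ l, Tendsto (fun G => freeCurrentLaw K β G (pointCylinder E k)) atTop (𝓝 l) := by
  obtain ⟨G₀, h₀⟩ := exists_bondsIn_superset E
  have hs {e : Bond W} (he : e ∈ E) (σ) := bondSpin_truncateSpins (h₀ he) σ
  obtain ⟨a, ha⟩ := exists_tendsto_spinAverage_free (G₀ := G₀) (couplingOff_nonneg hK E)
    (positiveType_currentSpin E k)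
    (fun σ => by
      rw [currentSpin_apply, currentSpin_apply, Finset.prod_congr rfl fun e he => by rw [hs he]])
    fun σ => signVal_le_one _
  obtain ⟨b, hb⟩ := exists_tendsto_spinAverage_free (G₀ := G₀) (couplingOff_nonneg hK E)
    (positiveType_bondFactor hK E)
    (fun σ => by
      rw [bondFactor, bondFactor, Finset.prod_congr rfl fun e he => by rw [hs he]])
    (bondFactor_le hK E)
  refine ⟨_, (tendsto_ofReal_quotient (c := currentWeight (fun e => β * K e) E k) ha hb ?_).congr'
    ?_⟩
  · filter_upwards [eventually_subset_bondsIn E] with G hG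
    exact one_le_spinAverage_bondFactor hK G hG
  · filter_upwards [eventually_subset_bondsIn E] with G hG
    exact (finiteCurrentLaw_pointCylinder_eq hK G hG k).symm

end

/-! ### Transfer of the spin formula to the laws with `+` boundary condition. -/

section

variable {V : Type*}

lemma toGhost_injective : Function.Injective (Bond.toGhost (V := V)) := by
  intro e e' h
  exact Subtype.ext (Sym2.map.injective (Option.some_injective V) (congrArg Subtype.val h))

/-- A current on `V`, extended by `0` to the bonds of the ghost vertex. -/
noncomputable def ghostExtend (k : Current V) : Current (Option V) :=
  Function.extend Bond.toGhost k 0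

lemma ghostExtend_toGhost (k : Current V) (e : Bond V) : ghostExtend k e.toGhost = k e :=
  toGhost_injective.extend_apply k 0 e

lemma measurable_forgetGhost :
    Measurable fun (n : Current (Option V)) (e : Bond V) => n e.toGhost :=
  measurable_pi_lambda _ fun e => measurable_pi_apply e.toGhost

variable [DecidableEq V]

@[simp] lemma ghostCoupling_toGhost (J : Sym2 V → ℝ) (G : Finset V) (e : Bond V) :
    ghostCoupling J G e.toGhost.1 = J e.1 := by
  obtain ⟨e, he⟩ := e
  induction e with
  | h a b => rfl

/-- The bonds of `E`, as bonds of the graph with the ghost vertex. -/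
def ghostBonds (E : Finset (Bond V)) : Finset (Bond (Option V)) :=
  E.map ⟨Bond.toGhost, toGhost_injective⟩

lemma plusCurrentLaw_pointCylinder_eq_ghost (J : Sym2 V → ℝ) (β : ℝ) (G : Finset V)
    (E : Finset (Bond V)) (k : Current V) :
    plusCurrentLaw J β G (pointCylinder E k) =
      finiteCurrentLaw β (ghostCoupling J G) (G.map Function.Embedding.some)
        (Finset.insertNone G) (pointCylinder (ghostBonds E) (ghostExtend k)) := by
  rw [plusCurrentLaw, Measure.map_apply measurable_forgetGhost (measurableSet_pointCylinder E k)]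
  congr 1
  ext n
  constructor
  · intro h e he
    obtain ⟨e, he', rfl⟩ := Finset.mem_map.1 he
    exact (h e he').trans (ghostExtend_toGhost k e).symm
  · intro h e he
    exact (h e.toGhost (Finset.mem_map_of_mem _ he)).trans (ghostExtend_toGhost k e)

lemma ghostBonds_subset {E : Finset (Bond V)} {G : Finset V} (hE : E ⊆ bondsIn G) :
    ghostBonds E ⊆ bondsIn (Finset.insertNone G) := by
  intro e he
  obtain ⟨e, he', rfl⟩ := Finset.mem_map.1 he
  refine mem_bondsIn.2 fun x hx => ?_
  obtain ⟨y, hy, rfl⟩ := Sym2.mem_map.1 hx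
  simpa using mem_bondsIn.1 (hE he') y hy

/-- The ghost couplings involve only `J` between `G` and its complement, so switching off bonds
inside `G` leaves them alone. The weight with `E` off is thus again a `+` weight, and its
monotonicity applies. -/
lemma couplingOff_ghostCoupling {J : Sym2 V → ℝ} {β : ℝ} {E : Finset (Bond V)} {G : Finset V}
    (hE : E ⊆ bondsIn G) :
    couplingOff (ghostBonds E) (fun e => β * ghostCoupling J G e) =
      ghostCoupling (couplingOff E fun e => β * J e) G := by
  have hn (x : V) : s(some x, none) ∉ (ghostBonds E).image Subtype.val := by
    intro h
    obtain ⟨e, he, h⟩ := Finset.mem_image.1 h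
    obtain ⟨e, he, rfl⟩ := Finset.mem_map.1 he
    have : none ∈ (Bond.toGhost e).1 := by
      rw [show (Bond.toGhost e).1 = _ from h]; simp
    obtain ⟨y, -, h⟩ := Sym2.mem_map.1 this
    exact Option.some_ne_none _ h
  have h₁ (x : V) : couplingOff (ghostBonds E) (fun e => β * ghostCoupling J G e)
      s(some x, none) = ghostCoupling (couplingOff E fun e => β * J e) G s(some x, none) := by
    rw [couplingOff, if_neg (hn x), ghostCoupling_some_none, ghostCoupling_some_none,
      ← tsum_mul_left]
    refine tsum_congr fun y => ?_
    by_cases hy : y ∈ G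
    · simp [hy]
    · rw [if_neg hy, if_neg hy, couplingOff, if_neg]
      intro h
      obtain ⟨e, he, h⟩ := Finset.mem_image.1 h
      exact hy (mem_bondsIn.1 (hE he) y (by rw [h]; simp))
  ext e
  induction e with
  | h a b =>
  rcases a with _ | x <;> rcases b with _ | y
  · simp [couplingOff, ghostCoupling]
  · rw [Sym2.eq_swap]; exact h₁ y
  · exact h₁ x
  · rw [ghostCoupling_some_some, couplingOff, couplingOff, ghostCoupling_some_some]
    have : s(some x, some y) ∈ (ghostBonds E).image Subtype.val ↔
        s(x, y) ∈ E.image Subtype.val := by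
      simp only [Finset.mem_image, ghostBonds, Finset.mem_map, Function.Embedding.coeFn_mk]
      constructor
      · rintro ⟨_, ⟨e, he, rfl⟩, h⟩
        exact ⟨e, he, Sym2.map.injective (Option.some_injective V) h⟩
      · rintro ⟨e, he, h⟩
        exact ⟨_, ⟨e, he, rfl⟩, congrArg (Sym2.map some) h⟩
    simp only [this]

lemma currentWeight_ghost (J : Sym2 V → ℝ) (β : ℝ) (G : Finset V) (E : Finset (Bond V))
    (k : Current V) :
    currentWeight (fun e => β * ghostCoupling J G e) (ghostBonds E) (ghostExtend k) =
      currentWeight (fun e => β * J e) E k := by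
  simp [currentWeight, ghostBonds, ghostExtend_toGhost]

/-- The bonds of `E` do not touch the ghost, so the observable is the same for every volume; `∅` is
an arbitrary reference. -/
lemma bondFactor_ghost (J : Sym2 V → ℝ) (β : ℝ) (G : Finset V) (E : Finset (Bond V)) :
    bondFactor (fun e => β * ghostCoupling J G e) (ghostBonds E) =
      bondFactor (fun e => β * ghostCoupling J ∅ e) (ghostBonds E) := by
  ext σ; simp [bondFactor, ghostBonds]

lemma exists_tendsto_plusCurrentLaw {J : Sym2 V → ℝ} {β : ℝ} (hβ : 0 ≤ β) (hJ : ∀ e, 0 ≤ J e)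
    (hJs : ∀ x, Summable fun y => J s(x, y)) (E : Finset (Bond V)) (k : Current V) :
    ∃ l, Tendsto (fun G => plusCurrentLaw J β G (pointCylinder E k)) atTop (𝓝 l) := by
  have hK : ∀ e, 0 ≤ β * J e := fun e => mul_nonneg hβ (hJ e)
  have hg (G) (e) : 0 ≤ β * ghostCoupling J G e := mul_nonneg hβ (ghostCoupling_nonneg hJ G e)
  have hs (x : V) : Summable fun y => couplingOff E (fun e => β * J e) s(x, y) := by
    refine Summable.of_nonneg_of_le (fun y => couplingOff_nonneg hK E _) (fun y => ?_)
      ((hJs x).mul_left β)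
    rw [couplingOff]; split_ifs
    exacts [hK _, le_rfl]
  obtain ⟨a, ha⟩ := exists_tendsto_spinAverage_plus (couplingOff_nonneg hK E) hs
    (positiveType_currentSpin (ghostBonds E) (ghostExtend k))
  obtain ⟨b, hb⟩ := exists_tendsto_spinAverage_plus (couplingOff_nonneg hK E) hs
    (positiveType_bondFactor (hg ∅) (ghostBonds E))
  refine ⟨_, (tendsto_ofReal_quotient (c := currentWeight (fun e => β * J e) E k) ha hb ?_).congr'
    ?_⟩
  · filter_upwards [eventually_subset_bondsIn E] with G hG
    rw [← bondFactor_ghost J β G E, ← couplingOff_ghostCoupling hG]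
    exact one_le_spinAverage_bondFactor (hg G) _ (ghostBonds_subset hG)
  · filter_upwards [eventually_subset_bondsIn E] with G hG
    rw [plusCurrentLaw_pointCylinder_eq_ghost,
      finiteCurrentLaw_pointCylinder_eq (hg G) _ (ghostBonds_subset hG), currentWeight_ghost,
      bondFactor_ghost J β G E, couplingOff_ghostCoupling hG]

lemma isProbabilityMeasure_plusCurrentLaw {J : Sym2 V → ℝ} {β : ℝ} (hβ : 0 ≤ β)
    (hJ : ∀ e, 0 ≤ J e) (G : Finset V) : IsProbabilityMeasure (plusCurrentLaw J β G) := by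
  have := isProbabilityMeasure_finiteCurrentLaw
    (fun e => mul_nonneg hβ (ghostCoupling_nonneg hJ G e))
    (G.map Function.Embedding.some) (Finset.insertNone G)
  exact Measure.isProbabilityMeasure_map measurable_forgetGhost.aemeasurable

end

/-! ### Infinite-volume limits -/

lemma preimage_restrict_singleton {V : Type*} (E : Finset (Bond V)) (k : Current V) :
    E.restrict ⁻¹' ({E.restrict k} : Set (E → ℕ)) = pointCylinder E k := by
  ext n
  exact ⟨fun h e he => congrFun h ⟨e, he⟩, fun h => funext fun e => h e.1 e.2⟩

/-- Finite measures on currents are determined by their values on point cylinders. -/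
lemma measure_ext_of_pointCylinder {V : Type*} {P Q : Measure (Current V)} [IsFiniteMeasure P]
    (E₀ : Finset (Bond V))
    (h : ∀ E : Finset (Bond V), E₀ ⊆ E → ∀ k, P (pointCylinder E k) = Q (pointCylinder E k)) :
    P = Q := by
  classical
  have hm (E : Finset (Bond V)) : Measurable (E.restrict : Current V → E → ℕ) :=
    measurable_pi_lambda _ fun _ => measurable_pi_apply _
  have h₁ (E : Finset (Bond V)) (hE : E₀ ⊆ E) :
      P.map E.restrict = Q.map (E.restrict : Current V → E → ℕ) := by
    refine Measure.ext_of_singleton fun a => ?_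
    obtain ⟨k, rfl⟩ : ∃ k : Current V, E.restrict k = a :=
      ⟨fun e => if he : e ∈ E then a ⟨e, he⟩ else 0, by ext e; simp⟩
    rw [Measure.map_apply (hm E) (measurableSet_singleton _),
      Measure.map_apply (hm E) (measurableSet_singleton _), preimage_restrict_singleton]
    exact h E hE k
  have h₂ (E : Finset (Bond V)) :
      Q.map E.restrict = P.map (E.restrict : Current V → E → ℕ) := by
    -- A general `E` is reached by projecting from `E ∪ E₀`.
    have hr : (E.restrict : Current V → E → ℕ) =
        Finset.restrict₂ Finset.subset_union_left ∘ (E ∪ E₀).restrict := rfl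
    have hm₂ : Measurable (Finset.restrict₂ (π := fun _ : Bond V => ℕ)
        (Finset.subset_union_left : E ⊆ E ∪ E₀)) :=
      measurable_pi_lambda _ fun _ => measurable_pi_apply _
    rw [hr, ← Measure.map_map hm₂ (hm _), ← Measure.map_map hm₂ (hm _),
      h₁ _ Finset.subset_union_right]
  have i (E : Finset (Bond V)) : IsFiniteMeasure (P.map (E.restrict : Current V → E → ℕ)) :=
    Measure.isFiniteMeasure_map P _
  exact IsProjectiveLimit.unique (P := fun E => P.map E.restrict) (fun E => rfl) h₂

lemma tsum_currentWeight_singleton_ne_top {V : Type*} (K : Sym2 V → ℝ) (e : Bond V) :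
    ∑' m : ℕ, ENNReal.ofReal (currentWeight K {e} fun _ => m) ≠ ∞ := by
  have h : Summable fun m : ℕ => currentWeight K {e} fun _ => m := by
    simpa [currentWeight] using Real.summable_pow_div_factorial (K e.1)
  exact h.tsum_ofReal_ne_top

/-- Laws of currents that are dominated on point cylinders are tight. -/
lemma isTightMeasureSet_of_pointCylinder_le {V : Type*} [Countable V] {K : Sym2 V → ℝ}
    {s : Set (Measure (Current V))}
    (hs : ∀ μ ∈ s, ∀ e m, μ (pointCylinder {e} fun _ => m) ≤
      ENNReal.ofReal (currentWeight K {e} fun _ => m)) : IsTightMeasureSet s := by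
  rw [isTightMeasureSet_iff_exists_isCompact_measure_compl_le]
  intro ε hε
  obtain ⟨δ, hδ, hδε⟩ := ENNReal.exists_pos_sum_of_countable' hε.ne' (Bond V)
  have h (e : Bond V) : ∃ N : ℕ, ∑' m : ℕ, ENNReal.ofReal
      (currentWeight K {e} fun _ => m + N) ≤ δ e :=
    ((ENNReal.tendsto_sum_nat_add _ (tsum_currentWeight_singleton_ne_top K e)).eventually
      (ge_mem_nhds (hδ e))).exists
  choose N hN using h
  -- A product of finite sets is compact; leaving it at the bond `e` has probability at most `δ e`,
  -- and these sum to less than `ε`.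
  refine ⟨Set.univ.pi fun e => Set.Iio (N e),
    isCompact_univ_pi fun e => (Set.finite_Iio (N e)).isCompact, fun μ hμ => ?_⟩
  have hsub : (Set.univ.pi fun e => Set.Iio (N e))ᶜ ⊆
      ⋃ e, ⋃ m : ℕ, pointCylinder {e} fun _ => m + N e := by
    intro n hn
    simp only [Set.mem_compl_iff, Set.mem_univ_pi, Set.mem_Iio, not_forall, not_lt] at hn
    obtain ⟨e, he⟩ := hn
    simp only [Set.mem_iUnion]
    exact ⟨e, n e - N e, fun e' he' => by
      rw [Finset.mem_singleton.1 he']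
      exact (Nat.sub_add_cancel he).symm⟩
  calc μ (Set.univ.pi fun e => Set.Iio (N e))ᶜ
      ≤ μ (⋃ e, ⋃ m : ℕ, pointCylinder {e} fun _ => m + N e) := measure_mono hsub
    _ ≤ ∑' e, ∑' m : ℕ, μ (pointCylinder {e} fun _ => m + N e) :=
        (measure_iUnion_le _).trans (ENNReal.tsum_le_tsum fun e => measure_iUnion_le _)
    _ ≤ ∑' e, δ e := ENNReal.tsum_le_tsum fun e =>
        (ENNReal.tsum_le_tsum fun m => hs μ hμ e _).trans (hN e)
    _ ≤ ε := hδε.le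

/-- Prokhorov's theorem makes the sequence relatively compact. Cylinders are clopen, so every weak
cluster point gives a point cylinder its prescribed limit; the cluster point is therefore unique and
the whole sequence converges weakly. Clopenness then gives convergence on every event that depends
on finitely many bonds. -/
lemma exists_infiniteVolumeLimit {V : Type*} [Countable V] {K : Sym2 V → ℝ}
    {μ : ℕ → Measure (Current V)} (hμ : ∀ L, IsProbabilityMeasure (μ L))
    (hle : ∀ L e m, μ L (pointCylinder {e} fun _ => m) ≤
      ENNReal.ofReal (currentWeight K {e} fun _ => m))
    (hlim : ∀ E k, ∃ l, Tendsto (fun L => μ L (pointCylinder E k)) atTop (𝓝 l)) :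
    ∃ P, IsInfiniteVolumeLimit μ P := by
  let u : ℕ → ProbabilityMeasure (Current V) := fun L => ⟨μ L, hμ L⟩
  have hc : IsCompact (closure (Set.range u)) := by
    refine isCompact_closure_of_isTightMeasureSet
      (isTightMeasureSet_of_pointCylinder_le (K := K) ?_)
    rintro _ ⟨_, ⟨L, rfl⟩, rfl⟩
    exact hle L
  have hclopen (E : Finset (Bond V)) (A : Set (E → ℕ)) :
      IsClopen (cylinder E A : Set (Current V)) :=
    (isClopen_discrete A).preimage (by fun_prop)
  have hfr (E : Finset (Bond V)) (A : Set (E → ℕ)) (P : ProbabilityMeasure (Current V)) :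
      (P : Measure (Current V)) (frontier (cylinder E A)) = 0 := by
    simp [(hclopen E A).frontier_eq]
  have hcyl (E : Finset (Bond V)) (k : Current V) :
      pointCylinder E k = cylinder E ({E.restrict k} : Set (E → ℕ)) :=
    (preimage_restrict_singleton E k).symm
  have hcluster (P : ProbabilityMeasure (Current V)) (hP : MapClusterPt P atTop u)
      (E : Finset (Bond V)) (k : Current V) :
      Tendsto (fun L => μ L (pointCylinder E k)) atTop
        (𝓝 ((P : Measure (Current V)) (pointCylinder E k))) := by
    -- A cluster point is a limit along an ultrafilter finer than `atTop`, so the limit of the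
    -- probabilities can be computed along that ultrafilter.
    obtain ⟨U, hU, hUP⟩ := mapClusterPt_iff_ultrafilter.1 hP
    obtain ⟨l, hl⟩ := hlim E k
    have h := ProbabilityMeasure.tendsto_measure_of_null_frontier_of_tendsto' hUP
      (hfr E {E.restrict k} P)
    rw [← hcyl] at h
    rwa [← tendsto_nhds_unique (hl.mono_left hU) h]
  obtain ⟨P, -, hP⟩ := hc.exists_mapClusterPt (f := atTop) (u := u)
    (Filter.tendsto_principal.2 (Eventually.of_forall fun L => subset_closure ⟨L, rfl⟩))
  have hlimP : Tendsto u atTop (𝓝 P) := by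
    refine hc.le_nhds_of_unique_clusterPt
      (Filter.mem_map.2 (Eventually.of_forall fun L => subset_closure ⟨L, rfl⟩)) fun Q _ hQ => ?_
    have : IsProbabilityMeasure Q.1 := Q.2
    refine Subtype.ext (measure_ext_of_pointCylinder ∅ fun E _ k => ?_)
    exact tendsto_nhds_unique (hcluster Q hQ E k) (hcluster P hP E k)
  exact ⟨P, P.2, fun E A =>
    ProbabilityMeasure.tendsto_measure_of_null_frontier_of_tendsto' hlimP (hfr E A P)⟩

section

variable {W : Type*} [DecidableEq W]

lemma finiteCurrentLaw_ne_zero (β : ℝ) (K : Sym2 W → ℝ) (S : Finset W) {G : Finset W}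
    {e : Bond W} (he : e ∉ bondsIn G) : finiteCurrentLaw β K S G {n | n e ≠ 0} = 0 := by
  have hm : MeasurableSet {n : Current W | n e ≠ 0} :=
    measurable_pi_apply e (measurableSet_singleton 0).compl
  rw [finiteCurrentLaw, Measure.sum_apply _ hm]
  simp only [Measure.smul_apply, Measure.dirac_apply' _ hm]
  refine ENNReal.tsum_eq_zero.2 fun n => ?_
  simp [FinCurrent.extend, he]

/-- On a bond outside `G` the current vanishes: the case `m = 0` has weight `1` and the others have
probability `0`. Tightness thus holds over all volumes and all bonds. -/
lemma finiteCurrentLaw_singleton_le {β : ℝ} {K : Sym2 W → ℝ} (hK : ∀ e, 0 ≤ β * K e)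
    (S G : Finset W) (e : Bond W) (m : ℕ) :
    finiteCurrentLaw β K S G (pointCylinder {e} fun _ => m) ≤
      ENNReal.ofReal (currentWeight (fun e => β * K e) {e} fun _ => m) := by
  by_cases he : e ∈ bondsIn G
  · exact finiteCurrentLaw_pointCylinder_le hK S (Finset.singleton_subset_iff.2 he) _
  · rcases eq_or_ne m 0 with rfl | hm
    · have := isProbabilityMeasure_finiteCurrentLaw hK S G
      simpa [currentWeight] using prob_le_one
    · refine (measure_mono fun n hn => ?_).trans
        ((finiteCurrentLaw_ne_zero β K S he).trans_le zero_le)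
      rw [Set.mem_ofPred_eq, hn e (by simp)]
      exact hm

end

section

variable {V : Type*} [DecidableEq V]

lemma plusCurrentLaw_singleton_le {J : Sym2 V → ℝ} {β : ℝ} (hβ : 0 ≤ β) (hJ : ∀ e, 0 ≤ J e)
    (G : Finset V) (e : Bond V) (m : ℕ) :
    plusCurrentLaw J β G (pointCylinder {e} fun _ => m) ≤
      ENNReal.ofReal (currentWeight (fun e => β * J e) {e} fun _ => m) := by
  have h := finiteCurrentLaw_singleton_le
    (fun e => mul_nonneg hβ (ghostCoupling_nonneg hJ G e)) (G.map Function.Embedding.some)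
    (Finset.insertNone G) e.toGhost m
  rw [plusCurrentLaw_pointCylinder_eq_ghost]
  convert h using 2
  · ext n; simp [pointCylinder, ghostBonds, ghostExtend_toGhost]
  · simp [currentWeight]

end

lemma tendsto_latticeBox (d : ℕ) : Tendsto (latticeBox d) atTop atTop := by
  refine tendsto_atTop_finset_of_monotone (fun L L' h => ?_) fun x => ?_
  · refine Finset.Icc_subset_Icc (fun _ => ?_) fun _ => ?_ <;> simp <;> omega
  · refine ⟨∑ i, (x i).natAbs, Finset.mem_Icc.2 ⟨fun i => ?_, fun i => ?_⟩⟩ <;>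
    · have : (x i).natAbs ≤ ∑ i, (x i).natAbs :=
        Finset.single_le_sum (f := fun i => (x i).natAbs) (fun _ _ => zero_le) (Finset.mem_univ i)
      simp only
      omega

/-! ### Covariance under permutations of the vertices -/

/-- The action of a permutation of the vertices on bonds. -/
def Bond.permute {W : Type*} (θ : W ≃ W) : Bond W ≃ Bond W where
  toFun e := ⟨e.1.map θ, fun h => e.2 ((Sym2.isDiag_map θ.injective).1 h)⟩
  invFun e := ⟨e.1.map θ.symm, fun h => e.2 ((Sym2.isDiag_map θ.symm.injective).1 h)⟩
  left_inv e := by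
    refine Subtype.ext ?_
    simp [Sym2.map_map]
  right_inv e := by
    refine Subtype.ext ?_
    simp [Sym2.map_map]

lemma Bond.permute_val {W : Type*} (θ : W ≃ W) (e : Bond W) :
    (Bond.permute θ e).1 = e.1.map θ := rfl

lemma bondSpin_map {W : Type*} (θ : W ≃ W) (e : Sym2 W) (σ : W → ℤˣ) :
    bondSpin (e.map θ) σ = bondSpin e (σ ∘ θ) := by
  induction e with
  | h a b => rfl

lemma sum_spinsOn_map {W : Type*} (θ : W ≃ W) (S : Finset W) (f : (W → ℤˣ) → ℝ) :
    ∑ σ : spinsOn (S.map θ.toEmbedding), f (σ.1 ∘ θ) = ∑ σ : spinsOn S, f σ.1 := by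
  refine Fintype.sum_equiv ⟨fun σ => ⟨σ.1 ∘ θ, fun x hx => σ.2 _ (by simpa using hx)⟩,
    fun σ => ⟨σ.1 ∘ θ.symm, fun x hx => σ.2 _ (by simpa [Finset.mem_map_equiv] using hx)⟩,
    fun σ => ?_, fun σ => ?_⟩ _ _ fun σ => rfl
  · refine Subtype.ext (funext fun x => ?_); simp
  · refine Subtype.ext (funext fun x => ?_); simp

section

variable {W : Type*} [DecidableEq W]

lemma bondsIn_map (θ : W ≃ W) (G : Finset W) :
    bondsIn (G.map θ.toEmbedding) = (bondsIn G).map (Bond.permute θ).toEmbedding := by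
  ext e
  obtain ⟨e, rfl⟩ := (Bond.permute θ).surjective e
  simp [mem_bondsIn, Bond.permute_val, Sym2.mem_map]

lemma couplingOff_map {θ : W ≃ W} {K K' : Sym2 W → ℝ} (hK : ∀ e, K' (e.map θ) = K e)
    (E : Finset (Bond W)) (e : Sym2 W) :
    couplingOff (E.map (Bond.permute θ).toEmbedding) K' (e.map θ) = couplingOff E K e := by
  have : e.map θ ∈ (E.map (Bond.permute θ).toEmbedding).image Subtype.val ↔
      e ∈ E.image Subtype.val := by
    simp only [Finset.mem_image, Finset.mem_map_equiv]
    constructor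
    · rintro ⟨f, hf, h⟩
      refine ⟨_, hf, ?_⟩
      rw [show ((Bond.permute θ).symm f).1 = f.1.map θ.symm from rfl, h, Sym2.map_map]
      simp
    · rintro ⟨f, hf, h⟩
      exact ⟨Bond.permute θ f, by simpa using hf, by rw [Bond.permute_val, h]⟩
  simp only [couplingOff, this, hK]

lemma boltzmann_map {θ : W ≃ W} {K K' : Sym2 W → ℝ} (hK : ∀ e, K' (e.map θ) = K e)
    (G : Finset W) (σ : W → ℤˣ) :
    boltzmann K' (G.map θ.toEmbedding) σ = boltzmann K G (σ ∘ θ) := by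
  rw [boltzmann, bondsIn_map, Finset.prod_map]
  exact Finset.prod_congr rfl fun e _ => by
    simp only [Equiv.coe_toEmbedding, Bond.permute_val, hK, bondSpin_map]

/-- In the spin formula `θ` only relabels the spins. Two couplings `K` and `K'` are allowed because
the ghost couplings depend on the volume, which is itself moved. -/
lemma finiteCurrentLaw_map {θ : W ≃ W} {β : ℝ} {K K' : Sym2 W → ℝ}
    (hK : ∀ e, K' (e.map θ) = K e) (hK₀ : ∀ e, 0 ≤ β * K e) (S : Finset W) {G : Finset W}
    {E : Finset (Bond W)} (hE : E ⊆ bondsIn G) (k : Current W) :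
    finiteCurrentLaw β K' (S.map θ.toEmbedding) (G.map θ.toEmbedding)
      (pointCylinder (E.map (Bond.permute θ).toEmbedding) k) =
    finiteCurrentLaw β K S G (pointCylinder E (k ∘ Bond.permute θ)) := by
  have hK₁ (e) : 0 ≤ β * K' e := by
    have h := hK₀ (e.map θ.symm)
    rw [← hK, Sym2.map_map] at h
    simpa using h
  have hK₂ (e : Sym2 W) : (fun e => β * K' e) (e.map θ) = (fun e => β * K e) e := by
    simp only [hK]
  have hE' : E.map (Bond.permute θ).toEmbedding ⊆ bondsIn (G.map θ.toEmbedding) := by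
    rw [bondsIn_map]; exact Finset.map_subset_map.2 hE
  have hw : currentWeight (fun e => β * K' e) (E.map (Bond.permute θ).toEmbedding) k =
      currentWeight (fun e => β * K e) E (k ∘ Bond.permute θ) := by
    rw [currentWeight, Finset.prod_map]
    exact Finset.prod_congr rfl fun e _ => by
      simp only [Equiv.coe_toEmbedding, Bond.permute_val, hK, Function.comp_apply]
  have hs (σ : W → ℤˣ) : currentSpin (E.map (Bond.permute θ).toEmbedding) k σ =
      currentSpin E (k ∘ Bond.permute θ) (σ ∘ θ) := by
    rw [currentSpin_apply, currentSpin_apply, Finset.prod_map]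
    exact Finset.prod_congr rfl fun e _ => by
      simp only [Equiv.coe_toEmbedding, Bond.permute_val, bondSpin_map, Function.comp_apply]
  rw [finiteCurrentLaw_pointCylinder hK₁ _ hE', finiteCurrentLaw_pointCylinder hK₀ _ hE, hw]
  have hb₁ := boltzmann_map (K := fun e => β * K e) (K' := fun e => β * K' e) hK₂ G
  have hb₂ := boltzmann_map (couplingOff_map (K := fun e => β * K e) (K' := fun e => β * K' e)
    hK₂ E) G
  simp only [hs, hb₁, hb₂]
  rw [sum_spinsOn_map θ S (boltzmann (fun e => β * K e) G),
    sum_spinsOn_map θ S fun σ => signVal (currentSpin E (k ∘ Bond.permute θ) σ) *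
      boltzmann (couplingOff E fun e => β * K e) G σ]

end

lemma tendsto_map_equiv_atTop {V : Type*} (θ : V ≃ V) :
    Tendsto (fun G : Finset V => G.map θ.toEmbedding) atTop atTop :=
  tendsto_atTop_finset_of_monotone (fun _ _ h => Finset.map_subset_map.2 h)
    fun x => ⟨{θ.symm x}, by simp⟩

/-- A bond carries a positive current with probability at most `K e^K`. -/
lemma measure_ne_zero_le {V : Type*} {K : Sym2 V → ℝ} (hK : ∀ e, 0 ≤ K e) {P : Measure (Current V)}
    (e : Bond V) (hP : ∀ m, P (pointCylinder {e} fun _ => m) ≤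
      ENNReal.ofReal (currentWeight K {e} fun _ => m)) :
    P {n | n e ≠ 0} ≤ ENNReal.ofReal (K e.1 * Real.exp (K e.1)) := by
  have hsub : {n : Current V | n e ≠ 0} ⊆ ⋃ m : ℕ, pointCylinder {e} fun _ => m + 1 := by
    intro n hn
    refine Set.mem_iUnion.2 ⟨n e - 1, fun e' he' => ?_⟩
    rw [Finset.mem_singleton.1 he']
    exact (Nat.sub_add_cancel (Nat.pos_of_ne_zero hn)).symm
  have hterm (m : ℕ) : currentWeight K {e} (fun _ => m + 1) ≤ K e.1 * (K e.1 ^ m / (m ! : ℝ)) := by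
    simp only [currentWeight, Finset.prod_singleton]
    rw [pow_succ', mul_div_assoc]
    gcongr
    · exact hK _
    · exact pow_nonneg (hK _) _
    · exact Nat.le_succ m
  have hs : Summable fun m : ℕ => K e.1 * (K e.1 ^ m / (m ! : ℝ)) :=
    (Real.summable_pow_div_factorial _).mul_left _
  have hnn (m : ℕ) : 0 ≤ K e.1 * (K e.1 ^ m / (m ! : ℝ)) :=
    mul_nonneg (hK _) (div_nonneg (pow_nonneg (hK _) _) (by positivity))
  calc P {n | n e ≠ 0} ≤ ∑' m : ℕ, P (pointCylinder {e} fun _ => m + 1) :=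
        (measure_mono hsub).trans (measure_iUnion_le _)
    _ ≤ ∑' m : ℕ, ENNReal.ofReal (K e.1 * (K e.1 ^ m / (m ! : ℝ))) :=
        ENNReal.tsum_le_tsum fun m => (hP (m + 1)).trans (ENNReal.ofReal_le_ofReal (hterm m))
    _ = ENNReal.ofReal (K e.1 * Real.exp (K e.1)) := by
        rw [← ENNReal.ofReal_tsum_of_nonneg hnn hs, tsum_mul_left, Real.exp_eq_exp_ℝ,
          NormedSpace.exp_eq_tsum_div]

section

variable {V : Type*} [DecidableEq V]

lemma freeCurrentLaw_map {θ : V ≃ V} {β : ℝ} {J : Sym2 V → ℝ} (hJθ : ∀ e, J (e.map θ) = J e)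
    (hJ : ∀ e, 0 ≤ β * J e) {G : Finset V} {E : Finset (Bond V)} (hE : E ⊆ bondsIn G)
    (k : Current V) :
    freeCurrentLaw J β (G.map θ.toEmbedding)
      (pointCylinder (E.map (Bond.permute θ).toEmbedding) k) =
    freeCurrentLaw J β G (pointCylinder E (k ∘ Bond.permute θ)) :=
  finiteCurrentLaw_map hJθ hJ G hE k

lemma ghostCoupling_map {θ : V ≃ V} {J : Sym2 V → ℝ} (hJθ : ∀ e, J (e.map θ) = J e)
    (G : Finset V) (e : Sym2 (Option V)) :
    ghostCoupling J (G.map θ.toEmbedding) (e.map (Equiv.optionCongr θ)) = ghostCoupling J G e := by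
  have h (x : V) : (∑' y, if y ∈ G.map θ.toEmbedding then 0 else J s(θ x, y)) =
      ∑' y, if y ∈ G then 0 else J s(x, y) := by
    rw [← θ.tsum_eq]
    refine tsum_congr fun y => ?_
    rw [← hJθ s(x, y)]
    simp
  induction e with
  | h a b =>
    rcases a with _ | a <;> rcases b with _ | b
    exacts [rfl, h b, h a, hJθ s(a, b)]

lemma plusCurrentLaw_map {θ : V ≃ V} {β : ℝ} (hβ : 0 ≤ β) {J : Sym2 V → ℝ}
    (hJθ : ∀ e, J (e.map θ) = J e) (hJ : ∀ e, 0 ≤ J e) {G : Finset V} {E : Finset (Bond V)}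
    (hE : E ⊆ bondsIn G) (k : Current V) :
    plusCurrentLaw J β (G.map θ.toEmbedding)
      (pointCylinder (E.map (Bond.permute θ).toEmbedding) k) =
    plusCurrentLaw J β G (pointCylinder E (k ∘ Bond.permute θ)) := by
  rw [plusCurrentLaw_pointCylinder_eq_ghost, plusCurrentLaw_pointCylinder_eq_ghost]
  -- The permutation is extended to `V ∪ {δ}` by fixing the ghost.
  have h := finiteCurrentLaw_map (ghostCoupling_map hJθ G)
    (fun e => mul_nonneg hβ (ghostCoupling_nonneg hJ G e)) (G.map Function.Embedding.some)
    (ghostBonds_subset hE) (ghostExtend k)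
  have hp (e : Bond V) : Bond.permute (Equiv.optionCongr θ) e.toGhost =
      (Bond.permute θ e).toGhost := by
    obtain ⟨e, he⟩ := e
    induction e with
    | h a b => rfl
  have h₁ : (G.map Function.Embedding.some).map (Equiv.optionCongr θ).toEmbedding =
      (G.map θ.toEmbedding).map Function.Embedding.some := by
    rw [Finset.map_map, Finset.map_map]; rfl
  have h₂ : (Finset.insertNone G).map (Equiv.optionCongr θ).toEmbedding =
      Finset.insertNone (G.map θ.toEmbedding) := by
    ext x
    obtain ⟨x, rfl⟩ := (Equiv.optionCongr θ).surjective x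
    rw [Finset.mem_map_equiv, Equiv.symm_apply_apply]
    rcases x with _ | x <;> simp
  have h₃ : (ghostBonds E).map (Bond.permute (Equiv.optionCongr θ)).toEmbedding =
      ghostBonds (E.map (Bond.permute θ).toEmbedding) := by
    rw [ghostBonds, ghostBonds, Finset.map_map, Finset.map_map]
    congr 1
    ext e : 1
    exact hp e
  have h₄ : pointCylinder (ghostBonds E)
      (ghostExtend k ∘ Bond.permute (Equiv.optionCongr θ)) =
      pointCylinder (ghostBonds E) (ghostExtend (k ∘ Bond.permute θ)) := by
    ext n
    have : ∀ e ∈ ghostBonds E, (ghostExtend k ∘ Bond.permute (Equiv.optionCongr θ)) e =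
        ghostExtend (k ∘ Bond.permute θ) e := by
      intro e he
      obtain ⟨e, _, rfl⟩ := Finset.mem_map.1 he
      simp only [Function.Embedding.coeFn_mk, Function.comp_apply]
      rw [hp, ghostExtend_toGhost, ghostExtend_toGhost]
      rfl
    exact ⟨fun h e he => (h e he).trans (this e he), fun h e he => (h e he).trans (this e he).symm⟩
  rwa [h₁, h₂, h₃, h₄] at h

/-- The limit of a covariant net of laws is invariant. -/
lemma map_permute_eq_of_tendsto {μ : Finset V → Measure (Current V)} {P : Measure (Current V)}
    [IsFiniteMeasure P] {θ : V ≃ V}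
    (hP : ∀ E k, Tendsto (fun G => μ G (pointCylinder E k)) atTop (𝓝 (P (pointCylinder E k))))
    (hμ : ∀ (G : Finset V) (E : Finset (Bond V)) (k : Current V), E ⊆ bondsIn G →
      μ (G.map θ.toEmbedding) (pointCylinder (E.map (Bond.permute θ).toEmbedding) k) =
        μ G (pointCylinder E (k ∘ Bond.permute θ))) :
    P.map (fun n => n ∘ Bond.permute θ) = P := by
  have hm : Measurable fun n : Current V => n ∘ Bond.permute θ :=
    measurable_pi_lambda _ fun e => measurable_pi_apply _
  have := Measure.isFiniteMeasure_map P fun n : Current V => n ∘ Bond.permute θ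
  refine measure_ext_of_pointCylinder ∅ fun E _ k => ?_
  rw [Measure.map_apply hm (measurableSet_pointCylinder E k)]
  have h₁ : (fun n : Current V => n ∘ Bond.permute θ) ⁻¹' pointCylinder E k =
      pointCylinder (E.map (Bond.permute θ).toEmbedding) (k ∘ (Bond.permute θ).symm) := by
    ext n
    constructor
    · intro h e he
      obtain ⟨e, he', rfl⟩ := Finset.mem_map.1 he
      simpa using h e he'
    · intro h e he
      simpa using h _ (Finset.mem_map_of_mem _ he)
  rw [h₁]
  -- The volumes `G.map θ` also exhaust `V`, so their laws have the same limit as those of `G`.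
  refine tendsto_nhds_unique ((hP _ _).comp (tendsto_map_equiv_atTop θ)) ((hP E k).congr' ?_)
  filter_upwards [eventually_subset_bondsIn E] with G hG
  rw [Function.comp_apply, hμ G E _ hG]
  congr 2
  ext e
  simp

/-! ### Insertion tolerance -/

/-- Adding two units of current to the bond `e`. -/
noncomputable def addTwo (e : Bond V) (n : Current V) : Current V := Function.update n e (n e + 2)

lemma measurable_addTwo (e : Bond V) : Measurable (addTwo e) := by
  refine measurable_pi_lambda _ fun e' => ?_
  by_cases h : e' = e
  · subst h
    simpa [addTwo] using (measurable_pi_apply e').add_const 2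
  · simpa [addTwo, Function.update_of_ne h] using measurable_pi_apply e'

/-- Two extra units change no parity, so the spin character is unaffected. Only the weight at `e`
changes, from `c^k/k!` to `c^(k+2)/(k+2)!` with `c = βJ` and `k` the current at `e`. -/
lemma freeCurrentLaw_addTwo {β : ℝ} {J : Sym2 V → ℝ} (hJ : ∀ e, 0 ≤ β * J e) {G : Finset V}
    {E : Finset (Bond V)} (hE : E ⊆ bondsIn G) {e : Bond V} (he : e ∈ E) (k : Current V) :
    freeCurrentLaw J β G (pointCylinder E (addTwo e k)) =
      ENNReal.ofReal ((β * J e.1) ^ 2 / ((k e + 1) * (k e + 2))) *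
        freeCurrentLaw J β G (pointCylinder E k) := by
  have hw : currentWeight (fun e => β * J e) E (addTwo e k) =
      (β * J e.1) ^ 2 / ((k e + 1) * (k e + 2)) * currentWeight (fun e => β * J e) E k := by
    rw [currentWeight, currentWeight, ← Finset.mul_prod_erase E _ he,
      ← Finset.mul_prod_erase E (fun e => (β * J e.1) ^ k e / ((k e)! : ℝ)) he, ← mul_assoc]
    congr 1
    · simp only [addTwo, Function.update_self]
      rw [pow_add, Nat.factorial_succ, Nat.factorial_succ]
      have := Nat.factorial_pos (k e)
      push_cast
      field_simp
      ring
    · refine Finset.prod_congr rfl fun e' he' => ?_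
      rw [addTwo, Function.update_of_ne (Finset.ne_of_mem_erase he')]
  have hs : currentSpin E (addTwo e k) = currentSpin E k := by
    ext σ : 1
    rw [currentSpin_apply, currentSpin_apply]
    refine Finset.prod_congr rfl fun e' _ => ?_
    by_cases h : e' = e
    · subst h
      rw [addTwo, Function.update_self, pow_add, Int.units_sq, mul_one]
    · rw [addTwo, Function.update_of_ne h]
  rw [freeCurrentLaw, finiteCurrentLaw_pointCylinder hJ _ hE,
    finiteCurrentLaw_pointCylinder hJ _ hE, hw, hs, ← ENNReal.ofReal_mul (by positivity)]
  congr 1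
  ring

/-- The infinite-volume free law is quasi-invariant under the addition of two units of current. -/
lemma map_addTwo_absolutelyContinuous {β : ℝ} {J : Sym2 V → ℝ} (hJ : ∀ e, 0 ≤ β * J e)
    {P : Measure (Current V)} [IsFiniteMeasure P]
    (hP : ∀ E k, Tendsto (fun G => freeCurrentLaw J β G (pointCylinder E k)) atTop
      (𝓝 (P (pointCylinder E k)))) {e : Bond V} (he : 0 < β * J e.1) :
    P.map (addTwo e) ≪ P := by
  let c : ℕ → ℝ≥0∞ := fun m => ENNReal.ofReal ((β * J e.1) ^ 2 / ((m + 1) * (m + 2)))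
  have hc (m) : c m ≠ 0 := by
    have : (0 : ℝ) < (β * J e.1) ^ 2 / ((m + 1) * (m + 2)) := by positivity
    simpa [c] using this
  have hc' (m) : c m ≠ ∞ := ENNReal.ofReal_ne_top
  have hP₁ (E : Finset (Bond V)) (heE : e ∈ E) (k : Current V) :
      P (pointCylinder E (addTwo e k)) = c (k e) * P (pointCylinder E k) := by
    refine tendsto_nhds_unique ((hP E (addTwo e k)).congr' ?_)
      (ENNReal.Tendsto.const_mul (hP E k) (Or.inr (hc' (k e))))
    filter_upwards [eventually_subset_bondsIn E] with G hG
    exact freeCurrentLaw_addTwo hJ hG heE k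
  let F : ℕ → Set (Current V) := fun m => {n | n e = m}
  have hF (m) : MeasurableSet (F m) :=
    (measurable_pi_apply e : Measurable fun n : Current V => n e) (measurableSet_singleton m)
  -- The ratio depends on the current at `e`, so the law is cut into the pieces where this current
  -- equals `m`; each is carried to the piece `m + 2` up to a constant factor.
  have key (m : ℕ) : c m • (P.restrict (F m)).map (addTwo e) = P.restrict (F (m + 2)) := by
    have : IsFiniteMeasure (c m • (P.restrict (F m)).map (addTwo e)) :=
      Measure.smul_finite _ (hc' m)
    -- Only cylinders that prescribe the value at `e` need to be compared.
    refine measure_ext_of_pointCylinder {e} fun E heE k => ?_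
    rw [Finset.singleton_subset_iff] at heE
    have hmc := measurableSet_pointCylinder E k
    rw [Measure.smul_apply, Measure.map_apply (measurable_addTwo e) hmc,
      Measure.restrict_apply (measurable_addTwo e hmc), Measure.restrict_apply hmc, smul_eq_mul]
    by_cases hk : k e = m + 2
    · have hk' : addTwo e (Function.update k e m) = k := by
        rw [addTwo, Function.update_self, Function.update_idem, ← hk, Function.update_eq_self]
      have h₁ : addTwo e ⁻¹' pointCylinder E k ∩ F m =
          pointCylinder E (Function.update k e m) := by
        ext n
        constructor
        · rintro ⟨h, h'⟩ e' he'
          by_cases hee : e' = e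
          · subst hee; rw [Function.update_self]; exact h'
          · simpa [addTwo, Function.update_of_ne hee] using h e' he'
        · intro h
          refine ⟨fun e' he' => ?_, (h e heE).trans (Function.update_self ..)⟩
          by_cases hee : e' = e
          · subst hee
            have := h e' heE
            rw [Function.update_self] at this
            rw [addTwo, Function.update_self, this, hk]
          · simpa [addTwo, Function.update_of_ne hee] using h e' he'
      have h₂ : pointCylinder E k ∩ F (m + 2) = pointCylinder E k :=
        Set.inter_eq_left.2 fun n hn => (hn e heE).trans hk
      rw [h₁, h₂]
      have := hP₁ E heE (Function.update k e m)
      rw [hk', Function.update_self] at this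
      exact this.symm
    · have h₁ : addTwo e ⁻¹' pointCylinder E k ∩ F m = ∅ := by
        refine Set.eq_empty_of_forall_notMem fun n hn => hk ?_
        have h := hn.1 e heE
        rw [addTwo, Function.update_self, show n e = m from hn.2] at h
        exact h.symm
      have h₂ : pointCylinder E k ∩ F (m + 2) = ∅ :=
        Set.eq_empty_of_forall_notMem fun n hn => hk ((hn.1 e heE).symm.trans hn.2)
      rw [h₁, h₂, measure_empty, mul_zero]
  refine Measure.AbsolutelyContinuous.mk fun A hA hPA => ?_
  have hpre := measurable_addTwo e hA
  rw [Measure.map_apply (measurable_addTwo e) hA]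
  have hcover : addTwo e ⁻¹' A ⊆ ⋃ m, addTwo e ⁻¹' A ∩ F m := fun n hn =>
    Set.mem_iUnion.2 ⟨n e, hn, rfl⟩
  refine measure_mono_null hcover (measure_iUnion_null fun m => ?_)
  have h := congrArg (fun ρ : Measure (Current V) => ρ A) (key m)
  simp only [Measure.smul_apply, smul_eq_mul] at h
  rw [Measure.map_apply (measurable_addTwo e) hA, Measure.restrict_apply hpre,
    Measure.restrict_apply hA, measure_mono_null Set.inter_subset_left hPA] at h
  exact (mul_eq_zero.1 h).resolve_left (hc m)

end

/-! ### Furcation sets of a graph -/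

namespace SimpleGraph

variable {V : Type*}

/-- The edges of `H` with no endpoint in `B`. -/
def avoiding (H : SimpleGraph V) (B : Set V) : SimpleGraph V where
  Adj u v := H.Adj u v ∧ u ∉ B ∧ v ∉ B
  symm := ⟨fun _ _ h => ⟨h.1.symm, h.2.2, h.2.1⟩⟩
  loopless := ⟨fun _ h => h.1.ne rfl⟩

/-- The edges of `H` with both endpoints in `B`. -/
def within (H : SimpleGraph V) (B : Set V) : SimpleGraph V where
  Adj u v := H.Adj u v ∧ u ∈ B ∧ v ∈ B
  symm := ⟨fun _ _ h => ⟨h.1.symm, h.2.2, h.2.1⟩⟩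
  loopless := ⟨fun _ h => h.1.ne rfl⟩

variable {H : SimpleGraph V} {B B' : Set V}

lemma avoiding_le : H.avoiding B ≤ H := fun _ _ h => h.1

lemma within_le : H.within B ≤ H := fun _ _ h => h.1

lemma within_le_avoiding (h : Disjoint B B') : H.within B' ≤ H.avoiding B := fun _ _ huv =>
  ⟨huv.1, Set.disjoint_right.1 h huv.2.1, Set.disjoint_right.1 h huv.2.2⟩

lemma Reachable.step {u v w : V} (h : H.Reachable u v) (h' : H.Adj v w) : H.Reachable u w :=
  h.trans h'.reachable

/-- Induction along a path, from its end. -/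
lemma Reachable.head_induction {b : V} {p : V → Prop} (hb : p b)
    (hstep : ∀ u v, H.Adj u v → H.Reachable v b → p v → p u) {v : V} (h : H.Reachable v b) :
    p v := by
  obtain ⟨w⟩ := h
  induction w with
  | nil => exact hb
  | cons huv w ih => exact hstep _ _ huv ⟨w⟩ (ih hb hstep)

/-- Induction along a path, from its start. -/
lemma Reachable.tail_induction {b : V} {p : V → Prop} (hb : p b)
    (hstep : ∀ u v, H.Adj u v → H.Reachable b u → p u → p v) {v : V} (h : H.Reachable b v) :
    p v :=
  Reachable.head_induction (b := b) hb (fun u v huv hv hp => hstep v u huv.symm hv.symm hp) h.symm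

lemma notMem_of_avoiding_reachable {u v : V} (hu : u ∉ B) (h : (H.avoiding B).Reachable u v) :
    v ∉ B :=
  Reachable.tail_induction (H := H.avoiding B) (p := fun v => v ∉ B) hu
    (fun _ _ huv _ _ => huv.2.2) h

/-- A path from `v` to `B` first enters `B` through an edge. -/
lemma exists_entry {v b : V} (hb : b ∈ B) (h : H.Reachable v b) (hv : v ∉ B) :
    ∃ u w, (H.avoiding B).Reachable v u ∧ H.Adj u w ∧ w ∈ B := by
  revert hv
  refine Reachable.head_induction (p := fun v => v ∉ B →
    ∃ u w, (H.avoiding B).Reachable v u ∧ H.Adj u w ∧ w ∈ B) (fun h => absurd hb h) ?_ h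
  intro u v huv _ ih hu
  by_cases hv : v ∈ B
  · exact ⟨u, v, Reachable.refl _, huv, hv⟩
  · obtain ⟨u', w, h₁, h₂⟩ := ih hv
    exact ⟨u', w, (Adj.reachable (⟨huv, hu, hv⟩ : (H.avoiding B).Adj u v)).trans h₁, h₂⟩

/-- A component of the complement of `B` that does not meet `B'` is connected off `B'`. -/
lemma avoiding_reachable_of_disjoint {u v : V} (h : (H.avoiding B).Reachable u v)
    (hB' : ∀ w, (H.avoiding B).Reachable u w → w ∉ B') : (H.avoiding B').Reachable u v :=
  Reachable.tail_induction (H := H.avoiding B) (p := fun v => (H.avoiding B').Reachable u v)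
    (Reachable.refl _)
    (fun _ _ hvw hv h => h.step ⟨hvw.1, hB' _ hv, hB' _ (hv.step hvw)⟩) h

/-- `B` is connected, and its removal leaves at least three infinite components in its cluster. -/
structure IsFurcation (H : SimpleGraph V) (B : Set V) : Prop where
  connected : ∀ x ∈ B, ∀ y ∈ B, (H.within B).Reachable x y
  branches : ∃ b ∈ B, ∃ u : Fin 3 → V, (∀ i, u i ∉ B ∧ H.Reachable (u i) b ∧
    {v | (H.avoiding B).Reachable (u i) v}.Infinite) ∧
    ∀ i j, i ≠ j → ¬ (H.avoiding B).Reachable (u i) (u j)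

/-- The vertices outside `Λ` that are adjacent to `Λ`. -/
def outerBoundary (H : SimpleGraph V) (Λ : Set V) : Set V := {y | y ∉ Λ ∧ ∃ x ∈ Λ, H.Adj x y}

/-- Bonds may be long, so a branch can enter `B` by an edge coming straight from outside `Λ`; the
other end of that edge then lies in the outer boundary. Otherwise the branch has a vertex in `Λ`
and, being infinite, must step out of `Λ`. -/
lemma exists_mem_outerBoundary {Λ : Set V} (hΛ : Λ.Finite) (hB : B ⊆ Λ) {u b : V} (hb : b ∈ B)
    (hu : u ∉ B) (hub : H.Reachable u b)
    (hinf : {v | (H.avoiding B).Reachable u v}.Infinite) :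
    ∃ y ∈ H.outerBoundary Λ, (H.avoiding B).Reachable u y := by
  obtain ⟨u', w, h₁, h₂, h₃⟩ := exists_entry hb hub hu
  by_cases hu' : u' ∈ Λ
  · obtain ⟨z, hz, hzΛ⟩ := hinf.exists_notMem_finite hΛ
    have huz : (H.avoiding B).Reachable u' z := h₁.symm.trans hz
    have key : z ∈ Λ ∨ ∃ y ∈ H.outerBoundary Λ, (H.avoiding B).Reachable u y := by
      refine Reachable.tail_induction (p := fun z => z ∈ Λ ∨
        ∃ y ∈ H.outerBoundary Λ, (H.avoiding B).Reachable u y) (Or.inl hu') ?_ huz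
      rintro a c hac ha (haΛ | h)
      · by_cases hc : c ∈ Λ
        · exact Or.inl hc
        · exact Or.inr ⟨c, ⟨hc, a, haΛ, hac.1⟩, (h₁.trans ha).step hac⟩
      · exact Or.inr h
    exact key.resolve_left hzΛ
  · exact ⟨u', ⟨hu', w, hB h₃, h₂.symm⟩, h₁⟩

/-- The data used to select a boundary vertex for a furcation set: `y` is the first boundary vertex
in its branch, another branch has an earlier one, and neither branch contains the root `r`. -/
structure BranchSelection (H : SimpleGraph V) (Y : Set V) (ρ : V → ℕ) (B : Set V)
    (r y y' : V) : Prop where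
  mem : y ∈ Y
  mem' : y' ∈ Y
  not_root : ¬ (H.avoiding B).Reachable y r
  not_root' : ¬ (H.avoiding B).Reachable y' r
  lt : ρ y' < ρ y
  min : ∀ z ∈ Y, (H.avoiding B).Reachable y z → ρ y ≤ ρ z
  reachable : ∃ b ∈ B, H.Reachable y b
  reachable' : ∃ b ∈ B, H.Reachable y' b

lemma exists_min_rank {Y : Set V} (ρ : V → ℕ) (hY : Y.Nonempty) :
    ∃ y ∈ Y, ∀ z ∈ Y, ρ y ≤ ρ z := by
  obtain ⟨y, hy, h⟩ := (measure ρ).wf.has_min Y hY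
  exact ⟨y, hy, fun z hz => not_lt.1 (h z hz)⟩

/-- At most one of three branches contains `r`. Of the first boundary vertices of two branches
without `r`, the later one is selected and the earlier one is its witness `y'`. -/
lemma IsFurcation.exists_branchSelection {Λ : Set V} (hΛ : Λ.Finite) (hB : B ⊆ Λ)
    (h : H.IsFurcation B) {ρ : V → ℕ} (hρ : Function.Injective ρ) (r : V) :
    ∃ y y', BranchSelection H (H.outerBoundary Λ) ρ B r y y' := by
  obtain ⟨b, hb, u, hu, hne⟩ := h.branches
  have hmin (i : Fin 3) : ∃ y ∈ H.outerBoundary Λ, (H.avoiding B).Reachable (u i) y ∧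
      ∀ z ∈ H.outerBoundary Λ, (H.avoiding B).Reachable (u i) z → ρ y ≤ ρ z := by
    obtain ⟨y, hy, hy'⟩ := exists_mem_outerBoundary hΛ hB hb (hu i).1 (hu i).2.1 (hu i).2.2
    obtain ⟨y, hy, h⟩ := exists_min_rank ρ
      (Y := {y | y ∈ H.outerBoundary Λ ∧ (H.avoiding B).Reachable (u i) y}) ⟨y, hy, hy'⟩
    exact ⟨y, hy.1, hy.2, fun z hz hz' => h z ⟨hz, hz'⟩⟩
  choose y hy hyu hymin using hmin
  have hyne {i j : Fin 3} (hij : i ≠ j) : ρ (y i) ≠ ρ (y j) := fun h =>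
    hne i j hij ((hyu i).trans (hρ h ▸ (hyu j).symm))
  have hyb (i) : ∃ b ∈ B, H.Reachable (y i) b :=
    ⟨b, hb, ((hyu i).mono avoiding_le).symm.trans (hu i).2.1⟩
  have select {i j : Fin 3} (hij : i ≠ j) (hi : ¬ (H.avoiding B).Reachable (u i) r)
      (hj : ¬ (H.avoiding B).Reachable (u j) r) :
      ∃ y y', BranchSelection H (H.outerBoundary Λ) ρ B r y y' := by
    have hi' : ¬ (H.avoiding B).Reachable (y i) r := fun h => hi ((hyu i).trans h)
    have hj' : ¬ (H.avoiding B).Reachable (y j) r := fun h => hj ((hyu j).trans h)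
    rcases lt_or_gt_of_ne (hyne hij) with hlt | hlt
    · exact ⟨y j, y i, hy j, hy i, hj', hi', hlt,
        fun z hz hz' => hymin j z hz ((hyu j).trans hz'), hyb j, hyb i⟩
    · exact ⟨y i, y j, hy i, hy j, hi', hj', hlt,
        fun z hz hz' => hymin i z hz ((hyu i).trans hz'), hyb i, hyb j⟩
  by_cases h0 : (H.avoiding B).Reachable (u 0) r
  · exact select (i := 1) (j := 2) (by decide)
      (fun h => hne 0 1 (by decide) (h0.trans h.symm))
      (fun h => hne 0 2 (by decide) (h0.trans h.symm))
  · by_cases h1 : (H.avoiding B).Reachable (u 1) r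
    · exact select (i := 0) (j := 2) (by decide) h0
        (fun h => hne 1 2 (by decide) (h1.trans h.symm))
    · exact select (i := 0) (j := 1) (by decide) h0 h1

/-- If the branch of `y` off `B` met `B'`, it would contain all of `B'`, and the rest of the
cluster, including `r`, would stay connected through `B` off `B'`. The witness `y₂`, separated from
`r` by `B'`, would then lie in the branch of `y` off `B` and precede `y`, against the minimality of
`y` there. -/
lemma BranchSelection.not_meets {Y : Set V} {ρ : V → ℕ} {r y y₁ y₂ : V}
    (hBB' : Disjoint B B') (hB : ∀ x ∈ B, ∀ y ∈ B, (H.within B).Reachable x y)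
    (hB' : ∀ x ∈ B', ∀ y ∈ B', (H.within B').Reachable x y)
    (h₁ : BranchSelection H Y ρ B r y y₁) (h₂ : BranchSelection H Y ρ B' r y y₂)
    (hr : H.Reachable y r) {b' : V} (hb' : b' ∈ B') : ¬ (H.avoiding B).Reachable y b' := by
  intro hyb'
  obtain ⟨b, hb, hyb⟩ := h₁.reachable
  have hB'sub (x : V) (hx : x ∈ B') : (H.avoiding B).Reachable y x :=
    hyb'.trans ((hB' b' hb' x hx).mono (within_le_avoiding hBB'))
  have hin {x : V} (hx : x ∈ B) : (H.avoiding B').Reachable x b :=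
    (hB x hx b hb).mono (within_le_avoiding hBB'.symm)
  have key (v : V) (hv : H.Reachable v b) (hyv : ¬ (H.avoiding B).Reachable y v) :
      (H.avoiding B').Reachable v b := by
    by_cases hvB : v ∈ B
    · exact hin hvB
    · obtain ⟨u, w, hvu, huw, hw⟩ := exists_entry hb hv hvB
      have hdis (x : V) (hx : (H.avoiding B).Reachable v x) : x ∉ B' := fun hxB' =>
        hyv ((hB'sub x hxB').trans hx.symm)
      exact ((avoiding_reachable_of_disjoint hvu hdis).step
        ⟨huw, hdis u hvu, Set.disjoint_left.1 hBB' hw⟩).trans (hin hw)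
  have hrb := key r (hr.symm.trans hyb) h₁.not_root
  obtain ⟨c, hc, hyc⟩ := h₂.reachable'
  have hb'b : H.Reachable b' b := (hyb'.symm.mono avoiding_le).trans hyb
  have hcb : H.Reachable c b := ((hB' c hc b' hb').mono within_le).trans hb'b
  have h₃ : (H.avoiding B).Reachable y y₂ := by
    by_contra hcon
    exact h₂.not_root' ((key y₂ (hyc.trans hcb) hcon).trans hrb.symm)
  exact absurd (h₁.min y₂ h₂.mem' h₃) (not_le.2 h₂.lt)

/-- If the branch of `y` off `B` misses `B'`, it survives the removal of `B'` and leads to `B`. So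
the branch of `y` off `B'` meets `B`, and `not_meets` applies with the two sets exchanged. -/
lemma BranchSelection.false_of_disjoint {Y : Set V} {ρ : V → ℕ} {r y y₁ y₂ : V}
    (hYB : ∀ z ∈ Y, z ∉ B)
    (hBB' : Disjoint B B') (hB : ∀ x ∈ B, ∀ y ∈ B, (H.within B).Reachable x y)
    (hB' : ∀ x ∈ B', ∀ y ∈ B', (H.within B').Reachable x y)
    (h₁ : BranchSelection H Y ρ B r y y₁) (h₂ : BranchSelection H Y ρ B' r y y₂)
    (hr : H.Reachable y r) : False := by
  by_cases hmeet : ∃ b' ∈ B', (H.avoiding B).Reachable y b'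
  · obtain ⟨b', hb', h⟩ := hmeet
    exact h₁.not_meets hBB' hB hB' h₂ hr hb' h
  · have hdis (x : V) (hx : (H.avoiding B).Reachable y x) : x ∉ B' := fun hxB' =>
      hmeet ⟨x, hxB', hx⟩
    obtain ⟨b, hb, hyb⟩ := h₁.reachable
    obtain ⟨u, w, hyu, huw, hw⟩ := exists_entry hb hyb (hYB y h₁.mem)
    exact h₂.not_meets hBB'.symm hB' hB h₁ hr hw
      ((avoiding_reachable_of_disjoint hyu hdis).step
        ⟨huw, hdis u hyu, Set.disjoint_left.1 hBB' hw⟩)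

/-- Disjoint furcation sets inside `Λ` are at most as many as the boundary vertices of `Λ`. -/
theorem exists_injOn_outerBoundary [Countable V] [Nonempty V] {ι : Type*} {I : Set ι}
    {B : ι → Set V} {Λ : Set V}
    (hΛ : Λ.Finite) (hB : ∀ i ∈ I, B i ⊆ Λ) (hdisj : I.PairwiseDisjoint B)
    (hf : ∀ i ∈ I, H.IsFurcation (B i)) :
    ∃ f : ι → V, Set.InjOn f I ∧ ∀ i ∈ I, f i ∈ H.outerBoundary Λ := by
  classical
  obtain ⟨ρ, hρ⟩ := exists_injective_nat V
  -- The root is the first boundary vertex of the cluster. It depends on the cluster only, so two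
  -- furcation sets that select the same vertex share it.
  have hroot (y : V) (hy : y ∈ H.outerBoundary Λ) : ∃ r ∈ H.outerBoundary Λ, H.Reachable y r ∧
      ∀ z ∈ H.outerBoundary Λ, H.Reachable y z → ρ r ≤ ρ z := by
    obtain ⟨r, hr, h⟩ := exists_min_rank ρ
      (Y := {z | z ∈ H.outerBoundary Λ ∧ H.Reachable y z}) ⟨y, hy, Reachable.refl _⟩
    exact ⟨r, hr.1, hr.2, fun z hz hz' => h z ⟨hz, hz'⟩⟩
  have hsel (i : ι) (hi : i ∈ I) : ∃ r y y', BranchSelection H (H.outerBoundary Λ) ρ (B i) r y y' ∧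
      r ∈ H.outerBoundary Λ ∧ H.Reachable y r ∧
      ∀ z ∈ H.outerBoundary Λ, H.Reachable y z → ρ r ≤ ρ z := by
    obtain ⟨b, hb, u, hu, -⟩ := (hf i hi).branches
    obtain ⟨z, hz, huz⟩ := exists_mem_outerBoundary hΛ (hB i hi) hb (hu 0).1 (hu 0).2.1 (hu 0).2.2
    obtain ⟨r, hr, hzr, hmin⟩ := hroot z hz
    obtain ⟨y, y', h⟩ := (hf i hi).exists_branchSelection hΛ (hB i hi) hρ r
    obtain ⟨c, hc, hyc⟩ := h.reachable
    have hyz : H.Reachable y z :=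
      (hyc.trans (((hf i hi).connected c hc b hb).mono within_le)).trans
        ((hu 0).2.1.symm.trans (huz.mono avoiding_le))
    exact ⟨r, y, y', h, hr, hyz.trans hzr, fun w hw hyw => hmin w hw (hyz.symm.trans hyw)⟩
  choose! r y y' h₁ h₂ h₃ h₄ using hsel
  refine ⟨y, fun i hi j hj hij => ?_, fun i hi => (h₁ i hi).mem⟩
  by_contra hne
  have hrr : r i = r j := by
    refine hρ (le_antisymm (h₄ i hi _ (h₂ j hj) ?_) (h₄ j hj _ (h₂ i hi) ?_))
    · rw [hij]; exact h₃ j hj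
    · rw [← hij]; exact h₃ i hi
  have hj' := h₁ j hj
  rw [← hij, ← hrr] at hj'
  exact (h₁ i hi).false_of_disjoint (fun z hz hzB => hz.1 (hB i hi hzB)) (hdisj hi hj hne)
    (hf i hi).connected (hf j hj).connected hj' (h₃ i hi)

/-! ### Opening finitely many edges -/

/-- In a locally finite graph, removing a finite set from an infinite cluster leaves an infinite
component. -/
lemma exists_infinite_branch (hH : ∀ x, {y | H.Adj x y}.Finite) (hB : B.Finite) {x : V}
    (hx : x ∈ B) (hinf : {v | H.Reachable x v}.Infinite) :
    ∃ u ∉ B, H.Reachable u x ∧ {v | (H.avoiding B).Reachable u v}.Infinite := by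
  by_contra! hcon
  -- Every vertex of the cluster outside `B` lies in the branch of some neighbour of `B`, and local
  -- finiteness leaves finitely many of these.
  let N : Set V := {u | u ∉ B ∧ H.Reachable u x ∧ ∃ b ∈ B, H.Adj b u}
  have hN : N.Finite := (hB.biUnion fun b _ => hH b).subset fun u hu => by
    obtain ⟨-, -, b, hb, h⟩ := hu
    exact Set.mem_biUnion hb h
  refine hinf ((hB.union (hN.biUnion fun u hu => hcon u hu.1 hu.2.1)).subset fun v hv => ?_)
  by_cases hvB : v ∈ B
  · exact Or.inl hvB
  · obtain ⟨u, w, hvu, huw, hw⟩ := exists_entry hx (Reachable.symm hv) hvB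
    exact Or.inr (Set.mem_biUnion (x := u)
      ⟨notMem_of_avoiding_reachable hvB hvu, (hvu.mono avoiding_le).symm.trans
        (Reachable.symm hv), w, hw, huw.symm⟩ hvu.symm)

variable {H' : SimpleGraph V}

/-- Joining three infinite clusters through a finite connected set creates a furcation set. -/
lemma isFurcation_of_join (hH : ∀ x, {y | H.Adj x y}.Finite) (hB : B.Finite) (hle : H ≤ H')
    (hH' : ∀ u v, H'.Adj u v → H.Adj u v ∨ (u ∈ B ∧ v ∈ B))
    (hconn : ∀ x ∈ B, ∀ y ∈ B, (H'.within B).Reachable x y) {x : Fin 3 → V} (hx : ∀ i, x i ∈ B)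
    (hinf : ∀ i, {v | H.Reachable (x i) v}.Infinite)
    (hne : ∀ i j, i ≠ j → ¬ H.Reachable (x i) (x j)) : H'.IsFurcation B := by
  -- The added edges lie inside `B`, so they disappear with `B`.
  have havoid : H'.avoiding B = H.avoiding B := by
    ext u v
    constructor
    · rintro ⟨h, hu, hv⟩
      exact ⟨(hH' u v h).resolve_right fun h => hu h.1, hu, hv⟩
    · rintro ⟨h, hu, hv⟩
      exact ⟨hle h, hu, hv⟩
  choose u hu₁ hu₂ hu₃ using fun i => exists_infinite_branch hH hB (hx i) (hinf i)
  refine ⟨hconn, x 0, hx 0, u, fun i => ⟨hu₁ i, ?_, ?_⟩, fun i j hij h => hne i j hij ?_⟩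
  · exact ((hu₂ i).mono hle).trans ((hconn _ (hx i) _ (hx 0)).mono within_le)
  · rw [havoid]; exact hu₃ i
  · rw [havoid] at h
    exact (hu₂ i).symm.trans ((h.mono avoiding_le).trans (hu₂ j))

/-- Adding finitely many edges does not create an infinite cluster out of finite ones. -/
lemma exists_infinite_of_join (hB : B.Finite)
    (hH' : ∀ u v, H'.Adj u v → H.Adj u v ∨ (u ∈ B ∧ v ∈ B)) {v : V}
    (hinf : {w | H'.Reachable v w}.Infinite) :
    ∃ w, H'.Reachable v w ∧ {z | H.Reachable w z}.Infinite := by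
  by_contra! hcon
  -- Following an `H'`-path from `v`, each vertex is `H`-connected to `v` or to the endpoint in `B`
  -- of the last added edge.
  let N : Set V := {w | w ∈ insert v B ∧ H'.Reachable v w}
  have hN : N.Finite := (hB.insert v).subset fun w hw => hw.1
  refine hinf ((hN.biUnion fun w hw => hcon w hw.2).subset fun z hz => ?_)
  refine Reachable.tail_induction (p := fun z => z ∈ ⋃ w ∈ N, {z | H.Reachable w z})
    (Set.mem_biUnion (x := v) ⟨Set.mem_insert _ _, Reachable.refl _⟩ (Reachable.refl _)) ?_ hz
  intro a c hac ha hmem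
  rcases hH' a c hac with h | h
  · obtain ⟨w, hw, hwa⟩ := Set.mem_iUnion₂.1 hmem
    exact Set.mem_biUnion hw (Reachable.step hwa h)
  · exact Set.mem_biUnion (x := c) ⟨Set.mem_insert_of_mem _ h.2, ha.step hac⟩ (Reachable.refl _)

lemma Walk.within_reachable {u v : V} (w : H.Walk u v) (hw : ∀ x ∈ w.support, x ∈ B) :
    (H.within B).Reachable u v := by
  induction w with
  | nil => exact Reachable.refl _
  | @cons u v' _ h w ih =>
    have h₁ : ∀ x ∈ w.support, x ∈ B := fun x hx => hw x (by simp [hx])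
    exact (Adj.reachable (⟨h, hw u (by simp), h₁ v' w.start_mem_support⟩ :
      (H.within B).Adj u v')).trans (ih h₁)

/-- In a connected graph, finite sets are contained in finite connected sets. -/
lemma Preconnected.exists_finset_connected (hH : H.Preconnected) (X : Finset V) :
    ∃ B : Finset V, X ⊆ B ∧ ∀ x ∈ B, ∀ y ∈ B, (H.within B).Reachable x y := by
  classical
  rcases X.eq_empty_or_nonempty with rfl | ⟨o, -⟩
  · exact ⟨∅, by simp⟩
  let w : ∀ x, H.Walk o x := fun x => (hH o x).some
  let B : Finset V := X.biUnion fun x => (w x).support.toFinset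
  have hB (x : V) (hx : x ∈ B) : (H.within B).Reachable o x := by
    obtain ⟨z, hz, hx⟩ := Finset.mem_biUnion.1 hx
    rw [List.mem_toFinset] at hx
    refine ((w z).takeUntil x hx).within_reachable fun y hy => ?_
    exact Finset.mem_coe.2 (Finset.mem_biUnion.2
      ⟨z, hz, List.mem_toFinset.2 ((w z).support_takeUntil_subset_support hx hy)⟩)
  refine ⟨B, fun x hx => Finset.mem_biUnion.2 ⟨x, hx, by simp⟩, fun x hx y hy => ?_⟩
  exact (hB x hx).symm.trans (hB y hy)

end SimpleGraph

/-! ### Measurability of connection events -/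

section

variable {V Ω : Type*} [MeasurableSpace Ω]

/-- Connection is a countable union over walk lengths, and walks of a given length are handled by a
countable union over the first step. -/
lemma measurable_reachable [Countable V] {H : Ω → SimpleGraph V}
    (hH : ∀ u v, Measurable fun ω => (H ω).Adj u v) (u v : V) :
    Measurable fun ω => (H ω).Reachable u v := by
  have h (n : ℕ) : ∀ u, Measurable fun ω => ∃ w : (H ω).Walk u v, w.length = n := by
    induction n with
    | zero =>
      intro u
      simpa only [SimpleGraph.Walk.exists_length_eq_zero_iff] using measurable_const
    | succ n ih =>
      intro u
      have : (fun ω => ∃ w : (H ω).Walk u v, w.length = n + 1) =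
          fun ω => ∃ x, (H ω).Adj u x ∧ ∃ w : (H ω).Walk x v, w.length = n := by
        ext ω
        constructor
        · rintro ⟨w, hw⟩
          cases w with
          | nil => simp at hw
          | cons h w => exact ⟨_, h, w, by simpa using hw⟩
        · rintro ⟨x, hx, w, hw⟩
          exact ⟨SimpleGraph.Walk.cons hx w, by simp [hw]⟩
      rw [this]
      exact Measurable.exists fun x => (hH u x).and (ih x)
  have : (fun ω => (H ω).Reachable u v) = fun ω => ∃ n, ∃ w : (H ω).Walk u v, w.length = n := by
    ext ω
    exact ⟨fun ⟨w⟩ => ⟨_, w, rfl⟩, fun ⟨_, w, _⟩ => ⟨w⟩⟩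
  rw [this]
  exact Measurable.exists fun n => h n u

lemma measurable_infinite [Countable V] {p : Ω → V → Prop} (hp : ∀ v, Measurable fun ω => p ω v) :
    Measurable fun ω => {v | p ω v}.Infinite := by
  have : (fun ω => {v | p ω v}.Infinite) = fun ω => ∀ F : Finset V, ∃ v, v ∉ F ∧ p ω v := by
    ext ω
    constructor
    · intro h F
      obtain ⟨v, hv, hvF⟩ := h.exists_notMem_finset F
      exact ⟨v, hvF, hv⟩
    · intro h hfin
      obtain ⟨v, hv, hv'⟩ := h hfin.toFinset
      exact hv (hfin.mem_toFinset.2 hv')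
  rw [this]
  exact Measurable.forall fun F => Measurable.exists fun v => measurable_const.and (hp v)

lemma measurable_isFurcation [Countable V] {H : Ω → SimpleGraph V}
    (hH : ∀ u v, Measurable fun ω => (H ω).Adj u v) (B : Set V) :
    Measurable fun ω => (H ω).IsFurcation B := by
  have hw (u v : V) : Measurable fun ω => ((H ω).within B).Reachable u v :=
    measurable_reachable (fun u v => (hH u v).and measurable_const) u v
  have ha (u v : V) : Measurable fun ω => ((H ω).avoiding B).Reachable u v :=
    measurable_reachable (fun u v => (hH u v).and measurable_const) u v
  have : (fun ω => (H ω).IsFurcation B) = fun ω =>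
      (∀ x, x ∈ B → ∀ y, y ∈ B → ((H ω).within B).Reachable x y) ∧
      ∃ b, b ∈ B ∧ ∃ u : Fin 3 → V, (∀ i, u i ∉ B ∧ (H ω).Reachable (u i) b ∧
        {v | ((H ω).avoiding B).Reachable (u i) v}.Infinite) ∧
        ∀ i j, i ≠ j → ¬ ((H ω).avoiding B).Reachable (u i) (u j) := by
    ext ω
    exact ⟨fun h => ⟨h.1, h.2⟩, fun h => ⟨h.1, h.2⟩⟩
  rw [this]
  refine Measurable.and ?_ ?_
  · exact Measurable.forall fun x => measurable_const.imp (Measurable.forall fun y =>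
      measurable_const.imp (hw x y))
  · refine Measurable.exists fun b => measurable_const.and (Measurable.exists fun u => ?_)
    refine Measurable.and ?_ ?_
    · exact Measurable.forall fun i => measurable_const.and
        ((measurable_reachable hH _ _).and (measurable_infinite fun v => ha _ v))
    · exact Measurable.forall fun i => Measurable.forall fun j =>
        measurable_const.imp (ha _ _).not

end

/-! ### Opening bonds and shifting configurations -/

section

variable {V : Type*}

lemma openGraph_adj {ω : Bond V → Bool} {u v : V} :
    (openGraph ω).Adj u v ↔ ∃ h : ¬ s(u, v).IsDiag, ω ⟨s(u, v), h⟩ = true := by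
  rw [openGraph, SimpleGraph.fromEdgeSet_adj]
  refine ⟨fun h => h.1, fun h => ⟨h, fun huv => h.1 ?_⟩⟩
  rw [huv]; simp

lemma measurable_openGraph_adj (u v : V) :
    Measurable fun ω : Bond V → Bool => (openGraph ω).Adj u v := by
  simp only [openGraph_adj]
  refine Measurable.exists fun h => ?_
  exact measurableSet_setOfPred.1 ((measurable_pi_apply (⟨s(u, v), h⟩ : Bond V) :
    Measurable fun ω : Bond V → Bool => ω ⟨s(u, v), h⟩) (measurableSet_singleton true))

lemma openGraph_comp_permute (θ : V ≃ V) (ω : Bond V → Bool) :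
    openGraph (ω ∘ Bond.permute θ) = (openGraph ω).comap θ := by
  ext u v
  rw [SimpleGraph.comap_adj, openGraph_adj, openGraph_adj]
  constructor
  · rintro ⟨h, h'⟩
    exact ⟨fun hd => h (by simpa using hd), h'⟩
  · rintro ⟨h, h'⟩
    exact ⟨fun hd => h (by simpa using hd), h'⟩

variable [DecidableEq V]

/-- The configuration `ω`, with the bonds of `F` opened. -/
def openBonds (F : Finset (Bond V)) (ω : Bond V → Bool) : Bond V → Bool :=
  fun e => if e ∈ F then true else ω e

lemma openGraph_le_openBonds (F : Finset (Bond V)) (ω : Bond V → Bool) :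
    openGraph ω ≤ openGraph (openBonds F ω) := by
  intro u v h
  rw [openGraph_adj] at h ⊢
  obtain ⟨h, h'⟩ := h
  refine ⟨h, ?_⟩
  rw [openBonds]; split_ifs
  exacts [rfl, h']

lemma openGraph_openBonds_adj {F : Finset (Bond V)} {B : Finset V} (hF : F ⊆ bondsIn B)
    {ω : Bond V → Bool} {u v : V} (h : (openGraph (openBonds F ω)).Adj u v) :
    (openGraph ω).Adj u v ∨ (u ∈ (B : Set V) ∧ v ∈ (B : Set V)) := by
  rw [openGraph_adj] at h ⊢
  obtain ⟨h, h'⟩ := h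
  by_cases hmem : (⟨s(u, v), h⟩ : Bond V) ∈ F
  · have := mem_bondsIn.1 (hF hmem)
    exact Or.inr ⟨this u (by simp), this v (by simp)⟩
  · rw [openBonds, if_neg hmem] at h'
    exact Or.inl ⟨h, h'⟩

lemma measurable_openBonds (F : Finset (Bond V)) : Measurable (openBonds F) := by
  refine measurable_pi_lambda _ fun e => ?_
  unfold openBonds
  split_ifs
  exacts [measurable_const, measurable_pi_apply e]

/-- The configuration `ω`, with the bond `e` opened. -/
def openBond (e : Bond V) (ω : Bond V → Bool) : Bond V → Bool := Function.update ω e true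

lemma measurable_openBond (e : Bond V) : Measurable (openBond e) := by
  refine measurable_pi_lambda _ fun e' => ?_
  unfold openBond
  by_cases h : e' = e
  · subst h; simp
  · simpa [Function.update_of_ne h] using measurable_pi_apply e'

lemma map_openBonds_absolutelyContinuous {ν : Measure (Bond V → Bool)} (F : Finset (Bond V))
    (hν : ∀ e ∈ F, ν.map (openBond e) ≪ ν) : ν.map (openBonds F) ≪ ν := by
  induction F using Finset.induction_on with
  | empty =>
    have : openBonds (∅ : Finset (Bond V)) = id := by ext ω e; simp [openBonds]
    rw [this, Measure.map_id]
  | insert e F he ih =>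
    have : openBonds (insert e F) = openBond e ∘ openBonds F := by
      ext ω e'
      by_cases h : e' = e
      · subst h; simp [openBonds, openBond]
      · simp [openBonds, openBond, h]
    rw [this, ← Measure.map_map (measurable_openBond e) (measurable_openBonds F)]
    exact ((ih fun e' he' => hν e' (Finset.mem_insert_of_mem he')).map
      (measurable_openBond e)).trans (hν e (Finset.mem_insert_self _ _))

end

namespace SimpleGraph

variable {V : Type*} {H : SimpleGraph V}

lemma reachable_iso_iff {H' : SimpleGraph V} (i : H ≃g H') {u v : V} :
    H'.Reachable (i u) (i v) ↔ H.Reachable u v := Iso.reachable_iff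

/-- Furcation sets are carried by isomorphisms. -/
lemma IsFurcation.of_comap {θ : V ≃ V} {B : Set V} (h : (H.comap θ).IsFurcation B) :
    H.IsFurcation (θ '' B) := by
  have hm {x : V} : θ x ∈ θ '' B ↔ x ∈ B := θ.injective.mem_set_image
  let i₀ : H.comap θ ≃g H := ⟨θ, Iff.rfl⟩
  let i₁ : (H.comap θ).within B ≃g H.within (θ '' B) :=
    ⟨θ, by intro a b; exact and_congr Iff.rfl (and_congr hm hm)⟩
  let i₂ : (H.comap θ).avoiding B ≃g H.avoiding (θ '' B) :=
    ⟨θ, by intro a b; exact and_congr Iff.rfl (and_congr (not_congr hm) (not_congr hm))⟩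
  have r₀ {x y : V} : H.Reachable (θ x) (θ y) ↔ (H.comap θ).Reachable x y :=
    reachable_iso_iff i₀
  have r₁ {x y : V} : (H.within (θ '' B)).Reachable (θ x) (θ y) ↔
      ((H.comap θ).within B).Reachable x y := reachable_iso_iff i₁
  have r₂ {x y : V} : (H.avoiding (θ '' B)).Reachable (θ x) (θ y) ↔
      ((H.comap θ).avoiding B).Reachable x y := reachable_iso_iff i₂
  refine ⟨?_, ?_⟩
  · rintro _ ⟨x, hx, rfl⟩ _ ⟨y, hy, rfl⟩
    exact r₁.2 (h.connected x hx y hy)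
  · obtain ⟨b, hb, u, hu, hne⟩ := h.branches
    refine ⟨θ b, ⟨b, hb, rfl⟩, fun i => θ (u i), fun i => ⟨fun hi => (hu i).1 (hm.1 hi),
      r₀.2 (hu i).2.1, ?_⟩, fun i j hij h => hne i j hij (r₂.1 h)⟩
    have := (hu i).2.2.image θ.injective.injOn
    refine this.mono ?_
    rintro _ ⟨v, hv, rfl⟩
    exact r₂.2 hv

end SimpleGraph

/-! ### Absence of furcation sets in translation-invariant percolation -/

section

variable {V : Type*} [Countable V] [Nonempty V] [DecidableEq V]

/-- The expected number of furcation sets among disjoint subsets of `Λ` is at most the expected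
number of open bonds that leave `Λ`. -/
lemma sum_measure_isFurcation_le (ν : Measure (Bond V → Bool)) {ι : Type*} (I : Finset ι)
    {B : ι → Set V} {Λ : Finset V} (hB : ∀ i ∈ I, B i ⊆ Λ)
    (hdisj : (I : Set ι).PairwiseDisjoint B) :
    ∑ i ∈ I, ν {ω | (openGraph ω).IsFurcation (B i)} ≤
      ∑ x ∈ Λ, ∑' y, if y ∈ Λ then 0 else ν {ω | (openGraph ω).Adj x y} := by
  classical
  have hmf (i : ι) : MeasurableSet {ω : Bond V → Bool | (openGraph ω).IsFurcation (B i)} :=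
    measurableSet_setOfPred.2 (measurable_isFurcation measurable_openGraph_adj (B i))
  have hma (x y : V) : MeasurableSet {ω : Bond V → Bool | (openGraph ω).Adj x y} :=
    measurableSet_setOfPred.2 (measurable_openGraph_adj x y)
  -- For each configuration, furcation sets inject into the outer boundary of `Λ`, and each boundary
  -- vertex carries at least one open bond to `Λ`.
  have hpt (ω : Bond V → Bool) :
      ∑ i ∈ I, {ω | (openGraph ω).IsFurcation (B i)}.indicator (1 : (Bond V → Bool) → ℝ≥0∞) ω ≤
      ∑ x ∈ Λ, ∑' y, if y ∈ Λ then 0 else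
        {ω | (openGraph ω).Adj x y}.indicator (1 : (Bond V → Bool) → ℝ≥0∞) ω := by
    let I' : Finset ι := I.filter fun i => (openGraph ω).IsFurcation (B i)
    obtain ⟨f, hf, hfY⟩ := SimpleGraph.exists_injOn_outerBoundary (H := openGraph ω)
      (I := (I' : Set ι)) (B := B) (Λ := (Λ : Set V)) Λ.finite_toSet
      (fun i hi => hB i (Finset.mem_filter.1 hi).1)
      (hdisj.subset fun i hi => (Finset.mem_filter.1 hi).1)
      fun i hi => (Finset.mem_filter.1 hi).2
    have h₁ : ∑ i ∈ I,
        {ω | (openGraph ω).IsFurcation (B i)}.indicator (1 : (Bond V → Bool) → ℝ≥0∞) ω =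
        ∑ i ∈ I', 1 := by
      rw [Finset.sum_filter]
      exact Finset.sum_congr rfl fun i _ => by simp [Set.indicator_apply]
    have h₂ (y : V) (hy : y ∈ I'.image f) : (1 : ℝ≥0∞) ≤ ∑ x ∈ Λ, if y ∈ Λ then 0 else
        {ω | (openGraph ω).Adj x y}.indicator (1 : (Bond V → Bool) → ℝ≥0∞) ω := by
      obtain ⟨i, hi, rfl⟩ := Finset.mem_image.1 hy
      obtain ⟨hn, x, hx, hadj⟩ := hfY i hi
      refine le_trans ?_ (Finset.single_le_sum (fun _ _ => zero_le) hx)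
      rw [if_neg (by simpa using hn), Set.indicator_of_mem (by exact hadj)]
      rfl
    calc _ = ∑ i ∈ I', (1 : ℝ≥0∞) := h₁
      _ = ∑ y ∈ I'.image f, (1 : ℝ≥0∞) := by rw [Finset.sum_image hf]
      _ ≤ ∑ y ∈ I'.image f, ∑ x ∈ Λ, if y ∈ Λ then 0 else
          {ω | (openGraph ω).Adj x y}.indicator (1 : (Bond V → Bool) → ℝ≥0∞) ω :=
        Finset.sum_le_sum h₂
      _ = ∑ x ∈ Λ, ∑ y ∈ I'.image f, if y ∈ Λ then 0 else
          {ω | (openGraph ω).Adj x y}.indicator (1 : (Bond V → Bool) → ℝ≥0∞) ω := Finset.sum_comm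
      _ ≤ _ := Finset.sum_le_sum fun x _ => ENNReal.sum_le_tsum _
  have hmt (x y : V) : Measurable fun ω : Bond V → Bool => if y ∈ Λ then (0 : ℝ≥0∞) else
      {ω | (openGraph ω).Adj x y}.indicator 1 ω := by
    split_ifs
    exacts [measurable_const, measurable_one.indicator (hma x y)]
  calc ∑ i ∈ I, ν {ω | (openGraph ω).IsFurcation (B i)}
      = ∫⁻ ω, ∑ i ∈ I,
        {ω | (openGraph ω).IsFurcation (B i)}.indicator (1 : (Bond V → Bool) → ℝ≥0∞) ω ∂ν := by
        rw [lintegral_finsetSum _ fun i _ => measurable_one.indicator (hmf i)]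
        exact Finset.sum_congr rfl fun i _ => (lintegral_indicator_one (hmf i)).symm
    _ ≤ ∫⁻ ω, ∑ x ∈ Λ, ∑' y, (if y ∈ Λ then 0 else
        {ω | (openGraph ω).Adj x y}.indicator (1 : (Bond V → Bool) → ℝ≥0∞) ω) ∂ν :=
      lintegral_mono hpt
    _ = _ := by
        rw [lintegral_finsetSum _ fun x _ => Measurable.tsum fun y => hmt x y]
        refine Finset.sum_congr rfl fun x _ => ?_
        rw [lintegral_tsum fun y => (hmt x y).aemeasurable]
        refine tsum_congr fun y => ?_
        split_ifs
        · simp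
        · exact lintegral_indicator_one (hma x y)

end

/-! ### Boundary effects in large boxes and the density of furcation sets. -/

/-- The box `[0, n)^d`. -/
noncomputable def cornerBox (d n : ℕ) : Finset (Fin d → ℤ) :=
  Fintype.piFinset fun _ => Finset.Ico 0 (n : ℤ)

lemma mem_cornerBox {d n : ℕ} {x : Fin d → ℤ} : x ∈ cornerBox d n ↔ ∀ i, 0 ≤ x i ∧ x i < n := by
  simp [cornerBox]

lemma card_cornerBox (d n : ℕ) : (cornerBox d n).card = n ^ d := by
  simp [cornerBox]

/-- The number of vertices of the box that are moved out of it by the translation by `z`. -/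
noncomputable def exitCount (d n : ℕ) (z : Fin d → ℤ) : ℕ :=
  ((cornerBox d n).filter fun x => x + z ∉ cornerBox d n).card

lemma exitCount_le (d n : ℕ) (z : Fin d → ℤ) : exitCount d n z ≤ n ^ d :=
  (Finset.card_filter_le _ _).trans (card_cornerBox d n).le

/-- The vertices of the smaller cube `[m, n - m)^d` stay in the box under the translation. -/
lemma exitCount_add_le (d : ℕ) (z : Fin d → ℤ) {m n : ℕ} (hz : ∀ i, |z i| ≤ m)
    (hmn : 2 * m ≤ n) : exitCount d n z + (n - 2 * m) ^ d ≤ n ^ d := by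
  have h := Finset.card_filter_add_card_filter_not (s := cornerBox d n)
    (fun x => x + z ∉ cornerBox d n)
  rw [card_cornerBox] at h
  rw [exitCount, ← h]
  gcongr
  calc (n - 2 * m) ^ d = (Fintype.piFinset fun _ : Fin d =>
        Finset.Ico (m : ℤ) ((n : ℤ) - m)).card := by
        simp only [Fintype.card_piFinset, Int.card_Ico, Finset.prod_const, Finset.card_univ,
          Fintype.card_fin]
        congr 1
        omega
    _ ≤ _ := by
        refine Finset.card_le_card fun x hx => ?_
        simp only [Fintype.mem_piFinset, Finset.mem_Ico] at hx
        rw [Finset.mem_filter, not_not, mem_cornerBox, mem_cornerBox]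
        refine ⟨fun i => ?_, fun i => ?_⟩
        · have := hx i; omega
        · have := hx i
          have := abs_le.1 (hz i)
          rw [Pi.add_apply]; omega

lemma tendsto_exitCount (d : ℕ) (z : Fin d → ℤ) :
    Tendsto (fun n => (exitCount d n z : ℝ≥0∞) / (n ^ d : ℕ)) atTop (𝓝 0) := by
  obtain ⟨m, hm⟩ : ∃ m : ℕ, ∀ i, |z i| ≤ m := by
    refine ⟨∑ i, (z i).natAbs, fun i => ?_⟩
    have : (z i).natAbs ≤ ∑ i, (z i).natAbs :=
      Finset.single_le_sum (f := fun i => (z i).natAbs) (fun _ _ => zero_le) (Finset.mem_univ i)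
    rw [Int.abs_eq_natAbs]; omega
  have hreal : Tendsto (fun n : ℕ => 1 - (1 - 2 * m * (n : ℝ)⁻¹) ^ d) atTop (𝓝 0) := by
    have h : Tendsto (fun n : ℕ => 1 - (1 - 2 * m * (n : ℝ)⁻¹) ^ d) atTop
        (𝓝 (1 - (1 - 2 * m * 0) ^ d)) :=
      tendsto_const_nhds.sub ((tendsto_const_nhds.sub
        (tendsto_inv_atTop_nhds_zero_nat.const_mul _)).pow d)
    simpa using h
  have hen := ENNReal.tendsto_ofReal hreal
  rw [ENNReal.ofReal_zero] at hen
  refine tendsto_of_tendsto_of_tendsto_of_le_of_le' tendsto_const_nhds hen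
    (Eventually.of_forall fun _ => zero_le) ?_
  filter_upwards [eventually_ge_atTop (2 * m), eventually_ge_atTop 1] with n hn hn1
  have hpos : (0 : ℝ) < n := by exact_mod_cast hn1
  have h := exitCount_add_le d z hm hn
  have h' : (exitCount d n z : ℝ) + (n - 2 * m) ^ d ≤ (n : ℝ) ^ d := by
    have : ((n - 2 * m : ℕ) : ℝ) = (n : ℝ) - 2 * m := by push_cast [hn]; ring
    rw [← this]; exact_mod_cast h
  have h₁ : (exitCount d n z : ℝ≥0∞) / (n ^ d : ℕ) =
      ENNReal.ofReal ((exitCount d n z : ℝ) / (n : ℝ) ^ d) := by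
    rw [ENNReal.ofReal_div_of_pos (by positivity), ENNReal.ofReal_natCast, ← Nat.cast_pow,
      ENNReal.ofReal_natCast]
  rw [h₁]
  refine ENNReal.ofReal_le_ofReal ?_
  rw [div_le_iff₀ (by positivity)]
  have h₂ : (1 - 2 * m * (n : ℝ)⁻¹) ^ d * (n : ℝ) ^ d = (n - 2 * m) ^ d := by
    rw [← mul_pow]; congr 1; field_simp
  rw [sub_mul, h₂]
  linarith

/-- The summed kernel between the box `[0, n)^d` and its complement is `o(n^d)`. -/
lemma tendsto_boxBoundary {d : ℕ} {p : (Fin d → ℤ) → ℝ≥0∞} (hp : ∑' z, p z ≠ ∞) :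
    Tendsto (fun n : ℕ => (∑ x ∈ cornerBox d n, ∑' y, if y ∈ cornerBox d n then 0 else
      p (y - x)) / (n ^ d : ℕ)) atTop (𝓝 0) := by
  have hsum (n : ℕ) : (∑ x ∈ cornerBox d n, ∑' y, if y ∈ cornerBox d n then 0 else p (y - x)) /
      -- Bonds leaving the box are grouped by their displacement `z`. The fraction multiplying `p z`
      -- is at most `1` and tends to `0`, so dominated convergence for the counting measure applies.
      (n ^ d : ℕ) = ∑' z, p z * ((exitCount d n z : ℝ≥0∞) / (n ^ d : ℕ)) := by
    have h₁ (x : Fin d → ℤ) : (∑' y, if y ∈ cornerBox d n then 0 else p (y - x)) =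
        ∑' z, if x + z ∉ cornerBox d n then p z else 0 := by
      rw [← (Equiv.addLeft x).tsum_eq]
      refine tsum_congr fun z => ?_
      simp only [Equiv.coe_addLeft, add_sub_cancel_left, ite_not]
    rw [Finset.sum_congr rfl fun x _ => h₁ x,
      ← Summable.tsum_finsetSum fun _ _ => ENNReal.summable, div_eq_mul_inv,
      ← ENNReal.tsum_mul_right]
    refine tsum_congr fun z => ?_
    rw [← Finset.sum_filter, Finset.sum_const, nsmul_eq_mul, exitCount, div_eq_mul_inv]
    ring
  simp only [hsum]
  have hlim : Tendsto (fun n : ℕ => ∫⁻ z, p z * ((exitCount d n z : ℝ≥0∞) / (n ^ d : ℕ))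
      ∂Measure.count) atTop (𝓝 (∫⁻ _ : Fin d → ℤ, 0 ∂Measure.count)) := by
    refine tendsto_lintegral_of_dominated_convergence p (fun n => measurable_of_countable _)
      (fun n => Eventually.of_forall fun z => ?_) ?_ (Eventually.of_forall fun z => ?_)
    · refine mul_le_of_le_one_right' (ENNReal.div_le_of_le_mul ?_)
      rw [one_mul]
      exact_mod_cast exitCount_le d n z
    · rwa [lintegral_count]
    · have := ENNReal.Tendsto.const_mul (tendsto_exitCount d z)
        (Or.inr (ENNReal.ne_top_of_tsum_ne_top hp z))
      rwa [mul_zero] at this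
  simpa [lintegral_count] using hlim

section

variable {d : ℕ} {ν : Measure (Bond (Fin d → ℤ) → Bool)}

/-- Translation-invariant percolation with summable bond probabilities has no furcation sets. -/
lemma measure_isFurcation_eq_zero
    (hshift : ∀ a, ν.map (fun ω => ω ∘ Bond.permute (Equiv.addRight a)) = ν)
    {p : (Fin d → ℤ) → ℝ≥0∞} (hp : ∑' z, p z ≠ ∞)
    (hνp : ∀ x y, ν {ω | (openGraph ω).Adj x y} ≤ p (y - x)) (B : Finset (Fin d → ℤ)) :
    ν {ω | (openGraph ω).IsFurcation (B : Set (Fin d → ℤ))} = 0 := by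
  obtain ⟨m, hm⟩ : ∃ m : ℕ, ∀ x ∈ B, ∀ i, |x i| ≤ m := by
    refine ⟨∑ x ∈ B, ∑ i, (x i).natAbs, fun x hx i => ?_⟩
    have h₁ : (x i).natAbs ≤ ∑ i, (x i).natAbs :=
      Finset.single_le_sum (f := fun i => (x i).natAbs) (fun _ _ => zero_le) (Finset.mem_univ i)
    have h₂ : ∑ i, (x i).natAbs ≤ ∑ x ∈ B, ∑ i, (x i).natAbs :=
      Finset.single_le_sum (f := fun x : Fin d → ℤ => ∑ i, (x i).natAbs) (fun _ _ => zero_le) hx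
    rw [Int.abs_eq_natAbs]; omega
  -- The set `B` lies in `[-m, m]^d`, a cube of side `s`. The translations by `a t`, for `t ∈ [0,
  -- L)^d`, place disjoint copies of it in `[0, sL)^d`.
  let s : ℕ := 2 * m + 1
  let a : (Fin d → ℤ) → (Fin d → ℤ) := fun t i => m + s * t i
  have htrans (t : Fin d → ℤ) : ν {ω | (openGraph ω).IsFurcation (B : Set (Fin d → ℤ))} ≤
      ν {ω | (openGraph ω).IsFurcation (Equiv.addRight (a t) '' (B : Set (Fin d → ℤ)))} := by
    have hms : Measurable fun ω : Bond (Fin d → ℤ) → Bool =>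
        ω ∘ Bond.permute (Equiv.addRight (a t)) :=
      measurable_pi_lambda _ fun e => measurable_pi_apply _
    conv_lhs => rw [← hshift (a t)]
    rw [Measure.map_apply hms (measurableSet_setOfPred.2
      (measurable_isFurcation measurable_openGraph_adj _))]
    refine measure_mono fun ω hω => ?_
    simp only [Set.mem_preimage, Set.mem_ofPred_eq, openGraph_comp_permute] at hω
    exact hω.of_comap
  have hq (L : ℕ) : ν {ω | (openGraph ω).IsFurcation (B : Set (Fin d → ℤ))} * (L ^ d : ℕ) ≤
      ∑ x ∈ cornerBox d (s * L), ∑' y, if y ∈ cornerBox d (s * L) then 0 else p (y - x) := by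
    have hcoord {x : Fin d → ℤ} (hx : x ∈ B) (i : Fin d) : 0 ≤ x i + m ∧ x i + m < s := by
      have := abs_le.1 (hm x hx i)
      simp only [s]; omega
    have h := sum_measure_isFurcation_le ν (cornerBox d L)
      (B := fun t => Equiv.addRight (a t) '' (B : Set (Fin d → ℤ))) (Λ := cornerBox d (s * L))
      (by
        rintro t ht _ ⟨x, hx, rfl⟩
        rw [Finset.mem_coe, mem_cornerBox]
        intro i
        have h₁ := hcoord hx i
        have h₂ := mem_cornerBox.1 ht i
        have h₃ : (s : ℤ) * t i ≤ s * (L - 1) := by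
          refine mul_le_mul_of_nonneg_left (by omega) (by positivity)
        have h₄ : 0 ≤ (s : ℤ) * t i := mul_nonneg (by positivity) h₂.1
        simp only [Equiv.coe_addRight, Pi.add_apply, a]
        push_cast
        constructor
        · linarith
        · linarith)
      (by
        intro t _ t' _ hne
        refine Set.disjoint_left.2 ?_
        rintro _ ⟨x, hx, rfl⟩ ⟨x', hx', h⟩
        refine hne (funext fun i => ?_)
        have h₁ := hcoord hx i
        have h₂ := hcoord hx' i
        have h₃ : x' i + (m + s * t' i) = x i + (m + s * t i) := congrFun h i
        have h₄ (u v : ℤ) (hu : 0 ≤ u ∧ u < s) : (u + s * v) / s = v := by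
          rw [Int.add_mul_ediv_left _ _ (by omega), Int.ediv_eq_zero_of_lt hu.1 hu.2, zero_add]
        rw [← h₄ _ (t i) h₁, ← h₄ _ (t' i) h₂]
        congr 1
        linarith)
    calc _ = ∑ t ∈ cornerBox d L, ν {ω | (openGraph ω).IsFurcation (B : Set (Fin d → ℤ))} := by
          rw [Finset.sum_const, card_cornerBox, nsmul_eq_mul, mul_comm]
      _ ≤ _ := Finset.sum_le_sum fun t _ => htrans t
      _ ≤ _ := h
      _ ≤ _ := by
        refine Finset.sum_le_sum fun x _ => ENNReal.tsum_le_tsum fun y => ?_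
        split_ifs
        exacts [le_rfl, hνp x y]
  have hs0 : (s : ℝ≥0∞) ^ d ≠ 0 := pow_ne_zero _ (by simp [s])
  have hst : (s : ℝ≥0∞) ^ d ≠ ∞ := ENNReal.pow_ne_top (by simp)
  have hlim := (tendsto_boxBoundary hp).comp
    (tendsto_id.const_mul_atTop' (by simp [s] : 0 < s))
  -- The bound `hq` is divided by `(sL)^d`, and the right side tends to `0`.
  have hle : ν {ω | (openGraph ω).IsFurcation (B : Set (Fin d → ℤ))} / (s : ℝ≥0∞) ^ d ≤ 0 := by
    refine ge_of_tendsto hlim ?_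
    filter_upwards [eventually_ge_atTop 1] with L hL
    have hL0 : (L : ℝ≥0∞) ^ d ≠ 0 := pow_ne_zero _ (by simpa using (by omega : L ≠ 0))
    have hLt : (L : ℝ≥0∞) ^ d ≠ ∞ := ENNReal.pow_ne_top (by simp)
    simp only [Function.comp_apply, id]
    refine le_trans ?_ (ENNReal.div_le_div_right (hq L) _)
    push_cast
    rw [mul_pow, ENNReal.mul_div_mul_right _ _ hL0 hLt]
  rw [nonpos_iff_eq_zero, ENNReal.div_eq_zero_iff] at hle
  exact hle.resolve_right hst

end

/-! ### Uniqueness of the infinite cluster -/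

section

variable {V : Type*} [AddCommGroup V]

/-- A translation that carries `e` to `f` sends a given endpoint of `e` to one of the two endpoints
of `f`, so only finitely many translations are excluded. -/
lemma exists_permute_addRight_notMem [Infinite V] (E F : Finset (Bond V)) :
    ∃ a : V, ∀ e ∈ E, Bond.permute (Equiv.addRight a) e ∉ F := by
  have hfin (e f : Bond V) : {a : V | Bond.permute (Equiv.addRight a) e = f}.Finite := by
    obtain ⟨e, he⟩ := e
    obtain ⟨f, hf⟩ := f
    induction e using Sym2.ind with | _ u u'
    induction f using Sym2.ind with | _ v v'
    refine (Set.toFinite {v - u, v' - u}).subset fun a ha => ?_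
    have h : s(u + a, u' + a) = s(v, v') := congrArg Subtype.val ha
    have hu : u + a ∈ s(v, v') := h ▸ Sym2.mem_mk_left _ _
    rcases Sym2.mem_iff.1 hu with h | h
    · left; rw [← h]; abel
    · right; rw [Set.mem_singleton_iff, ← h]; abel
  have : (⋃ e ∈ E, ⋃ f ∈ F, {a : V | Bond.permute (Equiv.addRight a) e = f}).Finite :=
    E.finite_toSet.biUnion fun e _ => F.finite_toSet.biUnion fun f _ => hfin e f
  obtain ⟨a, ha⟩ := this.exists_notMem
  refine ⟨a, fun e he hF => ha ?_⟩
  exact Set.mem_biUnion he (Set.mem_biUnion (t := fun f => {a | _ = f}) hF rfl)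

/-- Opening finitely many bonds does not affect, up to null sets, a translation-invariant event. -/
lemma ae_openBonds_mem_iff [DecidableEq V] [Infinite V] {ν : Measure (Bond V → Bool)}
    [IsProbabilityMeasure ν]
    (hshift : ∀ a, ν.map (fun ω => ω ∘ Bond.permute (Equiv.addRight a)) = ν)
    {F : Finset (Bond V)} (hF : ν.map (openBonds F) ≪ ν) {I : Set (Bond V → Bool)}
    (hI : MeasurableSet I)
    (hinv : ∀ a ω, ω ∘ Bond.permute (Equiv.addRight a) ∈ I ↔ ω ∈ I) :
    ∀ᵐ ω ∂ν, openBonds F ω ∈ I ↔ ω ∈ I := by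
  have happrox (n : ℕ) : ∃ C ∈ measurableCylinders (fun _ : Bond V => Bool),
      ν (symmDiff C I) < (2⁻¹ : ℝ≥0∞) ^ n :=
    exists_measure_symmDiff_lt_of_generateFrom_isSetRing isSetRing_measurableCylinders
      ⟨{Set.univ}, Set.countable_singleton _,
        Set.singleton_subset_iff.2 (univ_mem_measurableCylinders _),
        by simp⟩
      generateFrom_measurableCylinders.symm hI (ENNReal.pow_pos (by simp) n)
  choose C hC hCI using happrox
  choose E S hS hES using fun n => (mem_measurableCylinders (C n)).1 (hC n)
  -- The translation by `a n` moves the bonds that determine `C n` off `F`, so opening `F` cannot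
  -- affect the translated cylinder event.
  choose a ha using fun n => exists_permute_addRight_notMem (E n) F
  let τ (n : ℕ) (ω : Bond V → Bool) : Bond V → Bool := ω ∘ Bond.permute (Equiv.addRight (a n))
  have hτ (n : ℕ) : Measurable (τ n) := measurable_pi_lambda _ fun e => measurable_pi_apply _
  have hTC (n : ℕ) (ω : Bond V → Bool) : τ n (openBonds F ω) ∈ C n ↔ τ n ω ∈ C n := by
    rw [hES, mem_cylinder, mem_cylinder]
    have : (E n).restrict (τ n (openBonds F ω)) = (E n).restrict (τ n ω) := by
      ext e
      simp only [Finset.restrict, τ, Function.comp_apply, openBonds, if_neg (ha n e.1 e.2)]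
    rw [this]
  -- Both `ν` and `I` are translation invariant, so the translated cylinder events approximate `I`
  -- equally well. By Borel–Cantelli they decide membership in `I` correctly for all large `n`, and
  -- by absolute continuity this holds for `openBonds F ω` too.
  have hsum : ∑' n, ν (τ n ⁻¹' symmDiff (C n) I) ≠ ∞ := by
    have hle (n : ℕ) : ν (τ n ⁻¹' symmDiff (C n) I) ≤ (2⁻¹ : ℝ≥0∞) ^ n := by
      rw [← Measure.map_apply (hτ n)
        ((MeasurableSet.of_mem_measurableCylinders (hC n)).symmDiff hI), hshift]
      exact (hCI n).le
    refine ne_top_of_le_ne_top ?_ (ENNReal.tsum_le_tsum hle)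
    rw [ENNReal.tsum_geometric]
    simp
  have h₁ := ae_eventually_notMem hsum
  have h₂ := ae_of_ae_map (measurable_openBonds F).aemeasurable (hF.ae_le h₁)
  filter_upwards [h₁, h₂] with ω hω hTω
  obtain ⟨n, h, h'⟩ := (hω.and hTω).exists
  rw [Set.mem_preimage, Set.mem_symmDiff, hinv] at h h'
  have := hTC n ω
  simp only [τ] at this h h'
  tauto

end

section

variable {V : Type*} [DecidableEq V]

open scoped Classical in
/-- The bonds in `B` that are edges of `A`. -/
noncomputable def SimpleGraph.bondsWithin (A : SimpleGraph V) (B : Finset V) : Finset (Bond V) :=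
  (bondsIn B).filter fun e => e.1 ∈ A.edgeSet

lemma SimpleGraph.bondsWithin_subset (A : SimpleGraph V) (B : Finset V) :
    A.bondsWithin B ⊆ bondsIn B := by
  classical exact Finset.filter_subset _ _

lemma SimpleGraph.mem_edgeSet_of_mem_bondsWithin {A : SimpleGraph V} {B : Finset V} {e : Bond V}
    (he : e ∈ A.bondsWithin B) : e.1 ∈ A.edgeSet := by
  classical exact (Finset.mem_filter.1 he).2

lemma SimpleGraph.within_le_openBonds (A : SimpleGraph V) (B : Finset V) (ω : Bond V → Bool) :
    A.within B ≤ (openGraph (openBonds (A.bondsWithin B) ω)).within B := by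
  classical
  rintro u v ⟨h, hu, hv⟩
  refine ⟨openGraph_adj.2 ⟨fun hd => h.ne (by simpa using hd), ?_⟩, hu, hv⟩
  rw [openBonds, if_pos]
  refine Finset.mem_filter.2 ⟨mem_bondsIn.2 fun x hx => ?_, h⟩
  rcases Sym2.mem_iff.1 hx with rfl | rfl
  exacts [hu, hv]

end

section

variable {d : ℕ} {ν : Measure (Bond (Fin d → ℤ) → Bool)}

/-- By Borel–Cantelli, since the expected degree of each vertex is finite. -/
lemma ae_locallyFinite {p : (Fin d → ℤ) → ℝ≥0∞} (hp : ∑' z, p z ≠ ∞)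
    (hνp : ∀ x y, ν {ω | (openGraph ω).Adj x y} ≤ p (y - x)) :
    ∀ᵐ ω ∂ν, ∀ x, {y | (openGraph ω).Adj x y}.Finite := by
  refine ae_all_iff.2 fun x =>
    ae_finite_setOfPred_mem (s := fun y => {ω | (openGraph ω).Adj x y}) ?_
  refine ne_top_of_le_ne_top ?_ (ENNReal.tsum_le_tsum fun y => hνp x y)
  exact ((Equiv.subRight x).tsum_eq p).trans_ne hp

/-- There are at most two infinite clusters. -/
lemma ae_not_three_infinite_clusters
    (hshift : ∀ a, ν.map (fun ω => ω ∘ Bond.permute (Equiv.addRight a)) = ν)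
    {p : (Fin d → ℤ) → ℝ≥0∞} (hp : ∑' z, p z ≠ ∞)
    (hνp : ∀ x y, ν {ω | (openGraph ω).Adj x y} ≤ p (y - x))
    {A : SimpleGraph (Fin d → ℤ)} (hA : A.Preconnected)
    (hins : ∀ e : Bond (Fin d → ℤ), e.1 ∈ A.edgeSet → ν.map (openBond e) ≪ ν) :
    ∀ᵐ ω ∂ν, ∀ x : Fin 3 → Fin d → ℤ, ¬ ((∀ i, {v | (openGraph ω).Reachable (x i) v}.Infinite) ∧
      ∀ i j, i ≠ j → ¬ (openGraph ω).Reachable (x i) (x j)) := by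
  refine ae_all_iff.2 fun x => ?_
  obtain ⟨B, hxB, hB⟩ := hA.exists_finset_connected (Finset.univ.image x)
  have hac := map_openBonds_absolutelyContinuous (A.bondsWithin B)
    fun e he => hins e (SimpleGraph.mem_edgeSet_of_mem_bondsWithin he)
  have hfurc : ∀ᵐ ω ∂ν, ¬ (openGraph ω).IsFurcation (B : Set (Fin d → ℤ)) := by
    rw [ae_iff]
    simpa using measure_isFurcation_eq_zero hshift hp hνp B
  -- Almost surely `B` is not a furcation set even once the bonds of `A` inside it are opened,
  -- whereas opening them would join the three clusters into one.
  filter_upwards [ae_locallyFinite hp hνp,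
    ae_of_ae_map (measurable_openBonds _).aemeasurable (hac.ae_le hfurc)] with ω hω hTω h
  exact hTω (SimpleGraph.isFurcation_of_join hω B.finite_toSet (openGraph_le_openBonds _ ω)
    (fun u v => openGraph_openBonds_adj (A.bondsWithin_subset B))
    (fun u hu v hv => (hB u hu v hv).mono (A.within_le_openBonds B ω))
    (fun i => hxB (Finset.mem_image_of_mem x (Finset.mem_univ i))) h.1 h.2)

/-- Uniqueness of the infinite cluster, for translation-invariant percolation with summable bond
probabilities in which the edges of a connected graph may be opened. -/
theorem ae_atMostOneInfiniteCluster [IsProbabilityMeasure ν]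
    (hshift : ∀ a, ν.map (fun ω => ω ∘ Bond.permute (Equiv.addRight a)) = ν)
    {p : (Fin d → ℤ) → ℝ≥0∞} (hp : ∑' z, p z ≠ ∞)
    (hνp : ∀ x y, ν {ω | (openGraph ω).Adj x y} ≤ p (y - x))
    {A : SimpleGraph (Fin d → ℤ)} (hA : A.Preconnected)
    (hins : ∀ e : Bond (Fin d → ℤ), e.1 ∈ A.edgeSet → ν.map (openBond e) ≪ ν) :
    ∀ᵐ ω ∂ν, AtMostOneInfiniteCluster ω := by
  -- For `d = 0` there is a single vertex; otherwise the lattice is infinite, as the translation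
  -- argument requires.
  rcases finite_or_infinite (Fin d → ℤ) with hfin | hinf
  · exact Eventually.of_forall fun ω C _ hC => absurd (Set.toFinite C.supp) hC
  let D (x y : Fin d → ℤ) (ω : Bond (Fin d → ℤ) → Bool) : Prop :=
    {v | (openGraph ω).Reachable x v}.Infinite ∧ {v | (openGraph ω).Reachable y v}.Infinite ∧
      ¬ (openGraph ω).Reachable x y
  let I : Set (Bond (Fin d → ℤ) → Bool) := {ω | ∃ x y, D x y ω}
  have hreach (x y : Fin d → ℤ) :
      Measurable fun ω : Bond (Fin d → ℤ) → Bool => (openGraph ω).Reachable x y :=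
    measurable_reachable measurable_openGraph_adj x y
  have hI : MeasurableSet I := measurableSet_setOfPred.2 <| Measurable.exists fun x =>
    Measurable.exists fun y => (measurable_infinite (hreach x)).and
      ((measurable_infinite (hreach y)).and (hreach x y).not)
  have hD (a x y : Fin d → ℤ) (ω : Bond (Fin d → ℤ) → Bool) :
      D x y (ω ∘ Bond.permute (Equiv.addRight a)) ↔ D (x + a) (y + a) ω := by
    have hr (u v : Fin d → ℤ) : (openGraph (ω ∘ Bond.permute (Equiv.addRight a))).Reachable u v ↔
        (openGraph ω).Reachable (u + a) (v + a) := by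
      rw [openGraph_comp_permute]
      exact (SimpleGraph.reachable_iso_iff (⟨Equiv.addRight a, Iff.rfl⟩ :
        (openGraph ω).comap (Equiv.addRight a) ≃g openGraph ω)).symm
    have hs (u : Fin d → ℤ) :
        {v | (openGraph (ω ∘ Bond.permute (Equiv.addRight a))).Reachable u v}.Infinite ↔
        {v | (openGraph ω).Reachable (u + a) v}.Infinite := by
      simp only [hr]
      rw [← Set.infinite_image_iff (f := Equiv.addRight a) (Equiv.injective _).injOn]
      exact iff_of_eq (congrArg Set.Infinite (Set.image_preimage_eq
        {v | (openGraph ω).Reachable (u + a) v} (Equiv.addRight a).surjective))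
    simp only [D, hs]
    rw [hr]
  have hinv (a : Fin d → ℤ) (ω : Bond (Fin d → ℤ) → Bool) :
      ω ∘ Bond.permute (Equiv.addRight a) ∈ I ↔ ω ∈ I := by
    constructor
    · rintro ⟨x, y, h⟩
      exact ⟨x + a, y + a, (hD a x y ω).1 h⟩
    · rintro ⟨x, y, h⟩
      exact ⟨x - a, y - a, (hD a _ _ ω).2 (by simpa using h)⟩
  have hnot (x y : Fin d → ℤ) : ∀ᵐ ω ∂ν, ¬ D x y ω := by
    obtain ⟨B, hxB, hB⟩ := hA.exists_finset_connected {x, y}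
    have hac := map_openBonds_absolutelyContinuous (A.bondsWithin B)
      fun e he => hins e (SimpleGraph.mem_edgeSet_of_mem_bondsWithin he)
    filter_upwards [ae_openBonds_mem_iff hshift hac hI hinv,
      ae_not_three_infinite_clusters hshift hp hνp hA hins] with ω hω h₃ h
    obtain ⟨hx, hy, hxy⟩ := h
    -- Two infinite clusters still exist after those of `x` and `y` have been joined.
    obtain ⟨u, v, hu, hv, huv⟩ := hω.2 ⟨x, y, hx, hy, hxy⟩
    set H := openGraph (openBonds (A.bondsWithin B) ω) with hH
    have hle : openGraph ω ≤ H := openGraph_le_openBonds _ ω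
    have hjoin : H.Reachable x y :=
      ((hB x (hxB (by simp)) y (hxB (by simp))).mono (A.within_le_openBonds B ω)).mono
        SimpleGraph.within_le
    -- An infinite cluster of `H` other than the joined one contains an infinite cluster of `ω`
    -- distinct from those of `x` and `y`, hence a third one.
    have hthird (w : Fin d → ℤ) (hw : {v | H.Reachable w v}.Infinite) : H.Reachable w x := by
      by_contra hwx
      obtain ⟨z, hwz, hz⟩ := SimpleGraph.exists_infinite_of_join (H := openGraph ω)
        B.finite_toSet (fun u v => openGraph_openBonds_adj (A.bondsWithin_subset B)) hw
      have hzx : ¬ (openGraph ω).Reachable z x := fun h => hwx (hwz.trans (h.mono hle))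
      have hzy : ¬ (openGraph ω).Reachable z y := fun h =>
        hwx ((hwz.trans (h.mono hle)).trans hjoin.symm)
      refine h₃ ![x, y, z] ⟨fun i => ?_, fun i j hij => ?_⟩
      · fin_cases i
        exacts [hx, hy, hz]
      · fin_cases i <;> fin_cases j <;> first | exact absurd rfl hij | skip
        exacts [hxy, fun h => hzx h.symm, fun h => hxy h.symm, fun h => hzy h.symm, hzx, hzy]
    exact huv ((hthird u hu).trans (hthird v hv).symm)
  filter_upwards [ae_all_iff.2 fun x => ae_all_iff.2 (hnot x)] with ω hω C C' hC hC'
  induction C using SimpleGraph.ConnectedComponent.ind with | _ x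
  induction C' using SimpleGraph.ConnectedComponent.ind with | _ y
  by_contra hne
  have hsupp (z : Fin d → ℤ) : ((openGraph ω).connectedComponentMk z).supp =
      {v | (openGraph ω).Reachable z v} := by
    ext v
    rw [SimpleGraph.ConnectedComponent.mem_supp_iff, SimpleGraph.ConnectedComponent.eq]
    exact SimpleGraph.reachable_comm
  rw [hsupp] at hC hC'
  exact hω x y ⟨hC, hC', fun h => hne (SimpleGraph.ConnectedComponent.eq.2 h)⟩

end

/-! ### The trace of the sum of two independent currents -/

section

variable {V : Type*} {P Q : Measure (Current V)}

lemma measurable_trace_add :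
    Measurable fun p : Current V × Current V => Current.trace (p.1 + p.2) := by
  refine measurable_pi_lambda _ fun e => ?_
  have h : Measurable fun p : Current V × Current V => p.1 e + p.2 e :=
    ((measurable_pi_apply e).comp measurable_fst).add ((measurable_pi_apply e).comp measurable_snd)
  exact (measurable_of_countable fun m : ℕ => decide (0 < m)).comp h

lemma isProbabilityMeasure_sumTraceLaw [IsProbabilityMeasure P] [IsProbabilityMeasure Q] :
    IsProbabilityMeasure (sumTraceLaw P Q) :=
  Measure.isProbabilityMeasure_map measurable_trace_add.aemeasurable

lemma sumTraceLaw_map_permute [SFinite P] [SFinite Q] {θ : V ≃ V}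
    (hP : P.map (fun n => n ∘ Bond.permute θ) = P)
    (hQ : Q.map (fun n => n ∘ Bond.permute θ) = Q) :
    (sumTraceLaw P Q).map (fun ω => ω ∘ Bond.permute θ) = sumTraceLaw P Q := by
  have hm : Measurable fun n : Current V => n ∘ Bond.permute θ :=
    measurable_pi_lambda _ fun e => measurable_pi_apply _
  have hm' : Measurable fun ω : Bond V → Bool => ω ∘ Bond.permute θ :=
    measurable_pi_lambda _ fun e => measurable_pi_apply _
  conv_rhs => rw [sumTraceLaw, ← hP, ← hQ, Measure.map_prod_map _ _ hm hm,
    Measure.map_map measurable_trace_add (hm.prodMap hm)]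
  rw [sumTraceLaw, Measure.map_map hm' measurable_trace_add]
  rfl

/-- Opening `e` in the trace amounts to adding two units to the first current there, so the
quasi-invariance of one of the two independent currents suffices. -/
lemma sumTraceLaw_map_openBond [DecidableEq V] [SFinite P] [SFinite Q] {e : Bond V}
    (hP : P.map (addTwo e) ≪ P) :
    (sumTraceLaw P Q).map (openBond e) ≪ sumTraceLaw P Q := by
  have hm := (measurable_addTwo e).prodMap (measurable_id (α := Current V))
  have h : openBond e ∘ (fun p : Current V × Current V => Current.trace (p.1 + p.2)) =
      (fun p : Current V × Current V => Current.trace (p.1 + p.2)) ∘ Prod.map (addTwo e) id := by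
    ext p e'
    by_cases he : e' = e
    · subst he
      simp [openBond, Current.trace, addTwo]
    · simp [openBond, Current.trace, addTwo, Function.update_of_ne he]
  rw [sumTraceLaw, Measure.map_map (measurable_openBond e) measurable_trace_add, h,
    ← Measure.map_map measurable_trace_add hm,
    ← Measure.map_prod_map _ _ (measurable_addTwo e) measurable_id, Measure.map_id]
  exact (hP.prod Measure.AbsolutelyContinuous.rfl).map measurable_trace_add

lemma sumTraceLaw_apply_le [IsProbabilityMeasure P] [IsProbabilityMeasure Q] (e : Bond V) :
    sumTraceLaw P Q {ω | ω e = true} ≤ P {n | n e ≠ 0} + Q {n | n e ≠ 0} := by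
  have hs : MeasurableSet {ω : Bond V → Bool | ω e = true} :=
    (measurable_pi_apply e : Measurable fun ω : Bond V → Bool => ω e)
      (measurableSet_singleton true)
  rw [sumTraceLaw, Measure.map_apply measurable_trace_add hs]
  calc _ ≤ P.prod Q ({n | n e ≠ 0} ×ˢ Set.univ ∪ Set.univ ×ˢ {n | n e ≠ 0}) := by
        refine measure_mono fun p hp => ?_
        simp only [Current.trace, Set.mem_preimage, Set.mem_ofPred_eq, decide_eq_true_eq,
          Pi.add_apply] at hp
        simp only [Set.mem_union, Set.mem_prod, Set.mem_ofPred_eq, Set.mem_univ, and_true,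
          true_and]
        omega
    _ ≤ _ := by
        refine (measure_union_le _ _).trans ?_
        simp [Measure.prod_prod]

end

/-! ### Limits along boxes and along all finite sets -/

section

variable {d : ℕ}

lemma exists_infiniteVolumeLimit_of_net {K : Sym2 (Fin d → ℤ) → ℝ}
    {μ : Finset (Fin d → ℤ) → Measure (Current (Fin d → ℤ))}
    (hμ : ∀ G, IsProbabilityMeasure (μ G))
    (hle : ∀ G e m, μ G (pointCylinder {e} fun _ => m) ≤
      ENNReal.ofReal (currentWeight K {e} fun _ => m))
    (hlim : ∀ E k, ∃ l, Tendsto (fun G => μ G (pointCylinder E k)) atTop (𝓝 l)) :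
    ∃ P, IsInfiniteVolumeLimit (fun L => μ (latticeBox d L)) P :=
  exists_infiniteVolumeLimit (fun _ => hμ _) (fun _ => hle _) fun E k =>
    let ⟨l, hl⟩ := hlim E k
    ⟨l, hl.comp (tendsto_latticeBox d)⟩

lemma IsInfiniteVolumeLimit.tendsto_pointCylinder {V : Type*} {μ : ℕ → Measure (Current V)}
    {P : Measure (Current V)} (hP : IsInfiniteVolumeLimit μ P) (E : Finset (Bond V))
    (k : Current V) :
    Tendsto (fun L => μ L (pointCylinder E k)) atTop (𝓝 (P (pointCylinder E k))) := by
  rw [← preimage_restrict_singleton]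
  exact hP.tendsto E {E.restrict k}

/-- The boxes are cofinal, so the limit of the net is the one already known along the boxes. -/
lemma IsInfiniteVolumeLimit.tendsto_net
    {μ : Finset (Fin d → ℤ) → Measure (Current (Fin d → ℤ))} {P : Measure (Current (Fin d → ℤ))}
    (hP : IsInfiniteVolumeLimit (fun L => μ (latticeBox d L)) P)
    (hlim : ∀ E k, ∃ l, Tendsto (fun G => μ G (pointCylinder E k)) atTop (𝓝 l))
    (E : Finset (Bond (Fin d → ℤ))) (k : Current (Fin d → ℤ)) :
    Tendsto (fun G => μ G (pointCylinder E k)) atTop (𝓝 (P (pointCylinder E k))) := by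
  obtain ⟨l, hl⟩ := hlim E k
  rwa [tendsto_nhds_unique (hP.tendsto_pointCylinder E k) (hl.comp (tendsto_latticeBox d))]

lemma IsInfiniteVolumeLimit.measure_ne_zero_le {V : Type*} {K : Sym2 V → ℝ} (hK : ∀ e, 0 ≤ K e)
    {μ : ℕ → Measure (Current V)} {P : Measure (Current V)} (hP : IsInfiniteVolumeLimit μ P)
    (hle : ∀ L e m, μ L (pointCylinder {e} fun _ => m) ≤
      ENNReal.ofReal (currentWeight K {e} fun _ => m)) (e : Bond V) :
    P {n | n e ≠ 0} ≤ ENNReal.ofReal (K e.1 * Real.exp (K e.1)) :=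
  _root_.measure_ne_zero_le hK e fun m =>
    le_of_tendsto (hP.tendsto_pointCylinder _ _) (Eventually.of_forall fun L => hle L e m)

end

/-- Without open bonds all clusters are finite. -/
lemma ae_atMostOneInfiniteCluster_of_null {V : Type*} [Countable V]
    {ν : Measure (Bond V → Bool)} (hν : ∀ x y, ν {ω | (openGraph ω).Adj x y} = 0) :
    ∀ᵐ ω ∂ν, AtMostOneInfiniteCluster ω := by
  have h : ∀ᵐ ω ∂ν, ∀ x y, ¬ (openGraph ω).Adj x y :=
    ae_all_iff.2 fun x => ae_all_iff.2 fun y => by rw [ae_iff]; simpa using hν x y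
  filter_upwards [h] with ω hω C _ hC
  induction C using SimpleGraph.ConnectedComponent.ind with | _ x
  refine absurd ((Set.finite_singleton x).subset fun v hv => ?_) hC
  have hr : (openGraph ω).Reachable x v :=
    (SimpleGraph.ConnectedComponent.eq.1
      ((SimpleGraph.ConnectedComponent.mem_supp_iff _ _).1 hv)).symm
  exact SimpleGraph.Reachable.tail_induction (p := fun z => z ∈ ({x} : Set V)) rfl
    (fun a c hac _ _ => absurd hac (hω a c)) hr

/-- The graph of the pairs with a positive coupling. -/
def couplingGraph {V : Type*} (J : Sym2 V → ℝ) : SimpleGraph V :=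
  SimpleGraph.fromEdgeSet {e | 0 < J e}

lemma preconnected_couplingGraph {V : Type*} [AddCommGroup V] {J : Sym2 V → ℝ}
    (hshift : ∀ a e, J (e.map (Equiv.addRight a)) = J e) (hJ : ∀ e, 0 ≤ J e)
    (hpath : ∀ x, ∃ (m : ℕ) (p : ℕ → V), p 0 = 0 ∧ p m = x ∧
      0 < ∏ i ∈ Finset.range m, J s(p i, p (i + 1))) :
    (couplingGraph J).Preconnected := by
  have h (x y : V) : (couplingGraph J).Reachable x (y + x) := by
    obtain ⟨m, p, h₀, hm, hp⟩ := hpath y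
    have hpos (i : ℕ) (hi : i < m) : 0 < J s(p i, p (i + 1)) :=
      (hJ _).lt_of_ne' (Finset.prod_ne_zero_iff.1 hp.ne' i (Finset.mem_range.2 hi))
    have hr (i : ℕ) (hi : i ≤ m) : (couplingGraph J).Reachable x (p i + x) := by
      induction i with
      | zero => rw [h₀, zero_add]
      | succ i ih =>
        -- A path may stay at the same vertex, since diagonal couplings can be positive; such a step
        -- is not an edge and is skipped.
        by_cases heq : p i + x = p (i + 1) + x
        · rw [← heq]; exact ih (by omega)
        · refine (ih (by omega)).trans (SimpleGraph.Adj.reachable ?_)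
          rw [couplingGraph, SimpleGraph.fromEdgeSet_adj]
          refine ⟨?_, heq⟩
          have := hshift x s(p i, p (i + 1))
          rw [Sym2.map_mk] at this
          exact (hpos i hi).trans_eq this.symm
    rw [← hm]
    exact hr m le_rfl
  intro x y
  simpa using h x (y - x)

theorem theorem2p3 (d : ℕ) (J : Sym2 (Fin d → ℤ) → ℝ)
    (C1 : ∀ x y, J s(x, y) = J s(0, y - x))
    (C2 : ∀ x y, 0 ≤ J s(x, y))
    (C3 : Summable fun x => J s(0, x))
    (C4 : ∀ x, ∃ (m : ℕ) (p : ℕ → Fin d → ℤ), p 0 = 0 ∧ p m = x ∧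
      0 < ∏ i ∈ Finset.range m, J s(p i, p (i + 1)))
    (β : ℝ) (hβ : 0 ≤ β) :
    (∃ P, IsInfiniteVolumeLimit (fun L => freeCurrentLaw J β (latticeBox d L)) P) ∧
    (∃ P, IsInfiniteVolumeLimit (fun L => plusCurrentLaw J β (latticeBox d L)) P) ∧
    ∀ Pfree Pplus : Measure (Current (Fin d → ℤ)),
      IsInfiniteVolumeLimit (fun L => freeCurrentLaw J β (latticeBox d L)) Pfree →
      IsInfiniteVolumeLimit (fun L => plusCurrentLaw J β (latticeBox d L)) Pplus →
      ∀ᵐ ω ∂(sumTraceLaw Pfree Pplus), AtMostOneInfiniteCluster ω := by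
  have hJ (e : Sym2 (Fin d → ℤ)) : 0 ≤ J e := by
    induction e using Sym2.ind with | _ x y
    exact C2 x y
  have hK (e : Sym2 (Fin d → ℤ)) : 0 ≤ β * J e := mul_nonneg hβ (hJ e)
  have hJshift (a : Fin d → ℤ) (e : Sym2 (Fin d → ℤ)) : J (e.map (Equiv.addRight a)) = J e := by
    induction e using Sym2.ind with | _ x y
    rw [Sym2.map_mk, C1, C1 x y]
    simp
  have hJs (x : Fin d → ℤ) : Summable fun y => J s(x, y) := by
    simp only [C1 x]
    exact (Equiv.subRight x).summable_iff.2 C3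
  have hfree := exists_tendsto_freeCurrentLaw hK
  have hplus := exists_tendsto_plusCurrentLaw hβ hJ hJs
  have hfle (G : Finset (Fin d → ℤ)) := finiteCurrentLaw_singleton_le hK G G
  have hple := plusCurrentLaw_singleton_le hβ hJ
  refine ⟨exists_infiniteVolumeLimit_of_net
      (fun G => isProbabilityMeasure_finiteCurrentLaw hK G G) hfle hfree,
    exists_infiniteVolumeLimit_of_net (isProbabilityMeasure_plusCurrentLaw hβ hJ) hple hplus,
    fun P Q hP hQ => ?_⟩
  have := hP.isProbabilityMeasure
  have := hQ.isProbabilityMeasure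
  have := isProbabilityMeasure_sumTraceLaw (P := P) (Q := Q)
  -- `q (y - x)` bounds the probability that the bond carries a positive current, for each of the
  -- two currents.
  let q (z : Fin d → ℤ) : ℝ := β * J s(0, z) * Real.exp (β * J s(0, z))
  have hbond (x y : Fin d → ℤ) : sumTraceLaw P Q {ω | (openGraph ω).Adj x y} ≤
      ENNReal.ofReal (q (y - x)) + ENNReal.ofReal (q (y - x)) := by
    by_cases hxy : s(x, y).IsDiag
    · refine (measure_mono fun ω hω => ?_).trans (measure_empty.trans_le zero_le)
      exact absurd hxy (openGraph_adj.1 hω).1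
    · have h₁ := hP.measure_ne_zero_le hK (fun L => hfle _) ⟨s(x, y), hxy⟩
      have h₂ := hQ.measure_ne_zero_le hK (fun L => hple _) ⟨s(x, y), hxy⟩
      simp only [C1 x y] at h₁ h₂
      refine (measure_mono fun ω hω => ?_).trans
        ((sumTraceLaw_apply_le ⟨s(x, y), hxy⟩).trans (add_le_add h₁ h₂))
      exact (openGraph_adj.1 hω).2
  -- For `β = 0` no bond can be opened by adding current, but all bonds are closed almost surely.
  rcases hβ.eq_or_lt with rfl | hβ0
  · refine ae_atMostOneInfiniteCluster_of_null fun x y => ?_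
    simpa [q] using hbond x y
  -- Each coupling is at most the total sum, so the exponential factor is bounded uniformly in `z`.
  have hq : Summable q := by
    refine Summable.of_nonneg_of_le (fun z => mul_nonneg (hK _) (Real.exp_nonneg _))
      (fun z => mul_le_mul_of_nonneg_left (Real.exp_le_exp.2 (mul_le_mul_of_nonneg_left
        (C3.le_tsum z fun _ _ => hJ _) hβ)) (hK _)) ((C3.mul_left β).mul_right _)
  have hqsum : ∑' z, (ENNReal.ofReal (q z) + ENNReal.ofReal (q z)) ≠ ∞ := by
    rw [ENNReal.tsum_add]
    exact ENNReal.add_ne_top.2 ⟨hq.tsum_ofReal_ne_top, hq.tsum_ofReal_ne_top⟩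
  refine ae_atMostOneInfiniteCluster (fun a => sumTraceLaw_map_permute ?_ ?_) hqsum hbond
    (preconnected_couplingGraph hJshift hJ C4) fun e he => sumTraceLaw_map_openBond ?_
  · exact map_permute_eq_of_tendsto (hP.tendsto_net hfree)
      fun G E k hE => freeCurrentLaw_map (hJshift a) hK hE k
  · exact map_permute_eq_of_tendsto (hQ.tendsto_net hplus)
      fun G E k hE => plusCurrentLaw_map hβ (hJshift a) hJ hE k
  · rw [couplingGraph, SimpleGraph.edgeSet_fromEdgeSet] at he
    exact map_addTwo_absolutelyContinuous hK (hP.tendsto_net hfree) (mul_pos hβ0 he.1)
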